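/- Let $p$ be a prime and let $k$ be a perfect field of characteristic $p$. **Restricted Lie algebras.** A restricted Lie algebra over $k$ is a Lie algebra $L$ over $k$ with a map $\xi\colon L\to L$ (the $p$-operation) such that $\xi(ax)=a^p\xi(x)$, $[y,\xi(x)]=\mathrm{ad}(x)^p(y)$ where $\mathrm{ad}(x)(y)=[y,x]$, and $\xi(x+y)=\xi(x)+\xi(y)+\sum_{i=1}^{p-1}\tfrac1i s_i(x,y)$, where $s_i(x,y)$ is the coefficient of $t^{i-1}$ in $\mathrm{ad}(tx+y)^{p-1}(x)$. Let $k\{\xi\}$ be the twisted polynomial ring, $\xi a=a^p\xi$ for $a\in k$. The abelianization of $L$ is the left $k\{\xi\}$-module $\mathrm{Ab}(L)=L/[L,L]$, where $[L,L]$ is the restricted Lie ideal generated by all brackets. **Homotopy theory.** Let $\mathsf{sL}$ be the category of simplicial restricted Lie algebras; $\pi_s(L)$ denotes the $s$-th homotopy group of the underlying simplicial vector space. The $p$-operation induces maps $\xi\colon\pi_s(L)\to\pi_s(L)$, and $\pi_0(L)$ is a restricted Lie algebra. $L$ is connected if $\pi_0(L)=0$. A map in $\mathsf{sL}$ is a weak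 equivalence if it induces isomorphisms on all $\pi_s$, an acyclic fibration if it is moreover degreewise surjective, and a cofibration if it has the left lifting property with respect to all acyclic fibrations. A cofibrant replacement of $L$ is a factorization $0\to Q\to L$ of $0\to L$ into a cofibration followed by an acyclic fibration. **Homology.** For a right $k\{\xi\}$-module $M$ put $\widetilde H_s(L;M)=\pi_s\big(\Sigma\, M\otimes^{\mathbb L}_{k\{\xi\}}\mathbb L\mathrm{Ab}(L)\big)$, i.e. $\widetilde H_0(L;M)=0$ and $\widetilde H_{s+1}(L;M)=\pi_s(M\otimes_{k\{\xi\}}\mathrm{Ab}(Q))$ for a cofibrant replacement $Q$ of $L$. In particular $\widetilde H_s(L;k\{\xi\})$ is a left $k\{\xi\}$-module. The Hurewicz homomorphism $h\colon\pi_s(L)\cong\pi_s(Q)\to\pi_s(\mathrm{Ab}(Q))=\widetilde H_{s+1}(L;k\{\xi\})$, $s\ge0$, is induced by the quotient map $Q\to\mathrm{Ab}(Q)$. **Pairs.** A pair $(L,A)$ consists of $L\in\mathsf{sL}$ and a simplicial restricted Lie subalgebra $\iota\colon A\hookrightarrow L$. Let $\mathrm{fib}(\iota)$ and $\mathrm{cofib}(\iota)$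 be the homotopy fiber and homotopy cofiber of $\iota$ in $\mathsf{sL}$. Put $\pi_s(L,A)=\pi_{s-1}(\mathrm{fib}(\iota))$ for $s\ge1$, with the action of $\xi$ on $\pi_{s-1}(\mathrm{fib}(\iota))$, let $\pi_0(L,A)$ be the cokernel of $\pi_0(A)\to\pi_0(L)$, and put $H_s(L,A;M)=\widetilde H_s(\mathrm{cofib}(\iota);M)$. The natural map $\mathrm{fib}(\iota)\to\Omega\,\mathrm{cofib}(\iota)$ followed by the Hurewicz homomorphism of $\mathrm{cofib}(\iota)$ gives the relative Hurewicz homomorphism $h\colon\pi_s(L,A)\to H_{s+1}(L,A;k\{\xi\})$, $s\ge1$. The pair is $n$-connected if $\pi_i(L,A)=0$ for all $0\le i\le n$. **Theorem.** 0. Every map in $\mathsf{sL}$ factors as a cofibration followed by an acyclic fibration; in particular cofibrant replacements exist. The following holds for every choice of cofibrant replacements, and of the factorization of $\iota$ that is used to compute $\mathrm{cofib}(\iota)$. 1. (Hurewicz theorem) Let $L\in\mathsf{sL}$. Then $h(\xi x)=\xi h(x)$ for all $s\ge 0$ and $x\in\pi_s(L)$. The homomorphism $h\colon\pi_0(L)\to\widetilde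 H_1(L;k\{\xi\})$ induces an isomorphism of left $k\{\xi\}$-modules $\mathrm{Ab}(\pi_0(L))\cong\widetilde H_1(L;k\{\xi\})$. If $n\ge0$ and $\pi_i(L)=0$ for $0\le i\le n$, then $h\colon\pi_{n+1}(L)\to\widetilde H_{n+2}(L;k\{\xi\})$ is an isomorphism and $h\colon\pi_{n+2}(L)\to\widetilde H_{n+3}(L;k\{\xi\})$ is surjective. 2. (Relative Hurewicz theorem) Let $(L,A)$ be a pair. Then $h(\xi x)=\xi h(x)$ for all $s\ge 1$ and $x\in\pi_s(L,A)$. If $n\ge1$, the pair $(L,A)$ is $n$-connected and $\pi_0(A)=0$, then $h\colon\pi_{n+1}(L,A)\to H_{n+2}(L,A;k\{\xi\})$ is an isomorphism and $h\colon\pi_{n+2}(L,A)\to H_{n+3}(L,A;k\{\xi\})$ is surjective. 3. (Homological Whitehead theorem) Let $f\colon L'\to L$ be a map between connected simplicial restricted Lie algebras. Then $f$ is a weak equivalence if and only if $f_*\colon\widetilde H_i(L';k\{\xi\})\to\widetilde H_i(L;k\{\xi\})$ is an isomorphism for all $i\ge1$. -/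

import Mathlib

open CategoryTheory Opposite Simplicial TensorProduct

universe u v w

noncomputable section

namespace SRLie

/-! ### Restricted Lie algebras -/

/-- With the convention `ad(u)(w) = [w, u]`, this is the coefficient of `t ^ j` in the formal
expression `ad(t x + y) ^ m (x)`, computed by expanding one factor `ad(t x + y)` at a time. -/
def adCoeff {L : Type*} [LieRing L] (x y : L) (m j : ℕ) : L :=
  match m, j with
  | 0, 0 => x
  | 0, _ + 1 => 0
  | m + 1, 0 => ⁅adCoeff x y m 0, y⁆
  | m + 1, j + 1 => ⁅adCoeff x y m j, x⁆ + ⁅adCoeff x y m (j + 1), y⁆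

/-- A restricted Lie algebra structure (a `p`-operation `ξ = pOp`) on a Lie algebra over `k`. -/
class RestrictedLieAlgebra (p : ℕ) (k L : Type*) [Field k] [LieRing L] [LieAlgebra k L] where
  pOp : L → L
  pOp_smul : ∀ (a : k) (x : L), pOp (a • x) = a ^ p • pOp x
  lie_pOp : ∀ x y : L, ⁅y, pOp x⁆ = (fun z : L => ⁅z, x⁆)^[p] y
  pOp_add : ∀ x y : L, pOp (x + y) = pOp x + pOp y +
    ∑ i ∈ Finset.Icc 1 (p - 1), ((i : k)⁻¹) • adCoeff x y (p - 1) (i - 1)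

/-- The `p`-operation. -/
abbrev pOp (p : ℕ) (k : Type*) {L : Type*} [Field k] [LieRing L] [LieAlgebra k L]
    [RestrictedLieAlgebra p k L] (x : L) : L := RestrictedLieAlgebra.pOp p k x

section basic

variable {p : ℕ} {k : Type*} [Field k]
variable {L L' L'' : Type*} [LieRing L] [LieAlgebra k L] [LieRing L'] [LieAlgebra k L']
  [LieRing L''] [LieAlgebra k L'']

theorem map_adCoeff (f : L →ₗ⁅k⁆ L') (x y : L) (m j : ℕ) :
    f (adCoeff x y m j) = adCoeff (f x) (f y) m j := by
  induction m generalizing j with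
  | zero => cases j <;> simp [adCoeff]
  | succ m ih => cases j <;> simp [adCoeff, ih]

theorem map_lie_iterate (f : L →ₗ⁅k⁆ L') (x y : L) (m : ℕ) :
    f ((fun z : L => ⁅z, x⁆)^[m] y) = (fun z : L' => ⁅z, f x⁆)^[m] (f y) :=
  (Function.Semiconj.iterate_right (f := f) (ga := fun z : L => ⁅z, x⁆)
    (gb := fun z : L' => ⁅z, f x⁆) (fun z => by simp) m) y

variable [RestrictedLieAlgebra p k L] [RestrictedLieAlgebra p k L'] [RestrictedLieAlgebra p k L'']

theorem pOp_zero [Fact p.Prime] : pOp p k (0 : L) = 0 := by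
  have h := RestrictedLieAlgebra.pOp_smul (p := p) (0 : k) (0 : L)
  simpa [(Fact.out : p.Prime).ne_zero] using h

variable (p k L L') in
/-- Homomorphisms of restricted Lie algebras. -/
structure RestrictedLieHom extends L →ₗ⁅k⁆ L' where
  map_pOp : ∀ x, toFun (pOp p k x) = pOp p k (toFun x)

/-- An injective Lie algebra map compatible with given `p`-operations transports the axioms. -/
@[reducible] def RestrictedLieAlgebra.ofInjective {N : Type*} [LieRing N] [LieAlgebra k N]
    (f : N →ₗ⁅k⁆ L) (hf : Function.Injective f) (op : N → N)
    (hop : ∀ x, f (op x) = pOp p k (f x)) : RestrictedLieAlgebra p k N where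
  pOp := op
  pOp_smul a x := hf (by simp [hop, RestrictedLieAlgebra.pOp_smul])
  lie_pOp x y := hf (by rw [LieHom.map_lie, hop, RestrictedLieAlgebra.lie_pOp, map_lie_iterate])
  pOp_add x y := hf (by
    simp [hop, RestrictedLieAlgebra.pOp_add, map_adCoeff])

/-- A surjective Lie algebra map compatible with given `p`-operations transports the axioms. -/
@[reducible] def RestrictedLieAlgebra.ofSurjective {N : Type*} [LieRing N] [LieAlgebra k N]
    (f : L →ₗ⁅k⁆ N) (hf : Function.Surjective f) (op : N → N)
    (hop : ∀ x, op (f x) = f (pOp p k x)) : RestrictedLieAlgebra p k N where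
  pOp := op
  pOp_smul a x := by
    obtain ⟨x, rfl⟩ := hf x
    rw [← map_smul, hop, hop, RestrictedLieAlgebra.pOp_smul, map_smul]
  lie_pOp x y := by
    obtain ⟨x, rfl⟩ := hf x
    obtain ⟨y, rfl⟩ := hf y
    rw [hop, ← LieHom.map_lie, RestrictedLieAlgebra.lie_pOp, map_lie_iterate]
  pOp_add x y := by
    obtain ⟨x, rfl⟩ := hf x
    obtain ⟨y, rfl⟩ := hf y
    rw [← map_add, hop, hop, hop, RestrictedLieAlgebra.pOp_add]
    simp [map_adCoeff]

/-- The product, with the componentwise `p`-operation. -/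
instance : RestrictedLieAlgebra p k (L × L') where
  pOp x := (pOp p k x.1, pOp p k x.2)
  pOp_smul a x := by ext <;> simp [RestrictedLieAlgebra.pOp_smul]
  lie_pOp x y := by
    ext
    · exact (RestrictedLieAlgebra.lie_pOp x.1 y.1).trans
        (map_lie_iterate (LieHom.fst k L L') x y p).symm
    · exact (RestrictedLieAlgebra.lie_pOp x.2 y.2).trans
        (map_lie_iterate (LieHom.snd k L L') x y p).symm
  pOp_add x y := by
    ext
    · refine (RestrictedLieAlgebra.pOp_add x.1 y.1).trans ?_
      simp only [Prod.fst_add, Prod.fst_sum, Prod.smul_fst]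
      congr 1
      exact Finset.sum_congr rfl fun i _ =>
        congrArg _ (map_adCoeff (LieHom.fst k L L') x y _ _).symm
    · refine (RestrictedLieAlgebra.pOp_add x.2 y.2).trans ?_
      simp only [Prod.snd_add, Prod.snd_sum, Prod.smul_snd]
      congr 1
      exact Finset.sum_congr rfl fun i _ =>
        congrArg _ (map_adCoeff (LieHom.snd k L L') x y _ _).symm

variable (p k L) in
/-- Restricted Lie subalgebras. -/
structure RestrictedSubalgebra extends LieSubalgebra k L where
  pOp_mem : ∀ x ∈ carrier, pOp p k x ∈ carrier

instance (K : RestrictedSubalgebra p k L) : RestrictedLieAlgebra p k K.toLieSubalgebra :=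
  RestrictedLieAlgebra.ofInjective K.toLieSubalgebra.incl Subtype.val_injective
    (fun x => ⟨pOp p k x.1, K.pOp_mem x.1 x.2⟩) (fun _ => rfl)

variable (p k L) in
/-- Restricted Lie ideals. -/
structure RestrictedIdeal extends LieIdeal k L where
  pOp_mem : ∀ x ∈ carrier, pOp p k x ∈ carrier

namespace RestrictedIdeal

variable (I : RestrictedIdeal p k L)

/-- The quotient of the underlying Lie algebra. -/
abbrev Quotient : Type _ := L ⧸ I.toLieSubmodule

/-- The quotient map as a homomorphism of Lie algebras. -/
def mkLie : L →ₗ⁅k⁆ I.Quotient :=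
  { I.toLieSubmodule.toSubmodule.mkQ with map_lie' := fun {_ _} => rfl }

theorem mkLie_surjective : Function.Surjective I.mkLie :=
  I.toLieSubmodule.toSubmodule.mkQ_surjective

theorem mkLie_eq_iff (x y : L) : I.mkLie x = I.mkLie y ↔ x - y ∈ I.toLieSubmodule :=
  Submodule.Quotient.eq I.toLieSubmodule.toSubmodule

theorem adCoeff_mem (x u : L) (hu : u ∈ I.toLieSubmodule) (m j : ℕ) :
    adCoeff x u (m + 1) j ∈ I.toLieSubmodule := by
  induction m generalizing j with
  | zero =>
    rcases j with _ | _ | j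
    · exact lie_mem_right k L I.toLieSubmodule _ _ hu
    · simp [adCoeff]
    · simp [adCoeff]
  | succ m ih =>
    cases j with
    | zero => exact lie_mem_right k L I.toLieSubmodule _ _ hu
    | succ j =>
      exact add_mem (lie_mem_left k L I.toLieSubmodule _ _ (ih j))
        (lie_mem_right k L I.toLieSubmodule _ _ hu)

theorem mkLie_pOp_eq [hp : Fact p.Prime] {x y : L} (h : I.mkLie x = I.mkLie y) :
    I.mkLie (pOp p k x) = I.mkLie (pOp p k y) := by
  rw [mkLie_eq_iff] at h ⊢
  obtain ⟨u, rfl⟩ : ∃ u, x = y + u := ⟨x - y, by abel⟩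
  rw [add_sub_cancel_left] at h
  rw [pOp, RestrictedLieAlgebra.pOp_add, add_assoc, add_sub_cancel_left]
  refine add_mem (I.pOp_mem _ h) (sum_mem fun i _ => ?_)
  obtain ⟨m, hm⟩ : ∃ m, p - 1 = m + 1 := ⟨p - 2, by have := hp.out.two_le; omega⟩
  rw [hm]
  exact SMulMemClass.smul_mem _ (I.adCoeff_mem _ _ h _ _)

instance [Fact p.Prime] : RestrictedLieAlgebra p k I.Quotient :=
  RestrictedLieAlgebra.ofSurjective I.mkLie I.mkLie_surjective
    (fun q => I.mkLie (pOp p k (Function.surjInv I.mkLie_surjective q)))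
    (fun _ => I.mkLie_pOp_eq (Function.surjInv_eq I.mkLie_surjective _))

theorem pOp_mkLie [Fact p.Prime] (x : L) : pOp p k (I.mkLie x) = I.mkLie (pOp p k x) :=
  I.mkLie_pOp_eq (Function.surjInv_eq I.mkLie_surjective _)

theorem mem_sInf_lieIdeal {S : Set (LieIdeal k L)} {x : L} : x ∈ sInf S ↔ ∀ N ∈ S, x ∈ N := by
  rw [← SetLike.mem_coe, LieSubmodule.coe_sInf]
  simp

variable (p k) in
/-- The restricted Lie ideal generated by a set. -/
def gen (S : Set L) : RestrictedIdeal p k L where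
  toLieSubmodule := sInf {N | ∃ J : RestrictedIdeal p k L, S ⊆ J.carrier ∧ J.toLieSubmodule = N}
  pOp_mem x hx := by
    have hx' : x ∈ sInf {N | ∃ J : RestrictedIdeal p k L,
      S ⊆ J.carrier ∧ J.toLieSubmodule = N} := hx
    change pOp p k x ∈ sInf {N | ∃ J : RestrictedIdeal p k L,
      S ⊆ J.carrier ∧ J.toLieSubmodule = N}
    rw [mem_sInf_lieIdeal] at hx' ⊢
    rintro N ⟨J, hJ, rfl⟩
    exact J.pOp_mem _ (hx' _ ⟨J, hJ, rfl⟩)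

theorem mem_gen {S : Set L} {x : L} : x ∈ (gen p k S).toLieSubmodule ↔
    ∀ J : RestrictedIdeal p k L, S ⊆ J.carrier → x ∈ J.toLieSubmodule := by
  change x ∈ sInf {N | ∃ J : RestrictedIdeal p k L, S ⊆ J.carrier ∧ J.toLieSubmodule = N} ↔ _
  rw [mem_sInf_lieIdeal]
  exact ⟨fun h J hJ => h _ ⟨J, hJ, rfl⟩, fun h N ⟨J, hJ, e⟩ => e ▸ h J hJ⟩

theorem subset_gen {S : Set L} {x : L} (hx : x ∈ S) : x ∈ (gen p k S).toLieSubmodule :=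
  mem_gen.2 fun _ hJ => hJ hx

/-- Preimage of a restricted Lie ideal under a homomorphism. -/
def comap (f : RestrictedLieHom p k L L') (J : RestrictedIdeal p k L') :
    RestrictedIdeal p k L where
  toLieSubmodule := LieIdeal.comap f.toLieHom J.toLieSubmodule
  pOp_mem x hx := by
    change f.toLieHom (pOp p k x) ∈ J.toLieSubmodule
    have h : f.toLieHom (pOp p k x) = pOp p k (f.toLieHom x) := f.map_pOp x
    rw [h]
    exact J.pOp_mem _ hx

theorem gen_le_comap (f : RestrictedLieHom p k L L') {S : Set L} {S' : Set L'}
    (h : ∀ x ∈ S, f.toLieHom x ∈ S') {x : L} (hx : x ∈ (gen p k S).toLieSubmodule) :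
    f.toLieHom x ∈ (gen p k S').toLieSubmodule :=
  mem_gen.1 hx (comap f (gen p k S')) fun y hy => subset_gen (h y hy)

/-- The map of quotients induced by a homomorphism. -/
def mapQuotient [Fact p.Prime] (f : RestrictedLieHom p k L L') (I : RestrictedIdeal p k L)
    (J : RestrictedIdeal p k L')
    (h : ∀ x ∈ I.toLieSubmodule, f.toLieHom x ∈ J.toLieSubmodule) :
    RestrictedLieHom p k I.Quotient J.Quotient where
  toLinearMap := Submodule.mapQ I.toLieSubmodule.toSubmodule J.toLieSubmodule.toSubmodule
    (f.toLieHom : L →ₗ[k] L') h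
  map_lie' {x y} := by
    obtain ⟨x, rfl⟩ := I.mkLie_surjective x
    obtain ⟨y, rfl⟩ := I.mkLie_surjective y
    change J.mkLie (f.toLieHom ⁅x, y⁆) = ⁅J.mkLie (f.toLieHom x), J.mkLie (f.toLieHom y)⁆
    simp
  map_pOp x := by
    obtain ⟨x, rfl⟩ := I.mkLie_surjective x
    rw [pOp_mkLie]
    change J.mkLie (f.toLieHom (pOp p k x)) = pOp p k (J.mkLie (f.toLieHom x))
    rw [pOp_mkLie]
    exact congrArg _ (f.map_pOp x)

end RestrictedIdeal

end basic

/-! ### The twisted polynomial ring -/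

section twisted

variable (p : ℕ) (k : Type u) [Field k] [Fact p.Prime] [CharP k p]

/-- The action of the monoid `ℕ` on `k` by powers of the Frobenius endomorphism. -/
@[reducible] def frobAction : MulSemiringAction (Multiplicative ℕ) k where
  smul n a := iterateFrobenius k p n.toAdd a
  one_smul a := by
    change iterateFrobenius k p 0 a = a
    simp
  mul_smul m n a := by
    change iterateFrobenius k p (m.toAdd + n.toAdd) a =
      iterateFrobenius k p m.toAdd (iterateFrobenius k p n.toAdd a)
    rw [iterateFrobenius_add_apply]
  smul_zero n := map_zero (iterateFrobenius k p n.toAdd)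
  smul_add n := map_add (iterateFrobenius k p n.toAdd)
  smul_one n := map_one (iterateFrobenius k p n.toAdd)
  smul_mul n := map_mul (iterateFrobenius k p n.toAdd)

/-- The twisted polynomial ring `k{ξ}`: polynomials `∑ aᵢ ξⁱ` with `ξ a = a ^ p ξ`. -/
def TwistedPoly (_p : ℕ) (k : Type u) [Field k] : Type u := SkewPolynomial k

instance : Ring (TwistedPoly p k) :=
  letI := frobAction p k
  inferInstanceAs (Ring (SkewPolynomial k))

namespace TwistedPoly

/-- The inclusion of constants `k → k{ξ}`. -/
def C : k →+* TwistedPoly p k :=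
  letI := frobAction p k
  (SkewPolynomial.CRingHom : k →+* SkewPolynomial k)

/-- The variable `ξ`. -/
def X : TwistedPoly p k := (SkewPolynomial.X : SkewPolynomial k)

theorem X_mul_C (a : k) : X p k * C p k a = C p k (a ^ p) * X p k := by
  let _ := frobAction p k
  have h : (Multiplicative.ofAdd 1 : Multiplicative ℕ) • a = a ^ p := by
    change iterateFrobenius k p 1 a = a ^ p
    simp [frobenius_def]
  have key : (SkewMonoidAlgebra.single (Multiplicative.ofAdd 1) 1 * SkewMonoidAlgebra.single 1 a :
      SkewMonoidAlgebra k (Multiplicative ℕ)) =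
      SkewMonoidAlgebra.single 1 (a ^ p) * SkewMonoidAlgebra.single (Multiplicative.ofAdd 1) 1 := by
    rw [SkewMonoidAlgebra.single_mul_single, SkewMonoidAlgebra.single_mul_single, h]
    simp
  exact key

variable {p k} {V : Type*} [AddCommGroup V] [Module k V] (F : AddMonoid.End V)

/-- The ring homomorphism `k{ξ} → End V`, `∑ aᵢ ξⁱ ↦ ∑ aᵢ Fⁱ`, for a Frobenius-semilinear
additive endomorphism `F` of a `k`-vector space. -/
def toEnd (hF : ∀ (a : k) (v : V), F (a • v) = a ^ p • F v) :
    TwistedPoly p k →+* AddMonoid.End V :=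
  letI := frobAction p k
  SkewMonoidAlgebra.liftNCRingHom (Module.toAddMonoidEnd k V)
    (powersHom (AddMonoid.End V) F) (by
      have key : ∀ (n : ℕ) (a : k) (v : V),
          (F ^ n) (a • v) =
            iterateFrobenius k p n a • (F ^ n) v := by
        intro n
        induction n with
        | zero => intro a v; simp
        | succ n ih =>
          intro a v
          simp only [pow_succ', AddMonoid.End.coe_mul, Function.comp_apply, ih]
          refine (hF _ _).trans ?_
          congr 1
          simp [iterateFrobenius_def, pow_succ, pow_mul]
      intro a n
      ext v
      exact (key n.toAdd a v).symm)

/-- The left `k{ξ}`-module structure given by a Frobenius-semilinear endomorphism. -/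
@[reducible] def moduleOf (hF : ∀ (a : k) (v : V), F (a • v) = a ^ p • F v) :
    Module (TwistedPoly p k) V :=
  Module.compHom V (toEnd F hF)

theorem toEnd_single (hF : ∀ (a : k) (v : V), F (a • v) = a ^ p • F v)
    (g : Multiplicative ℕ) (a : k) (v : V) :
    toEnd F hF (SkewMonoidAlgebra.single g a : SkewPolynomial k) v = a • (F ^ g.toAdd) v := by
  let _ := frobAction p k
  change (SkewMonoidAlgebra.liftNC (Module.toAddMonoidEnd k V : k →+ AddMonoid.End V)
    (powersHom (AddMonoid.End V) F) (SkewMonoidAlgebra.single g a) : AddMonoid.End V) v = _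
  rw [SkewMonoidAlgebra.liftNC_single]
  rfl

theorem toEnd_C (hF : ∀ (a : k) (v : V), F (a • v) = a ^ p • F v) (a : k) (v : V) :
    toEnd F hF (C p k a) v = a • v :=
  toEnd_single F hF 1 a v

theorem toEnd_X (hF : ∀ (a : k) (v : V), F (a • v) = a ^ p • F v) (v : V) :
    toEnd F hF (X p k) v = F v :=
  (toEnd_single F hF (Multiplicative.ofAdd 1) 1 v).trans (by simp)

/-- A map of `k`-vector spaces commuting with the semilinear endomorphisms is `k{ξ}`-linear. -/
theorem map_toEnd {W : Type*} [AddCommGroup W] [Module k W] (G : AddMonoid.End W)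
    (hF : ∀ (a : k) (v : V), F (a • v) = a ^ p • F v)
    (hG : ∀ (a : k) (w : W), G (a • w) = a ^ p • G w) (f : V →ₗ[k] W)
    (hf : ∀ v, f (F v) = G (f v)) (r : TwistedPoly p k) (v : V) :
    f (toEnd F hF r v) = toEnd G hG r (f v) := by
  let _ := frobAction p k
  have key : ∀ (n : ℕ) (v : V),
      f ((F ^ n) v) = (G ^ n) (f v) := by
    intro n
    induction n with
    | zero => intro v; rfl
    | succ n ih =>
      intro v
      simp only [pow_succ', AddMonoid.End.coe_mul, Function.comp_apply, ← ih]
      exact hf _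
  have main : ∀ r : SkewPolynomial k, f (toEnd F hF r v) = toEnd G hG r (f v) := by
    intro r
    induction r using SkewMonoidAlgebra.induction_on with
    | zero =>
      change f (toEnd F hF (0 : TwistedPoly p k) v) = toEnd G hG (0 : TwistedPoly p k) (f v)
      simp
    | single g a => rw [toEnd_single, toEnd_single, map_smul, key]
    | add x y hx hy =>
      have hadd : ∀ x y : TwistedPoly p k, f (toEnd F hF x v) = toEnd G hG x (f v) →
          f (toEnd F hF y v) = toEnd G hG y (f v) →
          f (toEnd F hF (x + y) v) = toEnd G hG (x + y) (f v) := by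
        intro x y hx hy
        rw [map_add, map_add]
        change f (toEnd F hF x v + toEnd F hF y v) = toEnd G hG x (f v) + toEnd G hG y (f v)
        rw [map_add, hx, hy]
      exact hadd x y hx hy
  exact main r

end TwistedPoly

end twisted

/-! ### The category of restricted Lie algebras and the abelianization -/

section cat

variable (p : ℕ) (k : Type u) [Field k]

/-- The category of restricted Lie algebras over `k`. -/
structure RLieCat : Type (u + 1) where
  carrier : Type u
  [lieRing : LieRing carrier]
  [lieAlgebra : LieAlgebra k carrier]
  [restricted : RestrictedLieAlgebra p k carrier]

attribute [instance] RLieCat.lieRing RLieCat.lieAlgebra RLieCat.restricted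

variable {p k}

instance : CoeSort (RLieCat p k) (Type u) := ⟨RLieCat.carrier⟩

@[ext] theorem RestrictedLieHom.ext {X Y : RLieCat p k} {f g : RestrictedLieHom p k X Y}
    (h : ∀ x, f.toLieHom x = g.toLieHom x) : f = g := by
  cases f; cases g
  congr
  exact LieHom.ext h

instance : Category (RLieCat p k) where
  Hom X Y := RestrictedLieHom p k X Y
  id X := { toLieHom := LieHom.id, map_pOp := fun _ => rfl }
  comp f g :=
    { toLieHom := g.toLieHom.comp f.toLieHom
      map_pOp := fun x => (congrArg g.toLieHom (f.map_pOp x)).trans (g.map_pOp _) }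

namespace RLieCat

variable {X Y Z : RLieCat p k}

/-- The Lie algebra homomorphism underlying a morphism. -/
abbrev lieHom (f : X ⟶ Y) : X →ₗ⁅k⁆ Y := RestrictedLieHom.toLieHom f

theorem lieHom_pOp (f : X ⟶ Y) (x : X) : lieHom f (pOp p k x) = pOp p k (lieHom f x) :=
  RestrictedLieHom.map_pOp f x

@[simp] theorem lieHom_id (x : X) : lieHom (𝟙 X) x = x := rfl

@[simp] theorem lieHom_comp (f : X ⟶ Y) (g : Y ⟶ Z) (x : X) :
    lieHom (f ≫ g) x = lieHom g (lieHom f x) := rfl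

theorem hom_ext {f g : X ⟶ Y} (h : ∀ x, lieHom f x = lieHom g x) : f = g :=
  RestrictedLieHom.ext h

theorem lieHom_congr {f g : X ⟶ Y} (h : f = g) (x : X) : lieHom f x = lieHom g x := by rw [h]

variable (p k) in
/-- The underlying vector space of a restricted Lie algebra. -/
def oblv : RLieCat p k ⥤ ModuleCat.{u} k where
  obj X := ModuleCat.of k X
  map f := ModuleCat.ofHom (lieHom f : _ →ₗ[k] _)

end RLieCat

section Ab

variable (p k) (L : Type*) [LieRing L] [LieAlgebra k L] [RestrictedLieAlgebra p k L]

/-- `[L, L]`: the restricted Lie ideal generated by all brackets. -/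
def commIdeal : RestrictedIdeal p k L := RestrictedIdeal.gen p k {z | ∃ x y : L, ⁅x, y⁆ = z}

/-- The abelianization `L / [L, L]`. -/
abbrev Ab : Type _ := (commIdeal p k L).Quotient

namespace Ab

/-- The quotient map `L → L / [L, L]`. -/
def mk : L →ₗ[k] Ab p k L := ((commIdeal p k L).mkLie : L →ₗ[k] (commIdeal p k L).Quotient)

theorem mk_surjective : Function.Surjective (mk p k L) := (commIdeal p k L).mkLie_surjective

theorem mk_lie (x y : L) : mk p k L ⁅x, y⁆ = 0 :=
  (Submodule.Quotient.mk_eq_zero _).2 (RestrictedIdeal.subset_gen ⟨x, y, rfl⟩)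

theorem mk_adCoeff (x y : L) (m j : ℕ) : mk p k L (adCoeff x y (m + 1) j) = 0 := by
  cases j with
  | zero => exact mk_lie p k L _ _
  | succ j =>
    refine (map_add (mk p k L) _ _).trans ?_
    rw [mk_lie, mk_lie, add_zero]

variable [Fact p.Prime]

/-- The `p`-operation on `L / [L, L]`, which is additive. -/
def frob : AddMonoid.End (Ab p k L) where
  toFun x := pOp p k x
  map_zero' := pOp_zero
  map_add' x y := by
    obtain ⟨x, rfl⟩ := mk_surjective p k L x
    obtain ⟨y, rfl⟩ := mk_surjective p k L y
    rw [← map_add]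
    refine ((commIdeal p k L).pOp_mkLie (x + y)).trans ?_
    rw [pOp, RestrictedLieAlgebra.pOp_add]
    change mk p k L _ = _
    rw [map_add, map_add, map_sum]
    refine (add_eq_left.2 (Finset.sum_eq_zero fun i _ => ?_)).trans
      (congrArg₂ _ ((commIdeal p k L).pOp_mkLie x).symm ((commIdeal p k L).pOp_mkLie y).symm)
    obtain ⟨m, hm⟩ : ∃ m, p - 1 = m + 1 :=
      ⟨p - 2, by have := (Fact.out : p.Prime).two_le; omega⟩
    rw [hm, map_smul, mk_adCoeff, smul_zero]

theorem frob_mk (x : L) : frob p k L (mk p k L x) = mk p k L (pOp p k x) :=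
  (commIdeal p k L).pOp_mkLie x

theorem frob_smul (a : k) (x : Ab p k L) : frob p k L (a • x) = a ^ p • frob p k L x :=
  RestrictedLieAlgebra.pOp_smul (p := p) a x

variable [CharP k p]

/-- `L / [L, L]` is a left `k{ξ}`-module, `ξ` acting by the `p`-operation. -/
instance : Module (TwistedPoly p k) (Ab p k L) :=
  TwistedPoly.moduleOf (frob p k L) (frob_smul p k L)

theorem C_smul (a : k) (x : Ab p k L) : TwistedPoly.C p k a • x = a • x :=
  TwistedPoly.toEnd_C (frob p k L) (frob_smul p k L) a x

theorem X_smul (x : Ab p k L) : TwistedPoly.X p k • x = frob p k L x :=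
  TwistedPoly.toEnd_X (frob p k L) (frob_smul p k L) x

variable {L} {L' : Type*} [LieRing L'] [LieAlgebra k L'] [RestrictedLieAlgebra p k L']

variable {p k} in
/-- Functoriality of the abelianization. -/
def map (f : RestrictedLieHom p k L L') : Ab p k L →ₗ[TwistedPoly p k] Ab p k L' where
  toFun := RestrictedLieHom.toLieHom (RestrictedIdeal.mapQuotient f (commIdeal p k L)
    (commIdeal p k L') (fun _ hx => RestrictedIdeal.gen_le_comap f
      (by rintro _ ⟨x, y, rfl⟩; exact ⟨f.toLieHom x, f.toLieHom y, (f.toLieHom.map_lie x y).symm⟩)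
      hx))
  map_add' x y := map_add (RestrictedLieHom.toLieHom _) x y
  map_smul' r x := TwistedPoly.map_toEnd (frob p k L) (frob p k L') (frob_smul p k L)
    (frob_smul p k L') (RestrictedLieHom.toLieHom (RestrictedIdeal.mapQuotient f (commIdeal p k L)
      (commIdeal p k L') _) : _ →ₗ[k] _) (fun v => RestrictedLieHom.map_pOp _ v) r x

theorem map_mk (f : RestrictedLieHom p k L L') (x : L) :
    map f (mk p k L x) = mk p k L' (f.toLieHom x) := rfl

end Ab

end Ab

variable [Fact p.Prime] [CharP k p]

variable (p k) in
/-- The abelianization functor from restricted Lie algebras to left `k{ξ}`-modules. -/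
def abFunctor : RLieCat p k ⥤ ModuleCat.{u} (TwistedPoly p k) where
  obj L := ModuleCat.of _ (Ab p k L)
  map f := ModuleCat.ofHom (Ab.map f)
  map_id L := by
    ext x
    obtain ⟨x, rfl⟩ := Ab.mk_surjective p k L x
    rfl
  map_comp {L L' L''} f g := by
    ext x
    obtain ⟨x, rfl⟩ := Ab.mk_surjective p k L x
    rfl

end cat

/-! ### Homotopy groups of simplicial modules -/

section homotopy

variable {S : Type v} {T : Type w} [Ring S] [Ring T] {σ : S →+* T}

/-- Simplicial modules. -/
abbrev SMod (S : Type v) [Ring S] := SimplicialObject (ModuleCat.{u} S)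

/-- The `n`-simplices all of whose faces vanish. -/
def cycles (Y : SMod.{u} S) (n : ℕ) : Submodule S (Y _⦋n⦌) :=
  match n with
  | 0 => ⊤
  | n + 1 => ⨅ i : Fin (n + 2), LinearMap.ker (Y.δ i).hom

/-- The `n`-simplices of the form `d₀ y` with `dᵢ y = 0` for all `i > 0`. -/
def boundaries (Y : SMod.{u} S) (n : ℕ) : Submodule S (Y _⦋n⦌) :=
  Submodule.map (Y.δ 0).hom (⨅ i : Fin (n + 1), LinearMap.ker (Y.δ i.succ).hom)

/-- The homotopy group `πₙ(Y)`. -/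
abbrev PiGroup (Y : SMod.{u} S) (n : ℕ) : Type u :=
  cycles Y n ⧸ (boundaries Y n).comap (cycles Y n).subtype

theorem mem_cycles_succ {Y : SMod.{u} S} {n : ℕ} {y : Y _⦋n + 1⦌} :
    y ∈ cycles Y (n + 1) ↔ ∀ i : Fin (n + 2), (Y.δ i).hom y = 0 := by
  simp [cycles, Submodule.mem_iInf]

theorem mem_boundaries {Y : SMod.{u} S} {n : ℕ} {z : Y _⦋n⦌} :
    z ∈ boundaries Y n ↔ ∃ y : Y _⦋n + 1⦌,
      (∀ i : Fin (n + 1), (Y.δ i.succ).hom y = 0) ∧ (Y.δ 0).hom y = z := by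
  simp [boundaries, Submodule.mem_map, Submodule.mem_iInf]

/-- The class of a cycle. -/
abbrev PiGroup.mk {Y : SMod.{u} S} {n : ℕ} (z : cycles Y n) : PiGroup Y n := Submodule.Quotient.mk z

theorem PiGroup.mk_eq_mk {Y : SMod.{u} S} {n : ℕ} {z z' : cycles Y n} :
    PiGroup.mk z = PiGroup.mk z' ↔ (z : Y _⦋n⦌) - z' ∈ boundaries Y n :=
  Submodule.Quotient.eq _

theorem PiGroup.mk_eq_zero {Y : SMod.{u} S} {n : ℕ} {z : cycles Y n} :
    PiGroup.mk z = 0 ↔ (z : Y _⦋n⦌) ∈ boundaries Y n :=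
  Submodule.Quotient.mk_eq_zero _

section mapSemi

variable {Y : SMod.{u} S} {Z : SMod.{u} T} (g : ∀ n : ℕ, Y _⦋n⦌ →ₛₗ[σ] Z _⦋n⦌)

theorem mapSemi_cycles
    (hg : ∀ (n : ℕ) (i : Fin (n + 2)) (y : Y _⦋n + 1⦌),
      (Z.δ i).hom (g (n + 1) y) = g n ((Y.δ i).hom y))
    {n : ℕ} {y : Y _⦋n⦌} (hy : y ∈ cycles Y n) : g n y ∈ cycles Z n := by
  cases n with
  | zero => trivial
  | succ n =>
    rw [mem_cycles_succ] at hy ⊢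
    intro i
    rw [hg, hy, map_zero]

theorem mapSemi_boundaries
    (hg : ∀ (n : ℕ) (i : Fin (n + 2)) (y : Y _⦋n + 1⦌),
      (Z.δ i).hom (g (n + 1) y) = g n ((Y.δ i).hom y))
    {n : ℕ} {y : Y _⦋n⦌} (hy : y ∈ boundaries Y n) :
    g n y ∈ boundaries Z n := by
  rw [mem_boundaries] at hy ⊢
  obtain ⟨w, hw, rfl⟩ := hy
  exact ⟨g (n + 1) w, fun i => by rw [hg, hw, map_zero], hg n 0 w⟩

/-- The map on homotopy groups induced by degreewise semilinear maps commuting with faces. -/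
def PiGroup.mapSemi
    (hg : ∀ (n : ℕ) (i : Fin (n + 2)) (y : Y _⦋n + 1⦌),
      (Z.δ i).hom (g (n + 1) y) = g n ((Y.δ i).hom y))
    (n : ℕ) : PiGroup Y n →ₛₗ[σ] PiGroup Z n :=
  Submodule.mapQ _ _ (((g n).comp (cycles Y n).subtype).codRestrict (cycles Z n)
    (fun y => mapSemi_cycles g hg y.2)) (fun _ hy => mapSemi_boundaries g hg hy)

theorem PiGroup.mapSemi_mk
    (hg : ∀ (n : ℕ) (i : Fin (n + 2)) (y : Y _⦋n + 1⦌),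
      (Z.δ i).hom (g (n + 1) y) = g n ((Y.δ i).hom y))
    (n : ℕ) (z : cycles Y n) :
    PiGroup.mapSemi g hg n (PiGroup.mk z) = PiGroup.mk ⟨g n z, mapSemi_cycles g hg z.2⟩ := rfl

end mapSemi

/-- The map on homotopy groups induced by a map of simplicial modules. -/
def PiGroup.map {Y Z : SMod.{u} S} (f : Y ⟶ Z) (n : ℕ) : PiGroup Y n →ₗ[S] PiGroup Z n :=
  PiGroup.mapSemi (fun n => (f.app (op ⦋n⦌)).hom)
    (fun n i y => (LinearMap.congr_fun (congrArg ModuleCat.Hom.hom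
      (f.naturality (SimplexCategory.δ i).op)) y).symm) n

section simplicialIdentities

variable (Y : SMod.{u} S)

theorem d0_s0 {n : ℕ} (y : Y _⦋n⦌) : (Y.δ 0).hom ((Y.σ 0).hom y) = y :=
  LinearMap.congr_fun (congrArg ModuleCat.Hom.hom (Y.δ_comp_σ_self (n := n) (i := 0))) y

theorem d1_s0 {n : ℕ} (y : Y _⦋n⦌) : (Y.δ 1).hom ((Y.σ 0).hom y) = y :=
  LinearMap.congr_fun (congrArg ModuleCat.Hom.hom (Y.δ_comp_σ_succ (n := n) (i := 0))) y

theorem dss_s0 {n : ℕ} (l : Fin (n + 1)) (y : Y _⦋n + 1⦌) :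
    (Y.δ l.succ.succ).hom ((Y.σ 0).hom y) = (Y.σ 0).hom ((Y.δ l.succ).hom y) :=
  LinearMap.congr_fun (congrArg ModuleCat.Hom.hom
    (Y.δ_comp_σ_of_gt (n := n) (i := l.succ) (j := 0) (by simp))) y

theorem d_d {n : ℕ} {i j : Fin (n + 2)} (h : i ≤ j) (y : Y _⦋n + 2⦌) :
    (Y.δ i).hom ((Y.δ j.succ).hom y) = (Y.δ j).hom ((Y.δ i.castSucc).hom y) :=
  LinearMap.congr_fun (congrArg ModuleCat.Hom.hom (Y.δ_comp_δ h)) y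

variable {Y}

theorem dss_s0_of_mem {n : ℕ} {y : Y _⦋n⦌} (hy : y ∈ cycles Y n) (l : Fin n) :
    (Y.δ l.succ.succ).hom ((Y.σ 0).hom y) = 0 := by
  cases n with
  | zero => exact l.elim0
  | succ n => rw [dss_s0, mem_cycles_succ.1 hy, map_zero]

/-- If `w` has at most one nonvanishing face, the one of index `1`, this face is a boundary. -/
theorem d1_mem_boundaries {n : ℕ} (w : Y _⦋n + 1⦌) (h0 : (Y.δ 0).hom w = 0)
    (h : ∀ l : Fin n, (Y.δ l.succ.succ).hom w = 0) : (Y.δ 1).hom w ∈ boundaries Y n := by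
  have hc : (Y.δ 1).hom w ∈ cycles Y n := by
    cases n with
    | zero => trivial
    | succ n =>
      rw [mem_cycles_succ]
      intro i
      refine Fin.cases ?_ (fun i => ?_) i
      · have := d_d Y (i := 0) (j := 0) le_rfl w
        rw [Fin.castSucc_zero, h0, map_zero] at this
        exact this
      · have := d_d Y (i := 1) (j := i.succ) (by simp [Fin.le_def]) w
        rw [h] at this
        rw [map_zero] at this
        exact this.symm
  rw [mem_boundaries]
  refine ⟨(Y.σ 0).hom ((Y.δ 1).hom w) - w, fun i => ?_, ?_⟩
  · refine Fin.cases ?_ (fun i => ?_) i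
    · rw [map_sub]
      exact sub_eq_zero.2 (d1_s0 Y _)
    · rw [map_sub, dss_s0_of_mem hc, h, sub_zero]
  · rw [map_sub, d0_s0, h0, sub_zero]

theorem boundaries_le_cycles {n : ℕ} {y : Y _⦋n⦌} (hy : y ∈ boundaries Y n) :
    y ∈ cycles Y n := by
  cases n with
  | zero => trivial
  | succ n =>
    rw [mem_boundaries] at hy
    obtain ⟨w, hw, rfl⟩ := hy
    rw [mem_cycles_succ]
    intro i
    have := d_d Y (i := 0) (j := i) (Fin.zero_le _) w
    rw [hw, map_zero] at this
    exact this.symm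

end simplicialIdentities

end homotopy

/-! ### Tensor products over a noncommutative ring -/

section tensor

variable (S R M : Type*) [Ring S] [Ring R] [AddCommGroup M] [Module S M] [Module Rᵐᵒᵖ M]
  [SMulCommClass S Rᵐᵒᵖ M]

/-- The relations `(m r) ⊗ n = m ⊗ (r n)`. -/
def balancedRel (N : Type*) [AddCommGroup N] [Module R N] : Submodule S (M ⊗[ℤ] N) :=
  Submodule.span S {t | ∃ (m : M) (r : R) (n : N),
    t = (MulOpposite.op r • m) ⊗ₜ[ℤ] n - m ⊗ₜ[ℤ] (r • n)}

/-- The tensor product `M ⊗_R N` of an `(S, R)`-bimodule and a left `R`-module. -/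
abbrev BalancedTensor (N : Type*) [AddCommGroup N] [Module R N] : Type _ :=
  (M ⊗[ℤ] N) ⧸ balancedRel S R M N

namespace BalancedTensor

variable {N N' : Type*} [AddCommGroup N] [Module R N] [AddCommGroup N'] [Module R N']

variable {R M} in
/-- The class of `m ⊗ n`. -/
def tmul (m : M) (n : N) : BalancedTensor S R M N := Submodule.Quotient.mk (m ⊗ₜ[ℤ] n)

/-- Functoriality in the left `R`-module. -/
def map (f : N →ₗ[R] N') : BalancedTensor S R M N →ₗ[S] BalancedTensor S R M N' :=
  Submodule.mapQ _ _
    (TensorProduct.AlgebraTensorModule.lTensor S M f.toAddMonoidHom.toIntLinearMap) (by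
      rw [balancedRel, Submodule.span_le]
      rintro _ ⟨m, r, n, rfl⟩
      refine Submodule.subset_span ⟨m, r, f n, ?_⟩
      simp)

theorem map_tmul (f : N →ₗ[R] N') (m : M) (n : N) :
    map S R M f (tmul S m n) = tmul S m (f n) := rfl

variable {S R M} in
theorem induction {motive : BalancedTensor S R M N → Prop}
    (t : BalancedTensor S R M N) (h0 : motive 0) (h : ∀ m n, motive (tmul S m n))
    (hadd : ∀ x y, motive x → motive y → motive (x + y)) : motive t := by
  obtain ⟨t, rfl⟩ := Submodule.Quotient.mk_surjective _ t
  induction t using TensorProduct.induction_on with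
  | zero => exact h0
  | tmul m n => exact h m n
  | add x y hx hy => exact hadd _ _ hx hy

theorem tmul_add (m : M) (n n' : N) :
    tmul (R := R) S m (n + n') = tmul S m n + tmul S m n' := by
  simp [tmul, TensorProduct.tmul_add]

theorem smul_tmul (s : S) (m : M) (n : N) :
    s • tmul (R := R) S m n = tmul S (s • m) n := rfl

theorem tmul_smul (m : M) (r : R) (n : N) :
    tmul (R := R) S m (r • n) = tmul (R := R) S (MulOpposite.op r • m) n :=
  ((Submodule.Quotient.eq (balancedRel S R M N)).2 (Submodule.subset_span ⟨m, r, n, rfl⟩)).symm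

end BalancedTensor

end tensor

/-- The functor `M ⊗_R -` from left `R`-modules to left `S`-modules. -/
def tensorFunctor (S R : Type*) (M : Type u) [Ring S] [Ring R] [AddCommGroup M] [Module S M]
    [Module Rᵐᵒᵖ M] [SMulCommClass S Rᵐᵒᵖ M] : ModuleCat.{u} R ⥤ ModuleCat.{u} S where
  obj N := ModuleCat.of S (BalancedTensor S R M N)
  map f := ModuleCat.ofHom (BalancedTensor.map S R M f.hom)
  map_id N := ModuleCat.hom_ext (LinearMap.ext fun t => by
    refine BalancedTensor.induction (motive := fun t => BalancedTensor.map S R M _ t = t) t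
      ?_ (fun m n => rfl) (fun x y hx hy => ?_)
    · rw [map_zero]
    · rw [map_add, hx, hy])
  map_comp f g := ModuleCat.hom_ext (LinearMap.ext fun t => by
    refine BalancedTensor.induction (motive := fun t => BalancedTensor.map S R M _ t =
      BalancedTensor.map S R M g.hom (BalancedTensor.map S R M f.hom t)) t
      ?_ (fun m n => rfl) (fun x y hx hy => ?_)
    · simp only [map_zero]
    · simp only [map_add, hx, hy])

/-! ### Simplicial restricted Lie algebras -/

section srLie

variable {p : ℕ} {k : Type u} [Field k]

variable (p k) in
/-- The category of simplicial restricted Lie algebras. -/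
abbrev SRLieCat := SimplicialObject (RLieCat p k)

variable (p k) in
/-- The underlying simplicial vector space. -/
abbrev oblvFunctor : SRLieCat p k ⥤ SMod.{u} k :=
  (SimplicialObject.whiskering _ _).obj (RLieCat.oblv p k)

/-- The homotopy group `πₙ(L)` of a simplicial restricted Lie algebra, as a vector space. -/
abbrev homotopyGroup (L : SRLieCat p k) (n : ℕ) : Type u := PiGroup ((oblvFunctor p k).obj L) n

/-- The map `πₙ(f)`. -/
abbrev homotopyMap {L' L : SRLieCat p k} (f : L' ⟶ L) (n : ℕ) :
    homotopyGroup L' n →ₗ[k] homotopyGroup L n := PiGroup.map ((oblvFunctor p k).map f) n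

/-- A map inducing isomorphisms on all homotopy groups. -/
def IsWeakEquiv {L' L : SRLieCat p k} (f : L' ⟶ L) : Prop :=
  ∀ n, Function.Bijective (homotopyMap f n)

variable (p k) in
/-- Acyclic fibrations: weak equivalences that are degreewise surjective. -/
def acyclicFibrations : MorphismProperty (SRLieCat p k) := fun _ _ f =>
  IsWeakEquiv f ∧ ∀ n : ℕ, Function.Surjective (RLieCat.lieHom (f.app (op ⦋n⦌)))

variable (p k) in
/-- Cofibrations: maps with the left lifting property against acyclic fibrations. -/
def cofibrations : MorphismProperty (SRLieCat p k) := (acyclicFibrations p k).llp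

/-- A factorization of `f` as a cofibration followed by an acyclic fibration. -/
structure CofibrantFactorization {A L : SRLieCat p k} (f : A ⟶ L) where
  obj : SRLieCat p k
  i : A ⟶ obj
  q : obj ⟶ L
  fac : i ≫ q = f
  cof : cofibrations p k i
  acyclic : acyclicFibrations p k q

section zero

instance : LieRing PUnit.{u + 1} where
  bracket _ _ := 0
  add_lie _ _ _ := rfl
  lie_add _ _ _ := rfl
  lie_self _ := rfl
  leibniz_lie _ _ _ := rfl

instance : LieAlgebra k PUnit.{u + 1} where
  lie_smul _ _ _ := rfl

instance : RestrictedLieAlgebra p k PUnit.{u + 1} where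
  pOp _ := 0
  pOp_smul _ _ := rfl
  lie_pOp _ _ := rfl
  pOp_add _ _ := rfl

variable (p k) in
/-- The zero simplicial restricted Lie algebra. -/
def zeroSRLie : SRLieCat p k := (SimplicialObject.const _).obj { carrier := PUnit.{u + 1} }

variable [Fact p.Prime]

/-- The map from the zero object. -/
def fromZero (L : SRLieCat p k) : zeroSRLie p k ⟶ L where
  app _ := { toLieHom := 0, map_pOp := fun _ => pOp_zero.symm }
  naturality _ _ g := RLieCat.hom_ext fun _ => (map_zero (RLieCat.lieHom (L.map g))).symm

theorem fromZero_comp {L L' : SRLieCat p k} (f : L ⟶ L') : fromZero L ≫ f = fromZero L' := by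
  apply NatTrans.ext
  funext n
  exact RLieCat.hom_ext fun _ => map_zero (RLieCat.lieHom (f.app n))

/-- Cofibrant replacements. -/
abbrev CofibrantReplacement (L : SRLieCat p k) := CofibrantFactorization (fromZero L)

theorem CofibrantReplacement.commSq {L' L : SRLieCat p k} (Q' : CofibrantReplacement L')
    (Q : CofibrantReplacement L) (f : L' ⟶ L) : CommSq Q.i Q'.i Q.q (Q'.q ≫ f) :=
  ⟨by rw [Q.fac, ← Category.assoc, Q'.fac, fromZero_comp]⟩

theorem CofibrantReplacement.hasLift {L' L : SRLieCat p k} (Q' : CofibrantReplacement L')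
    (Q : CofibrantReplacement L) (f : L' ⟶ L) :
    (CofibrantReplacement.commSq Q' Q f).HasLift :=
  (Q'.cof Q.q Q.acyclic).sq_hasLift _

/-- A lift of a map to cofibrant replacements. -/
def CofibrantReplacement.lift {L' L : SRLieCat p k} (Q' : CofibrantReplacement L')
    (Q : CofibrantReplacement L) (f : L' ⟶ L) : Q'.obj ⟶ Q.obj :=
  haveI := CofibrantReplacement.hasLift Q' Q f
  (CofibrantReplacement.commSq Q' Q f).lift

theorem CofibrantReplacement.lift_q {L' L : SRLieCat p k} (Q' : CofibrantReplacement L')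
    (Q : CofibrantReplacement L) (f : L' ⟶ L) :
    CofibrantReplacement.lift Q' Q f ≫ Q.q = Q'.q ≫ f := by
  have := CofibrantReplacement.hasLift Q' Q f
  exact (CofibrantReplacement.commSq Q' Q f).fac_right

end zero

/-! ### The restricted Lie algebra structure on homotopy groups -/

variable [Fact p.Prime]

/-- The cycles form a restricted Lie subalgebra. -/
def cyclesLie (L : SRLieCat p k) (n : ℕ) : RestrictedSubalgebra p k (L _⦋n⦌) where
  toSubmodule := cycles ((oblvFunctor p k).obj L) n
  lie_mem' {x y} hx hy := by
    cases n with
    | zero => trivial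
    | succ n =>
      refine mem_cycles_succ.2 fun i => ?_
      have h : RLieCat.lieHom (L.δ i) x = 0 := mem_cycles_succ.1 hx i
      change RLieCat.lieHom (L.δ i) ⁅x, y⁆ = 0
      rw [LieHom.map_lie, h, zero_lie]
  pOp_mem x hx := by
    cases n with
    | zero => trivial
    | succ n =>
      refine mem_cycles_succ.2 fun i => ?_
      have h : RLieCat.lieHom (L.δ i) x = 0 := mem_cycles_succ.1 hx i
      change RLieCat.lieHom (L.δ i) (pOp p k x) = 0
      rw [RLieCat.lieHom_pOp, h, pOp_zero]

/-- The boundaries form a restricted Lie ideal in the cycles. -/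
def boundariesLie (L : SRLieCat p k) (n : ℕ) :
    RestrictedIdeal p k (cyclesLie L n).toLieSubalgebra where
  toSubmodule := (boundaries ((oblvFunctor p k).obj L) n).comap
    (cycles ((oblvFunctor p k).obj L) n).subtype
  lie_mem {z b} hb := by
    have hb' : (show ((oblvFunctor p k).obj L) _⦋n⦌ from b.1) ∈
      boundaries ((oblvFunctor p k).obj L) n := hb
    obtain ⟨w, hw, hwb⟩ : ∃ w : L _⦋n + 1⦌,
      (∀ i : Fin (n + 1), RLieCat.lieHom (L.δ i.succ) w = 0) ∧
        RLieCat.lieHom (L.δ 0) w = b.1 := mem_boundaries.1 hb'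
    let v : L _⦋n + 1⦌ := ⁅RLieCat.lieHom (L.σ 0) z.1, w⁆
    refine mem_boundaries.2 ⟨v, fun i => ?_, ?_⟩
    · have h : RLieCat.lieHom (L.δ i.succ) w = 0 := hw i
      change RLieCat.lieHom (L.δ i.succ) ⁅_, _⁆ = 0
      rw [LieHom.map_lie, h, lie_zero]
    · have h : RLieCat.lieHom (L.δ 0) w = b.1 := hwb
      have h' : RLieCat.lieHom (L.δ 0) (RLieCat.lieHom (L.σ 0) z.1) = z.1 :=
        d0_s0 ((oblvFunctor p k).obj L) z.1
      change RLieCat.lieHom (L.δ 0) ⁅_, _⁆ = ⁅z.1, b.1⁆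
      rw [LieHom.map_lie, h, h']
  pOp_mem b hb := by
    have hb' : (show ((oblvFunctor p k).obj L) _⦋n⦌ from b.1) ∈
      boundaries ((oblvFunctor p k).obj L) n := hb
    obtain ⟨w, hw, hwb⟩ : ∃ w : L _⦋n + 1⦌,
      (∀ i : Fin (n + 1), RLieCat.lieHom (L.δ i.succ) w = 0) ∧
        RLieCat.lieHom (L.δ 0) w = b.1 := mem_boundaries.1 hb'
    let v : L _⦋n + 1⦌ := pOp p k w
    refine mem_boundaries.2 ⟨v, fun i => ?_, ?_⟩
    · have h : RLieCat.lieHom (L.δ i.succ) w = 0 := hw i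
      change RLieCat.lieHom (L.δ i.succ) (pOp p k _) = 0
      rw [RLieCat.lieHom_pOp, h, pOp_zero]
    · have h : RLieCat.lieHom (L.δ 0) w = b.1 := hwb
      change RLieCat.lieHom (L.δ 0) (pOp p k _) = pOp p k b.1
      rw [RLieCat.lieHom_pOp, h]

/-- The homotopy group `πₙ(L)` as a restricted Lie algebra. -/
abbrev homotopyLie (L : SRLieCat p k) (n : ℕ) : Type u := (boundariesLie L n).Quotient

/-- The identity map: `homotopyLie L n` is `homotopyGroup L n` with more structure. -/
def toHomotopyLie (L : SRLieCat p k) (n : ℕ) : homotopyGroup L n ≃ₗ[k] homotopyLie L n :=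
  LinearEquiv.refl k (homotopyLie L n)

/-- The map `ξ : πₙ(L) → πₙ(L)` induced by the `p`-operation. -/
def homotopyXi (L : SRLieCat p k) (n : ℕ) (x : homotopyGroup L n) : homotopyGroup L n :=
  (toHomotopyLie L n).symm (pOp p k (toHomotopyLie L n x))

theorem homotopyXi_mk (L : SRLieCat p k) (n : ℕ) (z : (cyclesLie L n).toLieSubalgebra) :
    homotopyXi L n ((boundariesLie L n).mkLie z) = (boundariesLie L n).mkLie (pOp p k z) :=
  (boundariesLie L n).pOp_mkLie z

/-! ### Homology and the Hurewicz homomorphism -/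

variable [CharP k p]

/-- The simplicial module `M ⊗_{k{ξ}} Ab(Q)`. -/
abbrev chainsFunctor (S : Type v) (M : Type u) [Ring S] [AddCommGroup M] [Module S M]
    [Module (TwistedPoly p k)ᵐᵒᵖ M] [SMulCommClass S (TwistedPoly p k)ᵐᵒᵖ M] :
    SRLieCat p k ⥤ SMod.{u} S :=
  (SimplicialObject.whiskering _ _).obj
    (abFunctor p k ⋙ tensorFunctor S (TwistedPoly p k) M)

/-- The homology group `H̃ₛ(L; M)` of the suspension of `M ⊗ᴸ 𝕃Ab(L)`, where `M` is an
`(S, k{ξ})`-bimodule. It is computed from a cofibrant replacement `Q` of `L`: then `Ab(Q)`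
computes `𝕃Ab(L)` and is degreewise projective, so that the derived tensor product
is `M ⊗ Ab(Q)`. -/
def reducedHomology (S : Type v) (M : Type u) [Ring S] [AddCommGroup M] [Module S M]
    [Module (TwistedPoly p k)ᵐᵒᵖ M] [SMulCommClass S (TwistedPoly p k)ᵐᵒᵖ M]
    {L : SRLieCat p k} (Q : CofibrantReplacement L) (s : ℕ) : ModuleCat.{u} S :=
  match s with
  | 0 => ModuleCat.of S PUnit.{u + 1}
  | s + 1 => ModuleCat.of S (PiGroup ((chainsFunctor S M).obj Q.obj) s)

/-- The homology group `H̃ₛ(L; k{ξ})`, a left `k{ξ}`-module. -/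
abbrev xiHomology {L : SRLieCat p k} (Q : CofibrantReplacement L) (s : ℕ) :
    ModuleCat.{u} (TwistedPoly p k) :=
  reducedHomology (TwistedPoly p k) (TwistedPoly p k) Q s

/-- The induced map on homology. -/
def reducedHomologyMap (S : Type v) (M : Type u) [Ring S] [AddCommGroup M] [Module S M]
    [Module (TwistedPoly p k)ᵐᵒᵖ M] [SMulCommClass S (TwistedPoly p k)ᵐᵒᵖ M]
    {L' L : SRLieCat p k} (Q' : CofibrantReplacement L') (Q : CofibrantReplacement L)
    (f : L' ⟶ L) (s : ℕ) : reducedHomology S M Q' s →ₗ[S] reducedHomology S M Q s :=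
  match s with
  | 0 => 0
  | s + 1 => PiGroup.map ((chainsFunctor S M).map (CofibrantReplacement.lift Q' Q f)) s

/-- The induced map on homology with coefficients in `k{ξ}`. -/
abbrev xiHomologyMap {L' L : SRLieCat p k} (Q' : CofibrantReplacement L')
    (Q : CofibrantReplacement L) (f : L' ⟶ L) (s : ℕ) :
    xiHomology Q' s →ₗ[TwistedPoly p k] xiHomology Q s :=
  reducedHomologyMap (TwistedPoly p k) (TwistedPoly p k) Q' Q f s

/-- The quotient map `L → Ab(L) = k{ξ} ⊗ Ab(L)`, `x ↦ 1 ⊗ x`. -/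
def abUnit (L : RLieCat p k) : L →ₛₗ[TwistedPoly.C p k]
    BalancedTensor (TwistedPoly p k) (TwistedPoly p k) (TwistedPoly p k) (Ab p k L) where
  toFun x := BalancedTensor.tmul _ 1 (Ab.mk p k L x)
  map_add' x y := by rw [map_add, BalancedTensor.tmul_add]
  map_smul' a x := by
    rw [map_smul, ← Ab.C_smul, BalancedTensor.tmul_smul, BalancedTensor.smul_tmul]
    congr 1
    simp

/-- The map `πₛ(Q) → πₛ(k{ξ} ⊗ Ab(Q))` induced by the quotient map. -/
def piAbUnit (Q : SRLieCat p k) (s : ℕ) : homotopyGroup Q s →ₛₗ[TwistedPoly.C p k]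
    PiGroup ((chainsFunctor (TwistedPoly p k) (TwistedPoly p k)).obj Q) s :=
  PiGroup.mapSemi (Y := (oblvFunctor p k).obj Q)
    (Z := (chainsFunctor (TwistedPoly p k) (TwistedPoly p k)).obj Q)
    (fun n => abUnit (Q _⦋n⦌)) (fun _ _ _ => rfl) s

/-- The Hurewicz homomorphism `h : πₛ(L) → H̃ₛ₊₁(L; k{ξ})`. -/
def hurewicz {L : SRLieCat p k} (Q : CofibrantReplacement L) (s : ℕ) :
    homotopyGroup L s →ₛₗ[TwistedPoly.C p k] xiHomology Q (s + 1) :=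
  (piAbUnit Q.obj s).comp
    (LinearEquiv.ofBijective (homotopyMap Q.q s) (Q.acyclic.1 s)).symm.toLinearMap

end srLie

/-! ### Path objects and homotopy fibers -/

section fiber

/-- The functor `[n] ↦ [0] ⋆ [n] = [n + 1]` of the simplex category, adjoining a new minimal
element. -/
def shift : SimplexCategory ⥤ SimplexCategory where
  obj n := ⦋n.len + 1⦌
  map {m n} θ := SimplexCategory.Hom.mk
    { toFun := Fin.cases (motive := fun _ => Fin (n.len + 1 + 1)) 0
        (fun i => (θ.toOrderHom i).succ)
      monotone' := by
        intro i j h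
        induction i using Fin.cases with
        | zero => simp
        | succ i =>
          induction j using Fin.cases with
          | zero => simp at h
          | succ j => simpa using θ.toOrderHom.monotone (by simpa using h) }
  map_id n := by
    ext i : 3
    induction i using Fin.cases <;> rfl
  map_comp θ η := by
    ext i : 3
    induction i using Fin.cases <;> rfl

theorem shift_δ {n : ℕ} (i : Fin (n + 2)) :
    shift.map (SimplexCategory.δ (n := n) i) = SimplexCategory.δ (n := n + 1) i.succ := by
  ext j : 3
  induction j using Fin.cases with
  | zero => exact (Fin.succ_succAbove_zero i).symm
  | succ j => exact (Fin.succ_succAbove_succ i j).symm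

/-- The inclusion of `[n]` in `[0] ⋆ [n]`, i.e. the `0`-th coface. -/
def shiftFace : 𝟭 SimplexCategory ⟶ shift where
  app n := SimplexCategory.δ (n := n.len) 0
  naturality m n θ := by
    ext i : 3
    rfl

/-- The new vertex of `[0] ⋆ [n]`. -/
def shiftVertex (n : SimplexCategory) : ⦋0⦌ ⟶ shift.obj n :=
  SimplexCategory.const ⦋0⦌ (shift.obj n) 0

theorem shiftVertex_map {m n : SimplexCategory} (θ : m ⟶ n) :
    shiftVertex m ≫ shift.map θ = shiftVertex n := by
  ext i : 3
  rfl

variable {p : ℕ} {k : Type u} [Field k] [Fact p.Prime]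

variable {A L Q : SRLieCat p k} (f : A ⟶ L)

/-- The `n`-simplices of the homotopy fiber. The `n`-simplices of the path object `P L` (the based
décalage of `L`) are the `(n + 1)`-simplices `γ` of `L` whose `0`-th vertex is the base point `0`;
`P L` is contractible and `d₀ : P L → L` is the path fibration. The homotopy fiber of `f` is the
pullback `A ×_L P L`. -/
def fiberSub (n : SimplexCategoryᵒᵖ) :
    RestrictedSubalgebra p k (A.obj n × L.obj (shift.op.obj n)) where
  carrier := {x | RLieCat.lieHom (L.map (shiftFace.app n.unop).op) x.2 =
      RLieCat.lieHom (f.app n) x.1 ∧ RLieCat.lieHom (L.map (shiftVertex n.unop).op) x.2 = 0}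
  add_mem' {x y} hx hy := ⟨by
      rw [Prod.snd_add, Prod.fst_add, map_add, hx.1, hy.1]
      exact (map_add _ _ _).symm, by
      rw [Prod.snd_add, map_add, hx.2, hy.2, add_zero]⟩
  zero_mem' := ⟨by rw [Prod.snd_zero, Prod.fst_zero, map_zero, map_zero], by
      rw [Prod.snd_zero, map_zero]⟩
  smul_mem' a x hx := ⟨by
      rw [Prod.smul_snd, Prod.smul_fst, map_smul, map_smul, hx.1], by
      rw [Prod.smul_snd, map_smul, hx.2, smul_zero]⟩
  lie_mem' {x y} hx hy := ⟨by
      change RLieCat.lieHom _ ⁅x.2, y.2⁆ = RLieCat.lieHom _ ⁅x.1, y.1⁆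
      rw [LieHom.map_lie, LieHom.map_lie, hx.1, hy.1], by
      change RLieCat.lieHom _ ⁅x.2, y.2⁆ = 0
      rw [LieHom.map_lie, hx.2, zero_lie]⟩
  pOp_mem x hx := ⟨by
      change RLieCat.lieHom _ (pOp p k x.2) = RLieCat.lieHom _ (pOp p k x.1)
      rw [RLieCat.lieHom_pOp, RLieCat.lieHom_pOp, hx.1], by
      change RLieCat.lieHom _ (pOp p k x.2) = 0
      rw [RLieCat.lieHom_pOp, hx.2, pOp_zero]⟩

theorem fiberSub_map {m n : SimplexCategoryᵒᵖ} (θ : m ⟶ n) {x : A.obj m × L.obj (shift.op.obj m)}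
    (hx : x ∈ (fiberSub f m).toLieSubalgebra) :
    (RLieCat.lieHom (A.map θ) x.1, RLieCat.lieHom (L.map (shift.op.map θ)) x.2) ∈
      (fiberSub f n).toLieSubalgebra := by
  constructor
  · change RLieCat.lieHom (L.map (shiftFace.app n.unop).op)
        (RLieCat.lieHom (L.map (shift.op.map θ)) x.2) =
      RLieCat.lieHom (f.app n) (RLieCat.lieHom (A.map θ) x.1)
    have h1 := RLieCat.lieHom_congr (f.naturality θ) x.1
    rw [RLieCat.lieHom_comp, RLieCat.lieHom_comp] at h1
    rw [h1, ← hx.1, ← RLieCat.lieHom_comp, ← RLieCat.lieHom_comp, ← L.map_comp, ← L.map_comp]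
    refine RLieCat.lieHom_congr (congrArg L.map ?_) x.2
    exact congrArg Quiver.Hom.op (shiftFace.naturality θ.unop)
  · change RLieCat.lieHom (L.map (shiftVertex n.unop).op)
        (RLieCat.lieHom (L.map (shift.op.map θ)) x.2) = 0
    rw [← RLieCat.lieHom_comp, ← L.map_comp, ← hx.2]
    refine RLieCat.lieHom_congr (congrArg L.map ?_) x.2
    exact congrArg Quiver.Hom.op (shiftVertex_map θ.unop)

/-- The homotopy fiber of a map of simplicial restricted Lie algebras. -/
def fiber : SRLieCat p k where
  obj n := { carrier := (fiberSub f n).toLieSubalgebra }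
  map {m n} θ :=
    { toFun := fun x => ⟨(RLieCat.lieHom (A.map θ) x.1.1,
        RLieCat.lieHom (L.map (shift.op.map θ)) x.1.2), fiberSub_map f θ x.2⟩
      map_add' := fun x y => Subtype.ext (Prod.ext (map_add _ _ _) (map_add _ _ _))
      map_smul' := fun a x => Subtype.ext (Prod.ext (map_smul _ _ _) (map_smul _ _ _))
      map_lie' := Subtype.ext (Prod.ext (LieHom.map_lie _ _ _) (LieHom.map_lie _ _ _))
      map_pOp := fun x => Subtype.ext (Prod.ext (RLieCat.lieHom_pOp _ _)
        (RLieCat.lieHom_pOp _ _)) }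
  map_id n := RLieCat.hom_ext fun x => Subtype.ext (Prod.ext
    (RLieCat.lieHom_congr (A.map_id n) x.1.1)
    (RLieCat.lieHom_congr ((congrArg L.map (shift.op.map_id n)).trans (L.map_id _)) x.1.2))
  map_comp θ η := RLieCat.hom_ext fun x => Subtype.ext (Prod.ext
    (RLieCat.lieHom_congr (A.map_comp θ η) x.1.1)
    (RLieCat.lieHom_congr ((congrArg L.map (shift.op.map_comp θ η)).trans
      (L.map_comp _ _)) x.1.2))

/-- The map of homotopy fibers induced by postcomposition. -/
def fiberMap {i : A ⟶ Q} {q : Q ⟶ L} {f : A ⟶ L} (fac : i ≫ q = f) : fiber i ⟶ fiber f where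
  app n :=
    { toFun := fun x => ⟨(x.1.1, RLieCat.lieHom (q.app _) x.1.2), by
        subst fac
        constructor
        · change RLieCat.lieHom (L.map _) (RLieCat.lieHom (q.app _) x.1.2) =
            RLieCat.lieHom (q.app n) (RLieCat.lieHom (i.app n) x.1.1)
          rw [← x.2.1]
          exact (RLieCat.lieHom_congr (q.naturality (shiftFace.app n.unop).op) x.1.2).symm
        · change RLieCat.lieHom (L.map _) (RLieCat.lieHom (q.app _) x.1.2) = 0
          refine ((RLieCat.lieHom_congr (q.naturality (shiftVertex n.unop).op) x.1.2).symm).trans ?_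
          rw [RLieCat.lieHom_comp, x.2.2, map_zero]⟩
      map_add' := fun x y => Subtype.ext (Prod.ext rfl (map_add _ _ _))
      map_smul' := fun a x => Subtype.ext (Prod.ext rfl (map_smul _ _ _))
      map_lie' := Subtype.ext (Prod.ext rfl (LieHom.map_lie _ _ _))
      map_pOp := fun x => Subtype.ext (Prod.ext rfl (RLieCat.lieHom_pOp _ _)) }
  naturality m n θ := RLieCat.hom_ext fun x => Subtype.ext (Prod.ext rfl
    (RLieCat.lieHom_congr (q.naturality (shift.op.map θ)) x.1.2))

end fiber

/-! ### Homotopy cofibers -/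

section cofiber

variable {p : ℕ} {k : Type u} [Field k] [Fact p.Prime]

/-- The restricted Lie ideal generated by the image of `i`, in a given degree. -/
def imageIdeal {A Q : SRLieCat p k} (i : A ⟶ Q) (n : SimplexCategoryᵒᵖ) :
    RestrictedIdeal p k (Q.obj n) :=
  RestrictedIdeal.gen p k (Set.range (RLieCat.lieHom (i.app n)))

theorem imageIdeal_map {A Q : SRLieCat p k} (i : A ⟶ Q) {m n : SimplexCategoryᵒᵖ} (θ : m ⟶ n)
    (x : Q.obj m) (hx : x ∈ (imageIdeal i m).toLieSubmodule) :
    RLieCat.lieHom (Q.map θ) x ∈ (imageIdeal i n).toLieSubmodule :=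
  RestrictedIdeal.gen_le_comap (Q.map θ) (by
    rintro _ ⟨a, rfl⟩
    exact ⟨RLieCat.lieHom (A.map θ) a, RLieCat.lieHom_congr (i.naturality θ) a⟩) hx

/-- The quotient of `Qₙ` by the restricted Lie ideal generated by the image of `i`. -/
def cokernelObj {A Q : SRLieCat p k} (i : A ⟶ Q) (n : SimplexCategoryᵒᵖ) : RLieCat p k where
  carrier := (imageIdeal i n).Quotient

/-- The map of quotients induced by a simplicial operator. -/
def cokernelMap {A Q : SRLieCat p k} (i : A ⟶ Q) {m n : SimplexCategoryᵒᵖ} (θ : m ⟶ n) :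
    cokernelObj i m ⟶ cokernelObj i n :=
  RestrictedIdeal.mapQuotient (Q.map θ) (imageIdeal i m) (imageIdeal i n) (imageIdeal_map i θ)

/-- The degreewise quotient of `Q` by the restricted Lie ideal generated by the image of `i`, i.e.
the cokernel (coequalizer of `i` and `0`) in simplicial restricted Lie algebras. -/
def cokernel {A Q : SRLieCat p k} (i : A ⟶ Q) : SRLieCat p k where
  obj n := cokernelObj i n
  map θ := cokernelMap i θ
  map_id n := by
    refine RLieCat.hom_ext fun x => ?_
    obtain ⟨x, rfl⟩ := (imageIdeal i n).mkLie_surjective x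
    exact congrArg (imageIdeal i n).mkLie (RLieCat.lieHom_congr (Q.map_id n) x)
  map_comp {l m n} θ η := by
    refine RLieCat.hom_ext fun x => ?_
    obtain ⟨x, rfl⟩ := (imageIdeal i l).mkLie_surjective x
    exact congrArg (imageIdeal i n).mkLie (RLieCat.lieHom_congr (Q.map_comp θ η) x)

/-- The quotient map in each degree. -/
def cokernelMk {A Q : SRLieCat p k} (i : A ⟶ Q) (n : SimplexCategoryᵒᵖ) :
    Q.obj n →ₗ⁅k⁆ (cokernel i).obj n :=
  (imageIdeal i n).mkLie

theorem cokernelMk_map {A Q : SRLieCat p k} (i : A ⟶ Q) {m n : SimplexCategoryᵒᵖ} (θ : m ⟶ n)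
    (x : Q.obj m) : RLieCat.lieHom ((cokernel i).map θ) (cokernelMk i m x) =
      cokernelMk i n (RLieCat.lieHom (Q.map θ) x) := rfl

theorem cokernelMk_i {A Q : SRLieCat p k} (i : A ⟶ Q) (n : SimplexCategoryᵒᵖ) (a : A.obj n) :
    cokernelMk i n (RLieCat.lieHom (i.app n) a) = 0 :=
  (Submodule.Quotient.mk_eq_zero _).2 (RestrictedIdeal.subset_gen ⟨a, rfl⟩)

/-- The homotopy cofiber of `f`, computed from a factorization `A → Q → L` of `f` as a cofibration
followed by an acyclic fibration: it is the pushout of `0 ← A → Q`. -/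
abbrev cofiber {A L : SRLieCat p k} {f : A ⟶ L} (F : CofibrantFactorization f) : SRLieCat p k :=
  cokernel F.i

end cofiber

/-! ### Comparison of homotopy fibers and cofibers -/

section comparison

variable {p : ℕ} {k : Type u} [Field k] [Fact p.Prime]

/-- Boundaries, in terms of elements. -/
def IsBoundary (X : SRLieCat p k) (n : ℕ) (z : X _⦋n⦌) : Prop :=
  ∃ w : X _⦋n + 1⦌, (∀ i : Fin (n + 1), RLieCat.lieHom (X.δ i.succ) w = 0) ∧
    RLieCat.lieHom (X.δ 0) w = z

/-- The homotopy class of a cycle. -/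
def piMk (X : SRLieCat p k) (n : ℕ) (z : X _⦋n⦌) (hz : z ∈ (cyclesLie X n).toLieSubalgebra) :
    homotopyGroup X n := PiGroup.mk (Y := (oblvFunctor p k).obj X) ⟨z, hz⟩

theorem piMk_surj {X : SRLieCat p k} {n : ℕ} (x : homotopyGroup X n) :
    ∃ z hz, piMk X n z hz = x := by
  obtain ⟨⟨z, hz⟩, rfl⟩ := Submodule.Quotient.mk_surjective _ x
  exact ⟨z, hz, rfl⟩

theorem piMk_eq {X : SRLieCat p k} {n : ℕ} {z z' : X _⦋n⦌}
    {hz : z ∈ (cyclesLie X n).toLieSubalgebra} {hz' : z' ∈ (cyclesLie X n).toLieSubalgebra} :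
    piMk X n z hz = piMk X n z' hz' ↔ IsBoundary X n (z - z') :=
  PiGroup.mk_eq_mk.trans mem_boundaries

theorem piMk_eq_zero {X : SRLieCat p k} {n : ℕ} {z : X _⦋n⦌}
    {hz : z ∈ (cyclesLie X n).toLieSubalgebra} : piMk X n z hz = 0 ↔ IsBoundary X n z :=
  PiGroup.mk_eq_zero.trans mem_boundaries

theorem mem_cyclesLie_succ {X : SRLieCat p k} {n : ℕ} {z : X _⦋n + 1⦌} :
    z ∈ (cyclesLie X (n + 1)).toLieSubalgebra ↔
      ∀ i : Fin (n + 2), RLieCat.lieHom (X.δ i) z = 0 :=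
  mem_cycles_succ (Y := (oblvFunctor p k).obj X)

theorem map_mem_cyclesLie {X Y : SRLieCat p k} (f : X ⟶ Y) {n : ℕ} {z : X _⦋n⦌}
    (hz : z ∈ (cyclesLie X n).toLieSubalgebra) :
    RLieCat.lieHom (f.app (op ⦋n⦌)) z ∈ (cyclesLie Y n).toLieSubalgebra := by
  cases n with
  | zero => trivial
  | succ n =>
    rw [mem_cyclesLie_succ] at hz ⊢
    intro i
    refine (RLieCat.lieHom_congr (f.naturality (SimplexCategory.δ i).op) z).symm.trans ?_
    exact (congrArg (RLieCat.lieHom (f.app _)) (hz i)).trans (map_zero _)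

theorem homotopyMap_piMk {X Y : SRLieCat p k} (f : X ⟶ Y) {n : ℕ} {z : X _⦋n⦌}
    (hz : z ∈ (cyclesLie X n).toLieSubalgebra) : homotopyMap f n (piMk X n z hz) =
      piMk Y n (RLieCat.lieHom (f.app (op ⦋n⦌)) z) (map_mem_cyclesLie f hz) := rfl

theorem map_face {X Y : SRLieCat p k} (f : X ⟶ Y) {n : ℕ} (i : Fin (n + 2)) (x : X _⦋n + 1⦌) :
    RLieCat.lieHom (Y.δ i) (RLieCat.lieHom (f.app (op ⦋n + 1⦌)) x) =
      RLieCat.lieHom (f.app (op ⦋n⦌)) (RLieCat.lieHom (X.δ i) x) :=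
  (RLieCat.lieHom_congr (f.naturality (SimplexCategory.δ i).op) x).symm

theorem map_degen {X Y : SRLieCat p k} (f : X ⟶ Y) {n : ℕ} (i : Fin (n + 1)) (x : X _⦋n⦌) :
    RLieCat.lieHom (Y.σ i) (RLieCat.lieHom (f.app (op ⦋n⦌)) x) =
      RLieCat.lieHom (f.app (op ⦋n + 1⦌)) (RLieCat.lieHom (X.σ i) x) :=
  (RLieCat.lieHom_congr (f.naturality (SimplexCategory.σ i).op) x).symm

theorem face0_degen {X : SRLieCat p k} {n : ℕ} (x : X _⦋n⦌) :
    RLieCat.lieHom (X.δ 0) (RLieCat.lieHom (X.σ 0) x) = x :=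
  d0_s0 ((oblvFunctor p k).obj X) x

theorem face1_degen {X : SRLieCat p k} {n : ℕ} (x : X _⦋n⦌) :
    RLieCat.lieHom (X.δ 1) (RLieCat.lieHom (X.σ 0) x) = x :=
  d1_s0 ((oblvFunctor p k).obj X) x

theorem face_degen {X : SRLieCat p k} {n : ℕ} (l : Fin (n + 1)) (x : X _⦋n + 1⦌) :
    RLieCat.lieHom (X.δ l.succ.succ) (RLieCat.lieHom (X.σ 0) x) =
      RLieCat.lieHom (X.σ 0) (RLieCat.lieHom (X.δ l.succ) x) :=
  dss_s0 ((oblvFunctor p k).obj X) l x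

theorem face_face0 {X : SRLieCat p k} {n : ℕ} (j : Fin (n + 2)) (x : X _⦋n + 2⦌) :
    RLieCat.lieHom (X.δ j) (RLieCat.lieHom (X.δ 0) x) =
      RLieCat.lieHom (X.δ 0) (RLieCat.lieHom (X.δ j.succ) x) :=
  (d_d ((oblvFunctor p k).obj X) (i := 0) (j := j) (Fin.zero_le _) x).symm

theorem face1_isBoundary {X : SRLieCat p k} {n : ℕ} (w : X _⦋n + 1⦌)
    (h0 : RLieCat.lieHom (X.δ 0) w = 0)
    (h : ∀ l : Fin n, RLieCat.lieHom (X.δ l.succ.succ) w = 0) :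
    IsBoundary X n (RLieCat.lieHom (X.δ 1) w) :=
  mem_boundaries.1 (d1_mem_boundaries (Y := (oblvFunctor p k).obj X) w h0 h)

theorem IsWeakEquiv.inj {X Y : SRLieCat p k} {f : X ⟶ Y} (hf : IsWeakEquiv f) {n : ℕ} {z : X _⦋n⦌}
    (hz : z ∈ (cyclesLie X n).toLieSubalgebra)
    (h : IsBoundary Y n (RLieCat.lieHom (f.app (op ⦋n⦌)) z)) : IsBoundary X n z := by
  rw [← piMk_eq_zero (hz := map_mem_cyclesLie f hz), ← homotopyMap_piMk f hz] at h
  rw [← piMk_eq_zero (hz := hz)]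
  exact (hf n).1 (h.trans (map_zero _).symm)

theorem IsWeakEquiv.surj {X Y : SRLieCat p k} {f : X ⟶ Y} (hf : IsWeakEquiv f) {n : ℕ}
    {z : Y _⦋n⦌} (hz : z ∈ (cyclesLie Y n).toLieSubalgebra) :
    ∃ z' ∈ (cyclesLie X n).toLieSubalgebra,
      IsBoundary Y n (z - RLieCat.lieHom (f.app (op ⦋n⦌)) z') := by
  obtain ⟨x, hx⟩ := (hf n).2 (piMk Y n z hz)
  obtain ⟨z', hz', rfl⟩ := piMk_surj x
  rw [homotopyMap_piMk] at hx
  exact ⟨z', hz', piMk_eq.1 hx.symm⟩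

section elements

variable {A L : SRLieCat p k} {f : A ⟶ L} {n : ℕ}

theorem fiber_face_fst (j : Fin (n + 2)) (x : (fiber f) _⦋n + 1⦌) :
    (RLieCat.lieHom ((fiber f).δ j) x).1.1 = RLieCat.lieHom (A.δ j) x.1.1 := rfl

theorem fiber_face_snd (j : Fin (n + 2)) (x : (fiber f) _⦋n + 1⦌) :
    (RLieCat.lieHom ((fiber f).δ j) x).1.2 =
      RLieCat.lieHom (L.δ (n := n + 1) j.succ) (x.1.2 : L _⦋n + 2⦌) :=
  RLieCat.lieHom_congr (congrArg (fun θ => L.map (Quiver.Hom.op θ)) (shift_δ j)) x.1.2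

theorem fiber_face0 (x : (fiber f) _⦋n⦌) :
    RLieCat.lieHom (L.δ (n := n) 0) (x.1.2 : L _⦋n + 1⦌) =
      RLieCat.lieHom (f.app (op ⦋n⦌)) x.1.1 := x.2.1

/-- The vertex condition follows from the vanishing of a face containing the vertex. -/
theorem vertex_eq_zero (γ : L _⦋n + 1⦌) (j : Fin (n + 1))
    (h : RLieCat.lieHom (L.δ j.succ) γ = 0) :
    RLieCat.lieHom (L.map (shiftVertex ⦋n⦌).op) γ = 0 := by
  have e : shiftVertex ⦋n⦌ = SimplexCategory.const ⦋0⦌ ⦋n⦌ 0 ≫ SimplexCategory.δ j.succ := by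
    ext i : 3
    exact (Fin.succ_succAbove_zero j).symm
  have e' : L.map (shiftVertex ⦋n⦌).op =
      L.δ j.succ ≫ L.map (SimplexCategory.const ⦋0⦌ ⦋n⦌ 0).op :=
    (congrArg (fun θ => L.map (Quiver.Hom.op θ)) e).trans (L.map_comp _ _)
  exact (RLieCat.lieHom_congr e' γ).trans
    ((congrArg (RLieCat.lieHom (L.map _)) h).trans (map_zero _))

/-- Simplices of the homotopy fiber. -/
def fiberMk (a : A _⦋n⦌) (γ : L _⦋n + 1⦌)
    (h : RLieCat.lieHom (L.δ 0) γ = RLieCat.lieHom (f.app (op ⦋n⦌)) a) (j : Fin (n + 1))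
    (hj : RLieCat.lieHom (L.δ j.succ) γ = 0) : (fiber f) _⦋n⦌ :=
  ⟨(a, γ), h, vertex_eq_zero γ j hj⟩

theorem fiber_cycle_face {x : (fiber f) _⦋n⦌} (hx : x ∈ (cyclesLie (fiber f) n).toLieSubalgebra)
    (j : Fin (n + 1)) : RLieCat.lieHom (L.δ (n := n) j.succ) (x.1.2 : L _⦋n + 1⦌) = 0 := by
  cases n with
  | zero =>
    have e : shiftVertex ⦋0⦌ = SimplexCategory.δ (n := 0) j.succ := by
      ext i : 3
      have hi : i = 0 := Fin.fin_one_eq_zero i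
      subst hi
      exact (Fin.succ_succAbove_zero j).symm
    refine Eq.trans ?_ x.2.2
    exact RLieCat.lieHom_congr (congrArg (fun θ => L.map (Quiver.Hom.op θ)) e.symm) _
  | succ n =>
    rw [← fiber_face_snd, mem_cyclesLie_succ.1 hx j]
    rfl

theorem fiber_cycle_fst {x : (fiber f) _⦋n⦌} (hx : x ∈ (cyclesLie (fiber f) n).toLieSubalgebra) :
    x.1.1 ∈ (cyclesLie A n).toLieSubalgebra := by
  cases n with
  | zero => trivial
  | succ n =>
    rw [mem_cyclesLie_succ] at hx ⊢
    intro i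
    rw [← fiber_face_fst, hx i]
    rfl

theorem fiber_mem_cycles {x : (fiber f) _⦋n⦌} (h1 : x.1.1 ∈ (cyclesLie A n).toLieSubalgebra)
    (h2 : ∀ j : Fin (n + 1), RLieCat.lieHom (L.δ (n := n) j.succ) (x.1.2 : L _⦋n + 1⦌) = 0) :
    x ∈ (cyclesLie (fiber f) n).toLieSubalgebra := by
  cases n with
  | zero => trivial
  | succ n =>
    rw [mem_cyclesLie_succ] at h1 ⊢
    intro i
    refine Subtype.ext (Prod.ext ?_ ?_)
    · rw [fiber_face_fst, h1 i]; rfl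
    · rw [fiber_face_snd, h2 i]; rfl

/-- Boundaries in the homotopy fiber. -/
theorem fiber_isBoundary_iff {x : (fiber f) _⦋n⦌} : IsBoundary (fiber f) n x ↔
    ∃ (b : A _⦋n + 1⦌) (w : L _⦋n + 2⦌),
      (∀ j : Fin (n + 1), RLieCat.lieHom (A.δ j.succ) b = 0) ∧
      RLieCat.lieHom (A.δ 0) b = x.1.1 ∧
      RLieCat.lieHom (L.δ 0) w = RLieCat.lieHom (f.app (op ⦋n + 1⦌)) b ∧
      (∀ j : Fin (n + 1), RLieCat.lieHom (L.δ j.succ.succ) w = 0) ∧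
      RLieCat.lieHom (L.δ 1) w = x.1.2 := by
  constructor
  · rintro ⟨y, hy, rfl⟩
    refine ⟨y.1.1, y.1.2, fun j => ?_, rfl, y.2.1, fun j => ?_, ?_⟩
    · rw [← fiber_face_fst, hy j]; rfl
    · exact (fiber_face_snd j.succ y).symm.trans (by rw [hy j]; rfl)
    · exact (fiber_face_snd 0 y).symm
  · rintro ⟨b, w, hb, hb0, hw0, hw, hw1⟩
    refine ⟨fiberMk b w hw0 (Fin.succ 0) (hw 0), fun j => ?_, ?_⟩
    · refine Subtype.ext (Prod.ext (hb j) ?_)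
      exact (fiber_face_snd j.succ _).trans (hw j)
    · refine Subtype.ext (Prod.ext hb0 ?_)
      exact (fiber_face_snd 0 _).trans hw1

end elements

/-- A factorization `f = q ∘ i` with `q` a weak equivalence induces an isomorphism between the
homotopy groups of the homotopy fibers of `i` and `f`. -/
theorem fiberMap_bijective {A Q L : SRLieCat p k} {i : A ⟶ Q} {q : Q ⟶ L} {f : A ⟶ L}
    (fac : i ≫ q = f) (hq : IsWeakEquiv q) (n : ℕ) :
    Function.Bijective (homotopyMap (fiberMap fac) n) := by
  subst fac
  constructor
  · rw [injective_iff_map_eq_zero]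
    intro x hx
    obtain ⟨x, hxc, rfl⟩ := piMk_surj x
    rw [homotopyMap_piMk, piMk_eq_zero, fiber_isBoundary_iff] at hx
    rw [piMk_eq_zero, fiber_isBoundary_iff]
    obtain ⟨b, w, hb, hb0, hw0, hw, hw1⟩ := hx
    have hxf := fiber_cycle_face hxc
    have hx0 := fiber_face0 x
    set γ : Q _⦋n + 1⦌ := x.1.2 with hγ
    replace hb0 : RLieCat.lieHom (A.δ 0) b = x.1.1 := hb0
    replace hw0 : RLieCat.lieHom (L.δ 0) w =
      RLieCat.lieHom (q.app (op ⦋n + 1⦌)) (RLieCat.lieHom (i.app (op ⦋n + 1⦌)) b) := hw0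
    replace hw1 : RLieCat.lieHom (L.δ 1) w = RLieCat.lieHom (q.app (op ⦋n + 1⦌)) γ := hw1
    set c : Q _⦋n + 1⦌ := RLieCat.lieHom (i.app (op ⦋n + 1⦌)) b with hc
    have hc0 : RLieCat.lieHom (Q.δ 0) c = RLieCat.lieHom (i.app (op ⦋n⦌)) x.1.1 := by
      rw [hc, map_face, hb0]
    have hcs : ∀ j : Fin (n + 1), RLieCat.lieHom (Q.δ j.succ) c = 0 := fun j => by
      rw [hc, map_face, hb, map_zero]
    have hζ : γ - c ∈ (cyclesLie Q (n + 1)).toLieSubalgebra := by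
      rw [mem_cyclesLie_succ]
      intro j
      induction j using Fin.cases with
      | zero => rw [map_sub, hx0, hc0, sub_self]
      | succ j => rw [map_sub, hxf, hcs, sub_self]
    obtain ⟨v, hv, hv0⟩ := hq.inj hζ (by
      have := face1_isBoundary (X := L)
        (w - RLieCat.lieHom (L.σ 0) (RLieCat.lieHom (q.app (op ⦋n + 1⦌)) c))
        (by rw [map_sub, face0_degen, hw0, sub_self])
        (fun l => by rw [map_sub, face_degen, map_face, hcs, map_zero, map_zero, hw, sub_zero])
      rw [map_sub, face1_degen, hw1, ← map_sub] at this
      exact this)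
    refine ⟨b, RLieCat.lieHom (Q.σ 0) c + (RLieCat.lieHom (Q.σ 0) (RLieCat.lieHom (Q.δ 0) v) - v),
      hb, hb0, ?_, fun j => ?_, ?_⟩
    · rw [map_add, map_sub, face0_degen, face0_degen, sub_self, add_zero]
    · rw [map_add, map_sub, face_degen, face_degen, hcs, face_face0, hv, map_zero, map_zero,
        sub_zero, zero_add, map_zero]
    · rw [map_add, map_sub, face1_degen, face1_degen, hv0]
      have h1 : RLieCat.lieHom (Q.δ 1) v = 0 := hv 0
      rw [h1, sub_zero, add_sub_cancel]
  · intro x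
    obtain ⟨x, hxc, rfl⟩ := piMk_surj x
    have hxf := fiber_cycle_face hxc
    have hx0 := fiber_face0 x
    have hac := fiber_cycle_fst hxc
    set γ : L _⦋n + 1⦌ := x.1.2 with hγ
    replace hx0 : RLieCat.lieHom (L.δ 0) γ =
      RLieCat.lieHom (q.app (op ⦋n⦌)) (RLieCat.lieHom (i.app (op ⦋n⦌)) x.1.1) := hx0
    obtain ⟨γ', hγ', hγ'0⟩ := hq.inj (map_mem_cyclesLie i hac) ⟨γ, hxf, hx0⟩
    obtain ⟨z, hz, w, hw, hw0⟩ := hq.surj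
      (z := γ - RLieCat.lieHom (q.app (op ⦋n + 1⦌)) γ') (by
        rw [mem_cyclesLie_succ]
        intro j
        induction j using Fin.cases with
        | zero => rw [map_sub, map_face, hγ'0, hx0, sub_self]
        | succ j => rw [map_sub, map_face, hγ', hxf, map_zero, sub_self])
    rw [mem_cyclesLie_succ] at hz
    have hys : ∀ j : Fin (n + 1), RLieCat.lieHom (Q.δ j.succ) (γ' + z) = 0 := fun j => by
      rw [map_add, hγ', hz, add_zero]
    let y : (fiber i) _⦋n⦌ := fiberMk (f := i) x.1.1 (γ' + z)
      (by rw [map_add, hz, hγ'0, add_zero]) 0 (hys 0)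
    have hy : y ∈ (cyclesLie (fiber i) n).toLieSubalgebra := fiber_mem_cycles hac hys
    refine ⟨piMk _ n y hy, ?_⟩
    rw [homotopyMap_piMk, piMk_eq, fiber_isBoundary_iff]
    refine ⟨0, w - RLieCat.lieHom (L.σ 0) (RLieCat.lieHom (L.δ 0) w), fun j => map_zero _,
      (map_zero _).trans (sub_self x.1.1).symm, ?_, fun j => ?_, ?_⟩
    · rw [map_sub, face0_degen, sub_self, map_zero]
    · rw [map_sub, face_degen, face_face0, hw, map_zero, map_zero, sub_zero]
    · have h1 : RLieCat.lieHom (L.δ 1) w = 0 := hw 0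
      rw [map_sub, face1_degen, h1, hw0, zero_sub]
      change _ = RLieCat.lieHom (q.app (op ⦋n + 1⦌)) (γ' + z) - γ
      rw [map_add]
      abel

/-- The homomorphism `πₙ(fib(i)) → πₙ(Ω coker(i)) = πₙ₊₁(coker(i))` induced by the map
`fib(i) = A ×_Q P Q → 0 ×_C P C = Ω C`, `(a, γ) ↦ γ`, where `C = coker(i)`. -/
def fiberToCokernel {A Q : SRLieCat p k} (i : A ⟶ Q) (n : ℕ) :
    homotopyGroup (fiber i) n →ₗ[k] homotopyGroup (cokernel i) (n + 1) :=
  Submodule.mapQ _ _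
    ((((cokernelMk i (op ⦋n + 1⦌) : Q _⦋n + 1⦌ →ₗ[k] (cokernel i) _⦋n + 1⦌).comp
      ((LinearMap.snd k (A _⦋n⦌) (Q _⦋n + 1⦌)).comp
        (fiberSub i (op ⦋n⦌)).toLieSubalgebra.toSubmodule.subtype)).comp
      (cycles ((oblvFunctor p k).obj (fiber i)) n).subtype).codRestrict
        (cycles ((oblvFunctor p k).obj (cokernel i)) (n + 1)) (fun x => by
          obtain ⟨x, hx⟩ := x
          refine mem_cycles_succ.2 fun j => ?_
          refine (cokernelMk_map i (SimplexCategory.δ j).op _).trans ?_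
          induction j using Fin.cases with
          | zero => exact (congrArg _ (fiber_face0 x)).trans (cokernelMk_i i _ _)
          | succ j => exact (congrArg _ (fiber_cycle_face hx j)).trans (map_zero _)))
    (fun x hx => by
      obtain ⟨x, hxc⟩ := x
      obtain ⟨b, w, hb, hb0, hw0, hw, hw1⟩ :=
        fiber_isBoundary_iff.1 (show IsBoundary (fiber i) n x from mem_boundaries.1 hx)
      refine mem_boundaries.2 (show IsBoundary (cokernel i) (n + 1)
        (cokernelMk i (op ⦋n + 1⦌) x.1.2) from ?_)
      have := face1_isBoundary (X := cokernel i) (cokernelMk i (op ⦋n + 2⦌) w)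
        ((cokernelMk_map i (SimplexCategory.δ 0).op _).trans
          ((congrArg _ hw0).trans (cokernelMk_i i _ _)))
        (fun l => (cokernelMk_map i (SimplexCategory.δ l.succ.succ).op _).trans
          ((congrArg _ (hw l)).trans (map_zero _)))
      have e : RLieCat.lieHom ((cokernel i).δ 1) (cokernelMk i (op ⦋n + 2⦌) w) =
          cokernelMk i (op ⦋n + 1⦌) x.1.2 :=
        (cokernelMk_map i (SimplexCategory.δ 1).op _).trans (congrArg _ hw1)
      rwa [e] at this)

end comparison

/-! ### Relative homotopy and homology groups of pairs -/

section relative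

variable {p : ℕ} {k : Type u} [Field k] [Fact p.Prime]

/-- The relative homotopy group `πₛ(L, A) = πₛ₋₁(fib(ι))`, `s ≥ 1`, of a pair `ι : A → L`. By
convention `π₀(L, A)` is the cokernel of `π₀(A) → π₀(L)`. -/
def relativeHomotopy {A L : SRLieCat p k} (ι : A ⟶ L) (s : ℕ) : ModuleCat.{u} k :=
  match s with
  | 0 => ModuleCat.of k (homotopyGroup L 0 ⧸ LinearMap.range (homotopyMap ι 0))
  | s + 1 => ModuleCat.of k (homotopyGroup (fiber ι) s)

/-- The operation `ξ` on the relative homotopy group `πₛ₊₁(L, A)`. -/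
def relativeXi {A L : SRLieCat p k} (ι : A ⟶ L) (s : ℕ) (x : relativeHomotopy ι (s + 1)) :
    relativeHomotopy ι (s + 1) := homotopyXi (fiber ι) s x

/-- A pair is `n`-connected if its relative homotopy groups vanish in degrees at most `n`. -/
def IsConnectedPair {A L : SRLieCat p k} (ι : A ⟶ L) (n : ℕ) : Prop :=
  ∀ i ≤ n, Subsingleton (relativeHomotopy ι i)

variable [CharP k p]

/-- The relative homology group `Hₛ(L, A; k{ξ})`, the reduced homology of the homotopy cofiber. -/
abbrev relativeXiHomology {A L : SRLieCat p k} {ι : A ⟶ L} (F : CofibrantFactorization ι)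
    (Q : CofibrantReplacement (cofiber F)) (s : ℕ) : ModuleCat.{u} (TwistedPoly p k) :=
  xiHomology Q s

/-- The relative Hurewicz homomorphism `πₛ(L, A) → Hₛ₊₁(L, A; k{ξ})` (with `s = m + 1`): the
composition `πₘ(fib(ι)) → πₘ(Ω cofib(ι)) = πₘ₊₁(cofib(ι)) → H̃ₘ₊₂(cofib(ι); k{ξ})`, where the
first map uses the identification of `fib(ι)` with the homotopy fiber of the cofibration `A → F.obj`
replacing `ι`. -/
def relativeHurewicz {A L : SRLieCat p k} {ι : A ⟶ L} (F : CofibrantFactorization ι)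
    (Q : CofibrantReplacement (cofiber F)) (m : ℕ) :
    relativeHomotopy ι (m + 1) →ₛₗ[TwistedPoly.C p k] relativeXiHomology F Q (m + 2) :=
  (hurewicz Q (m + 1)).comp ((fiberToCokernel F.i m).comp
    (LinearEquiv.ofBijective (homotopyMap (fiberMap F.fac) m)
      (fiberMap_bijective F.fac F.acyclic.1 m)).symm.toLinearMap)

end relative

end SRLie

end

open SRLie

/-!
The proof is carried out with simplices; neither free restricted Lie algebras nor a small object
argument enter.

**Factorizations.** `cellSRLie f` is obtained from `A` by attaching freely a simplex with `0`-th
face `z` and other faces zero, over every admissible simplex of `L`, for every cycle `z` that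
arises in the process. Its simplices are formal expressions (`CellTerm`), two expressions being
identified if they take the same value in all simplicial restricted Lie algebras in which the cells
have the prescribed faces (`CellTerm.Model`). A map out of it is a choice of values for the cells,
so `A → cellSRLie f` is a cofibration (`cofibrations_cellIncl`), and every cycle in the kernel of
`cellSRLie f → L` bounds by construction (`acyclicFibrations_desc`).

**Transport along weak equivalences.** If `φ : E → X` is a weak equivalence under `A` and `A → X`
is a cofibration, the end point map of the mapping path space of `φ` is an acyclic fibration, and
lifting the identity of `X` gives a section of `φ` up to homotopy relative to `A`
(`exists_homotopy_section`). It follows that the acyclicity of natural ideals modulo `A` may be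
checked on `E` (`RelAcyclic.of_isWeakEquiv`), and that weak equivalences between cofibrant objects
induce isomorphisms in homology (`abChainsMap_bijective`).

**Acyclicity of ideals.** Let the simplicial vector space `X / i(A)` have no homotopy in degrees at
most `n`. Then the subobject `E` of all simplices of `X` whose faces of dimension at most `n` lie
in `A` is weakly equivalent to `X` (`isWeakEquiv_eilenbergIncl`). In degree `n + 1`, the faces of
index `0` and `1` of `⁅s₀ x, s₀ q - s₁ q⁆` are `⁅x, q⁆`, up to a bracket with a simplex of `A`, and
`0`, and its remaining faces lie in `A` or are brackets with simplices of `A`. Hence `⁅x, q⁆` is a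
boundary modulo `A` as soon as brackets with simplices of `A` are (`relBd_lie`). For `A = 0` this
is no condition, and the ideal `[E, E]` is acyclic in degrees at most `n + 1`; by transport, so is
`[X, X]` for cofibrant `X` (`relAcyclic_commFamily`). If `A` is connected, a path from `0` to `a`
in `A` gives a homotopy from `0` to `⁅a, q⁆`, and the ideal generated by `A` is acyclic modulo `A`
in degrees at most `n + 1` (`relAcyclic_imageFamily`). The `p`-operation causes no difficulty,
since it is additive up to brackets (`exists_restrictedIdeal_relBd`).

**The theorems.** The acyclicity of `[X, X]` says that `X → Ab(X)` has a kernel that is acyclic in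
degrees at most `n + 1`, and the long exact sequence gives the Hurewicz theorem
(`hurewicz_of_connected`). In degree `0` the Hurewicz homomorphism is computed on vertices
(`hurewicz_zero_eq_zero_iff`). The acyclicity of the ideal generated by `A` says the same of the
map from `X / i(A)`, whose homotopy groups are those of the homotopy fiber, to the cokernel of the
cofibration `i`, which is the homotopy cofiber; combined with the Hurewicz theorem for the cokernel
it gives the relative Hurewicz theorem (`relativeHurewicz_of_connected`). For the Whitehead
theorem, a homology isomorphism is factored into a cofibration `i` and an acyclic fibration. As
cofibrations are degreewise split, the abelianization of the cokernel of `i` fits into a short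
exact sequence and has no homotopy; by induction, using both kinds of acyclicity, `X / i(A)` has no
homotopy either, and `i` is a weak equivalence (`isWeakEquiv_iff_xiHomologyMap`).
-/

set_option linter.unusedVariables false
set_option linter.unusedSectionVars false

noncomputable section

namespace SRLie

/-! ### Simplicial modules -/

section simplicialModules

variable {S : Type v} {T : Type w} [Ring S] [Ring T]

section identities

variable (Y : SMod.{u} S) {n : ℕ}

theorem face_degen_of_lt {i : Fin (n + 2)} {j : Fin (n + 1)} (h : i ≤ j.castSucc) (y : Y _⦋n + 1⦌) :
    (Y.δ i.castSucc).hom ((Y.σ j.succ).hom y) = (Y.σ j).hom ((Y.δ i).hom y) :=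
  LinearMap.congr_fun (congrArg ModuleCat.Hom.hom (Y.δ_comp_σ_of_le h)) y

theorem face_degen_of_gt {i : Fin (n + 2)} {j : Fin (n + 1)} (h : j.castSucc < i) (y : Y _⦋n + 1⦌) :
    (Y.δ i.succ).hom ((Y.σ j.castSucc).hom y) = (Y.σ j).hom ((Y.δ i).hom y) :=
  LinearMap.congr_fun (congrArg ModuleCat.Hom.hom (Y.δ_comp_σ_of_gt h)) y

theorem face_degen_castSucc (j : Fin (n + 1)) (y : Y _⦋n⦌) :
    (Y.δ j.castSucc).hom ((Y.σ j).hom y) = y :=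
  LinearMap.congr_fun (congrArg ModuleCat.Hom.hom (Y.δ_comp_σ_self (i := j))) y

theorem face_degen_succ (j : Fin (n + 1)) (y : Y _⦋n⦌) :
    (Y.δ j.succ).hom ((Y.σ j).hom y) = y :=
  LinearMap.congr_fun (congrArg ModuleCat.Hom.hom (Y.δ_comp_σ_succ (i := j))) y

/-- A face of a degeneracy, other than the two that give back the simplex, is a degeneracy of a
face. -/
theorem exists_face_degen {i : Fin (n + 3)} {j : Fin (n + 2)} (h : i ≠ j.castSucc)
    (h' : i ≠ j.succ) : ∃ (i' : Fin (n + 2)) (j' : Fin (n + 1)), ∀ y : Y _⦋n + 1⦌,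
      (Y.δ i).hom ((Y.σ j).hom y) = (Y.σ j').hom ((Y.δ i').hom y) := by
  rcases lt_or_gt_of_ne h with hlt | hgt
  · have hj : j ≠ 0 := by rintro rfl; simp at hlt
    obtain ⟨j, rfl⟩ := Fin.exists_succ_eq.2 hj
    have hi : i ≠ Fin.last _ := (hlt.trans_le (Fin.le_last _)).ne
    obtain ⟨i, rfl⟩ := Fin.exists_castSucc_eq.2 hi
    refine ⟨i, j, fun y => face_degen_of_lt Y ?_ y⟩
    simp only [Fin.lt_def, Fin.le_def, Fin.val_castSucc, Fin.val_succ] at hlt ⊢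
    omega
  · have hi : i ≠ 0 := (lt_of_le_of_lt (Fin.zero_le _) hgt).ne'
    obtain ⟨i, rfl⟩ := Fin.exists_succ_eq.2 hi
    have hlt : j < i := by
      simp only [Fin.lt_def, Fin.val_castSucc, Fin.val_succ, ne_eq, Fin.ext_iff] at hgt h' ⊢
      omega
    have hj : j ≠ Fin.last _ := (hlt.trans_le (Fin.le_last _)).ne
    obtain ⟨j, rfl⟩ := Fin.exists_castSucc_eq.2 hj
    exact ⟨i, j, fun y => face_degen_of_gt Y hlt y⟩

variable {Y}

theorem face_degen_of_mem {y : Y _⦋n⦌} (hy : y ∈ cycles Y n) {i : Fin (n + 2)} {j : Fin (n + 1)}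
    (h : i ≠ j.castSucc) (h' : i ≠ j.succ) : (Y.δ i).hom ((Y.σ j).hom y) = 0 := by
  cases n with
  | zero =>
    exfalso
    obtain rfl : j = 0 := Fin.fin_one_eq_zero j
    fin_cases i
    · exact h rfl
    · exact h' rfl
  | succ n =>
    obtain ⟨i', j', e⟩ := exists_face_degen Y h h'
    rw [e, mem_cycles_succ.1 hy, map_zero]

theorem face_mem_cycles_of_forall {y : Y _⦋n + 1⦌} (h : ∀ i : Fin (n + 1), (Y.δ i.succ).hom y = 0) :
    (Y.δ 0).hom y ∈ cycles Y n :=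
  boundaries_le_cycles (mem_boundaries.2 ⟨y, h, rfl⟩)

end identities

section normalized

variable {Y : SMod.{u} S} {Z : SMod.{u} T}

/-- The simplices all of whose faces but the one of index `0` vanish. -/
def IsNormalized (Y : SMod.{u} S) (n : ℕ) (y : Y _⦋n⦌) : Prop :=
  match n, y with
  | 0, _ => True
  | _ + 1, y => ∀ i, (Y.δ (Fin.succ i)).hom y = 0

/-- Subtracting degeneracies of faces makes the faces of positive index vanish, from the last one
downwards. -/
theorem exists_normalized {n : ℕ} (R : (Y _⦋n + 1⦌) → Prop)
    (hR : ∀ (y : Y _⦋n + 1⦌) (j : Fin (n + 1)), R y →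
      (∀ i : Fin (n + 1), j < i → (Y.δ i.succ).hom y = 0) →
      R (y - (Y.σ j).hom ((Y.δ j.succ).hom y)))
    {y : Y _⦋n + 1⦌} (hy : R y) : ∃ y', R y' ∧ IsNormalized Y (n + 1) y' := by
  suffices H : ∀ m : ℕ, m ≤ n + 1 → ∃ y', R y' ∧
      ∀ i : Fin (n + 1), n + 1 - m ≤ i.1 → (Y.δ i.succ).hom y' = 0 by
    obtain ⟨y', h, h'⟩ := H (n + 1) le_rfl
    exact ⟨y', h, fun i => h' i (by omega)⟩
  intro m
  induction m with
  | zero => exact fun _ => ⟨y, hy, fun i hi => by omega⟩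
  | succ m ih =>
    intro hm
    obtain ⟨x, hx, h⟩ := ih (by omega)
    let j : Fin (n + 1) := ⟨n - m, by omega⟩
    have hj : ∀ i : Fin (n + 1), j < i → (Y.δ i.succ).hom x = 0 := fun i hi => h i (by
      simp only [Fin.lt_def, j] at hi; omega)
    refine ⟨_, hR x j hx hj, fun i hi => ?_⟩
    rw [map_sub]
    rcases eq_or_ne i j with rfl | hij
    · rw [face_degen_succ, sub_self]
    · have hlt : j < i := lt_of_le_of_ne (by simp only [Fin.le_def, j]; omega) hij.symm
      rw [hj i hlt, zero_sub, neg_eq_zero]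
      cases n with
      | zero => exact absurd ((Fin.fin_one_eq_zero i).trans (Fin.fin_one_eq_zero j).symm) hij
      | succ n =>
        clear_value j
        obtain ⟨j, rfl⟩ := Fin.exists_castSucc_eq.2 (hlt.trans_le (Fin.le_last _)).ne
        rw [face_degen_of_gt Y hlt]
        have := d_d Y (i := j.succ) (j := i) (by
          simp only [Fin.lt_def, Fin.le_def, Fin.val_castSucc, Fin.val_succ] at hlt ⊢; omega) x
        rw [hj i hlt, map_zero] at this
        exact (congrArg _ this.symm).trans (map_zero _)

/-- A family of subgroups that is stable under degeneracies and contains all normalized simplices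
is everything. -/
theorem mem_of_normalized (P : ∀ n, AddSubgroup (Y _⦋n⦌))
    (hσ : ∀ (n : ℕ) (j : Fin (n + 1)) (y : Y _⦋n⦌), y ∈ P n → (Y.σ j).hom y ∈ P (n + 1))
    (hP : ∀ (n : ℕ) (y : Y _⦋n⦌), IsNormalized Y n y → y ∈ P n) (n : ℕ) (y : Y _⦋n⦌) :
    y ∈ P n := by
  induction n with
  | zero => exact hP 0 y trivial
  | succ n ih =>
    obtain ⟨y', h, h'⟩ := exists_normalized (fun x => x ∈ P (n + 1) → y ∈ P (n + 1))
      (fun x j hx _ h => hx (by simpa using add_mem h (hσ n j _ (ih ((Y.δ j.succ).hom x)))))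
      (y := y) id
    exact h (hP _ _ h')

end normalized

/-! ### Degreewise additive maps and their kernels -/

/-- Degreewise additive maps commuting with faces and degeneracies. The two simplicial modules may
be over different rings, so that semilinear maps are included. -/
structure SimplicialAddHom (Y : SMod.{u} S) (Z : SMod.{u} T) where
  app : ∀ n : ℕ, Y _⦋n⦌ →+ Z _⦋n⦌
  face : ∀ (n : ℕ) (i : Fin (n + 2)) (y : Y _⦋n + 1⦌),
    (Z.δ i).hom (app (n + 1) y) = app n ((Y.δ i).hom y)
  degen : ∀ (n : ℕ) (j : Fin (n + 1)) (y : Y _⦋n⦌),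
    (Z.σ j).hom (app n y) = app (n + 1) ((Y.σ j).hom y)

/-- `z` is the face of index `0` of a simplex of `P` whose other faces vanish. -/
def BdIn (Y : SMod.{u} S) (P : ∀ n : ℕ, Set (Y _⦋n⦌)) (n : ℕ) (z : Y _⦋n⦌) : Prop :=
  ∃ w ∈ P (n + 1), (∀ i : Fin (n + 1), (Y.δ i.succ).hom w = 0) ∧ (Y.δ 0).hom w = z

namespace SimplicialAddHom

variable {Y : SMod.{u} S} {Z : SMod.{u} T} (g : SimplicialAddHom Y Z)

/-- The map underlying a morphism of simplicial modules. -/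
def ofHom {Y Z : SMod.{u} S} (f : Y ⟶ Z) : SimplicialAddHom Y Z where
  app n := (f.app (op ⦋n⦌)).hom.toAddMonoidHom
  face _ i y := (LinearMap.congr_fun (congrArg ModuleCat.Hom.hom
      (f.naturality (SimplexCategory.δ i).op)) y).symm
  degen _ j y := (LinearMap.congr_fun (congrArg ModuleCat.Hom.hom
      (f.naturality (SimplexCategory.σ j).op)) y).symm

/-- Degreewise surjectivity. -/
def IsSurjective : Prop := ∀ n, Function.Surjective (g.app n)

/-- The kernel. -/
def ker (n : ℕ) : AddSubgroup (Y _⦋n⦌) := (g.app n).ker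

/-- The vanishing of the `n`-th homotopy group of the kernel. -/
def KerAcyclic (n : ℕ) : Prop :=
  ∀ x ∈ cycles Y n, x ∈ g.ker n → BdIn Y (fun m => (g.ker m : Set (Y _⦋m⦌))) n x

variable {g}

theorem map_cycles {n : ℕ} {y : Y _⦋n⦌} (hy : y ∈ cycles Y n) : g.app n y ∈ cycles Z n := by
  cases n with
  | zero => trivial
  | succ n =>
    rw [mem_cycles_succ] at hy ⊢
    intro i
    rw [g.face, hy, map_zero]

theorem map_boundaries {n : ℕ} {y : Y _⦋n⦌} (hy : y ∈ boundaries Y n) :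
    g.app n y ∈ boundaries Z n := by
  obtain ⟨w, hw, rfl⟩ := mem_boundaries.1 hy
  exact mem_boundaries.2 ⟨g.app _ w, fun i => by rw [g.face, hw, map_zero], g.face _ _ _⟩

/-- Normalized simplices lift to normalized simplices along a degreewise surjective map. -/
theorem exists_normalized_lift (hg : g.IsSurjective) {n : ℕ} {z : Z _⦋n + 1⦌}
    (hz : ∀ i : Fin (n + 1), (Z.δ i.succ).hom z = 0) :
    ∃ y : Y _⦋n + 1⦌, (∀ i : Fin (n + 1), (Y.δ i.succ).hom y = 0) ∧ g.app _ y = z := by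
  obtain ⟨y, hy⟩ := hg _ z
  obtain ⟨y', h, h'⟩ := exists_normalized (fun x => g.app (n + 1) x = z)
    (fun x j hx _ => by
      rw [map_sub, ← g.degen, ← g.face, hx, hz, map_zero, sub_zero]) hy
  exact ⟨y', h', h⟩

theorem exists_boundary_lift (hg : g.IsSurjective) {n : ℕ} {z : Z _⦋n⦌} (hz : z ∈ boundaries Z n) :
    ∃ y ∈ boundaries Y n, g.app n y = z := by
  obtain ⟨w, hw, rfl⟩ := mem_boundaries.1 hz
  obtain ⟨y, hy, rfl⟩ := exists_normalized_lift hg hw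
  exact ⟨_, mem_boundaries.2 ⟨y, hy, rfl⟩, (g.face _ _ _).symm⟩

theorem KerAcyclic.mem_boundaries (hg : g.IsSurjective) {n : ℕ} (h : g.KerAcyclic n) {y : Y _⦋n⦌}
    (hy : y ∈ cycles Y n) (hz : g.app n y ∈ boundaries Z n) : y ∈ boundaries Y n := by
  obtain ⟨y', hy', e⟩ := exists_boundary_lift hg hz
  obtain ⟨w, -, hw, hw0⟩ := h (y - y') (sub_mem hy (boundaries_le_cycles hy'))
    (by change g.app n _ = 0; rw [map_sub, e, sub_self])
  have := add_mem (SRLie.mem_boundaries.2 ⟨w, hw, hw0⟩) hy'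
  rwa [sub_add_cancel] at this

/-- Simplices of the target with one possibly nonvanishing face lift along a surjective map with
acyclic kernel, the nonvanishing face being prescribed. -/
theorem KerAcyclic.exists_lift (hg : g.IsSurjective) {n : ℕ} (h : g.KerAcyclic n) {z : Z _⦋n + 1⦌}
    (hz : ∀ i : Fin (n + 1), (Z.δ i.succ).hom z = 0) {a : Y _⦋n⦌} (ha : a ∈ cycles Y n)
    (e : (Z.δ 0).hom z = g.app n a) :
    ∃ y : Y _⦋n + 1⦌, (∀ i : Fin (n + 1), (Y.δ i.succ).hom y = 0) ∧ (Y.δ 0).hom y = a ∧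
      g.app _ y = z := by
  obtain ⟨y, hy, rfl⟩ := exists_normalized_lift hg hz
  obtain ⟨w, hwk, hw, hw0⟩ := h ((Y.δ 0).hom y - a)
    (sub_mem (face_mem_cycles_of_forall hy) ha)
    (by change g.app n _ = 0; rw [map_sub, ← g.face, e, sub_self])
  refine ⟨y - w, fun i => ?_, ?_, ?_⟩
  · rw [map_sub, hy, hw, sub_zero]
  · rw [map_sub, hw0, sub_sub_cancel]
  · rw [map_sub, show g.app (n + 1) w = 0 from hwk, sub_zero]

theorem KerAcyclic.exists_cycle (hg : g.IsSurjective) {n : ℕ} (h : g.KerAcyclic n) {z : Z _⦋n + 1⦌}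
    (hz : z ∈ cycles Z (n + 1)) : ∃ y ∈ cycles Y (n + 1), g.app _ y = z := by
  rw [mem_cycles_succ] at hz
  obtain ⟨y, hy, hy0, e⟩ := h.exists_lift hg (fun i => hz i.succ) (zero_mem _)
    ((hz 0).trans (map_zero _).symm)
  exact ⟨y, mem_cycles_succ.2 (Fin.cases hy0 hy), e⟩

/-- The kernel is acyclic in degree `n` if the map is injective on `πₙ` and surjective on
`πₙ₊₁`. -/
theorem kerAcyclic_of (hg : g.IsSurjective) {n : ℕ}
    (h : ∀ y ∈ cycles Y n, g.app n y ∈ boundaries Z n → y ∈ boundaries Y n)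
    (h' : ∀ z ∈ cycles Z (n + 1), ∃ y ∈ cycles Y (n + 1), z - g.app _ y ∈ boundaries Z (n + 1)) :
    g.KerAcyclic n := by
  intro x hx hxk
  obtain ⟨y, hy, rfl⟩ := SRLie.mem_boundaries.1 (h x hx (by
    rw [show g.app n x = 0 from hxk]; exact zero_mem _))
  have hgy : g.app _ y ∈ cycles Z (n + 1) := by
    refine mem_cycles_succ.2 (Fin.cases ?_ fun i => ?_)
    · rw [g.face]; exact hxk
    · rw [g.face, hy, map_zero]
  obtain ⟨c, hc, hb⟩ := h' _ hgy
  obtain ⟨b, hb, e⟩ := exists_boundary_lift hg hb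
  have hb' := boundaries_le_cycles hb
  rw [mem_cycles_succ] at hc hb'
  refine ⟨y - c - b, ?_, fun i => ?_, ?_⟩
  · change g.app _ _ = 0
    rw [map_sub, map_sub, e, sub_self]
  · rw [map_sub, map_sub, hy, hc, hb', sub_zero, sub_zero]
  · rw [map_sub, map_sub, hc, hb', sub_zero, sub_zero]

/-- If the target has no homotopy in degree `n + 1`, the `n`-th homotopy group of the kernel injects
into that of the source. -/
theorem bdIn_ker_of_acyclic (hg : g.IsSurjective) {n : ℕ}
    (h : ∀ z ∈ cycles Z (n + 1), z ∈ boundaries Z (n + 1)) {x : Y _⦋n⦌} (hx : x ∈ g.ker n)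
    (hb : x ∈ boundaries Y n) : BdIn Y (fun m => (g.ker m : Set (Y _⦋m⦌))) n x := by
  obtain ⟨y, hy, rfl⟩ := SRLie.mem_boundaries.1 hb
  have hgy : g.app _ y ∈ cycles Z (n + 1) := by
    refine mem_cycles_succ.2 (Fin.cases ?_ fun i => ?_)
    · rw [g.face]; exact hx
    · rw [g.face, hy, map_zero]
  obtain ⟨b, hb, e⟩ := exists_boundary_lift hg (h _ hgy)
  have hb' := boundaries_le_cycles hb
  rw [mem_cycles_succ] at hb'
  refine ⟨y - b, ?_, fun i => ?_, ?_⟩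
  · change g.app _ _ = 0
    rw [map_sub, e, sub_self]
  · rw [map_sub, hy, hb', sub_zero]
  · rw [map_sub, hb', sub_zero]

/-- If the target has no homotopy in degree `n`, the `n`-th homotopy group of the kernel maps onto
that of the source. -/
theorem exists_cycle_ker (hg : g.IsSurjective) {n : ℕ} (h : ∀ z ∈ cycles Z n, z ∈ boundaries Z n)
    {y : Y _⦋n⦌} (hy : y ∈ cycles Y n) :
    ∃ x ∈ cycles Y n, x ∈ g.ker n ∧ y - x ∈ boundaries Y n := by
  obtain ⟨b, hb, e⟩ := exists_boundary_lift hg (h _ (map_cycles hy))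
  refine ⟨y - b, sub_mem hy (boundaries_le_cycles hb), ?_, by simpa using hb⟩
  change g.app _ _ = 0
  rw [map_sub, e, sub_self]

end SimplicialAddHom

/-! ### Homotopies -/

section homotopies

variable {Y : SMod.{u} S} {P : ∀ n : ℕ, AddSubgroup (Y _⦋n⦌)}

theorem bdIn_add {n : ℕ} {y z : Y _⦋n⦌} (hy : BdIn Y (fun m => P m) n y)
    (hz : BdIn Y (fun m => P m) n z) : BdIn Y (fun m => P m) n (y + z) := by
  obtain ⟨v, hv, hvs, rfl⟩ := hy
  obtain ⟨w, hw, hws, rfl⟩ := hz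
  exact ⟨v + w, add_mem hv hw, fun i => by rw [map_add, hvs, hws, add_zero], map_add _ _ _⟩

theorem bdIn_neg {n : ℕ} {y : Y _⦋n⦌} (hy : BdIn Y (fun m => P m) n y) :
    BdIn Y (fun m => P m) n (-y) := by
  obtain ⟨v, hv, hvs, rfl⟩ := hy
  exact ⟨-v, neg_mem hv, fun i => by rw [map_neg, hvs, neg_zero], map_neg _ _⟩

theorem bdIn_zero {n : ℕ} : BdIn Y (fun m => P m) n 0 :=
  ⟨0, zero_mem _, fun _ => map_zero _, map_zero _⟩

theorem bdIn_sub {n : ℕ} {y z : Y _⦋n⦌} (hy : BdIn Y (fun m => P m) n y)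
    (hz : BdIn Y (fun m => P m) n z) : BdIn Y (fun m => P m) n (y - z) := by
  rw [sub_eq_add_neg]
  exact bdIn_add hy (bdIn_neg hz)

theorem BdIn.mem_boundaries {n : ℕ} {z : Y _⦋n⦌} (h : BdIn Y (fun m => P m) n z) :
    z ∈ boundaries Y n := by
  obtain ⟨w, -, hw, rfl⟩ := h
  exact SRLie.mem_boundaries.2 ⟨w, hw, rfl⟩

variable (hδ : ∀ (n : ℕ) (i : Fin (n + 2)) (y : Y _⦋n + 1⦌), y ∈ P (n + 1) → (Y.δ i).hom y ∈ P n)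
  (hσ : ∀ (n : ℕ) (j : Fin (n + 1)) (y : Y _⦋n⦌), y ∈ P n → (Y.σ j).hom y ∈ P (n + 1))

include hδ hσ

/-- If `w` has at most two nonvanishing faces, which are adjacent, their difference is a
boundary. The proof is by induction on the index `t` of the first of these faces: subtracting
degeneracies moves the nonvanishing faces of `w` to the indices `t - 1` and `t`. -/
theorem bdIn_sub_of_two_faces {n : ℕ} (t : ℕ) (ht : t < n + 1) {w : Y _⦋n + 1⦌} (hw : w ∈ P (n + 1))
    {y z : Y _⦋n⦌} (hy : y ∈ cycles Y n) (hz : z ∈ cycles Y n)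
    (ey : (Y.δ (Fin.castSucc ⟨t, ht⟩)).hom w = y) (ez : (Y.δ (Fin.succ ⟨t, ht⟩)).hom w = z)
    (h : ∀ i : Fin (n + 2), i ≠ Fin.castSucc ⟨t, ht⟩ → i ≠ Fin.succ ⟨t, ht⟩ →
      (Y.δ i).hom w = 0) : BdIn Y (fun m => P m) n (y - z) := by
  have hzP : z ∈ P n := ez ▸ hδ _ _ _ hw
  induction t generalizing w y z with
  | zero =>
    refine ⟨w - (Y.σ 0).hom z, sub_mem hw (hσ _ _ _ hzP), fun i => ?_, ?_⟩
    · rw [map_sub]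
      rcases Fin.eq_zero_or_eq_succ i with rfl | ⟨i, rfl⟩
      · rw [show (Y.δ (Fin.succ 0)).hom w = z from ez]
        exact sub_eq_zero.2 (face_degen_succ Y 0 z).symm
      · rw [h _ (by simp [Fin.ext_iff]) (by simp [Fin.ext_iff]),
          face_degen_of_mem hz (by simp [Fin.ext_iff]) (by simp [Fin.ext_iff]), sub_zero]
    · rw [map_sub]
      exact congrArg₂ _ ey (face_degen_castSucc Y 0 z)
  | succ t ih =>
    have hs : (⟨t + 1, ht⟩ : Fin (n + 1)).castSucc = (⟨t, by omega⟩ : Fin (n + 1)).succ := rfl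
    have hyz : y - z ∈ P n := sub_mem (ey ▸ hδ _ _ _ hw) hzP
    have hc := sub_mem hy hz
    have := ih (by omega)
      (w := w - (Y.σ ⟨t + 1, ht⟩).hom z - (Y.σ ⟨t, by omega⟩).hom (y - z)) (y := -(y - z)) (z := 0)
      (sub_mem (sub_mem hw (hσ _ _ _ hzP)) (hσ _ _ _ hyz)) (neg_mem hc) (zero_mem _) ?_ ?_ ?_
      (zero_mem _)
    · simpa using bdIn_neg this
    · rw [map_sub, map_sub, face_degen_castSucc, h, face_degen_of_mem hz, sub_zero, zero_sub] <;>
        simp [Fin.ext_iff] <;> omega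
    · rw [map_sub, map_sub, face_degen_succ, ← hs, ey, face_degen_castSucc, sub_self]
    · intro i hi hi'
      rw [map_sub, map_sub, face_degen_of_mem hc hi hi', sub_zero]
      rcases eq_or_ne i (Fin.succ ⟨t + 1, ht⟩) with rfl | hi''
      · rw [ez, face_degen_succ, sub_self]
      · rw [h i (hs ▸ hi') hi'', face_degen_of_mem hz (hs ▸ hi') hi'', sub_zero]

end homotopies

/-- The map `[m] → [1]` that takes the value `0` exactly on the vertices smaller than `t`. -/
def cut (m : SimplexCategory) (t : ℕ) : m ⟶ ⦋1⦌ :=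
  SimplexCategory.Hom.mk
    { toFun := fun r => if r.1 < t then (0 : Fin 2) else 1
      monotone' := by
        intro r s h
        have h' : r.1 ≤ s.1 := h
        dsimp only
        split_ifs <;> first | omega | simp }

/-- The constant map `[m] → [1]` with value `e`. -/
def constMap (m : SimplexCategory) (e : Fin 2) : m ⟶ ⦋1⦌ := SimplexCategory.const m ⦋1⦌ e

theorem δ_castSucc_cut {n : ℕ} (t : Fin (n + 1)) :
    SimplexCategory.δ t.castSucc ≫ cut ⦋n + 1⦌ (t + 1) = cut ⦋n⦌ t := by
  ext r : 3
  change (if (t.castSucc.succAbove r).1 < t + 1 then (0 : Fin 2) else 1) =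
    if r.1 < t then (0 : Fin 2) else 1
  congr 1
  simp only [Fin.succAbove, Fin.lt_def, Fin.val_castSucc, eq_iff_iff]
  grind

theorem δ_succ_cut {n : ℕ} (t : Fin (n + 1)) :
    SimplexCategory.δ t.succ ≫ cut ⦋n + 1⦌ (t + 1) = cut ⦋n⦌ (t + 1) := by
  ext r : 3
  change (if (t.succ.succAbove r).1 < t + 1 then (0 : Fin 2) else 1) =
    if r.1 < t + 1 then (0 : Fin 2) else 1
  congr 1
  simp only [Fin.succAbove, Fin.lt_def, Fin.val_castSucc, Fin.val_succ, eq_iff_iff]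
  grind

theorem cut_zero (m : SimplexCategory) : cut m 0 = constMap m 1 := rfl

theorem cut_len (n : ℕ) : cut ⦋n⦌ (n + 1) = constMap ⦋n⦌ 0 := by
  ext r : 3
  exact if_pos r.2

/-- The end maps of a simplicial homotopy agree on homotopy classes. The filling simplices lie in
any simplicial subgroup `P` that contains the values of the homotopy on the degeneracies of `z`. -/
theorem bdIn_of_homotopy {Y : SMod.{u} S} {Z : SMod.{u} T} {P : ∀ n : ℕ, AddSubgroup (Z _⦋n⦌)}
    (hδ : ∀ (n : ℕ) (i : Fin (n + 2)) (y : Z _⦋n + 1⦌), y ∈ P (n + 1) → (Z.δ i).hom y ∈ P n)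
    (hσ : ∀ (n : ℕ) (j : Fin (n + 1)) (y : Z _⦋n⦌), y ∈ P n → (Z.σ j).hom y ∈ P (n + 1))
    (h : ∀ n : ℕ, (⦋n⦌ ⟶ ⦋1⦌) → Y _⦋n⦌ → Z _⦋n⦌) (h0 : ∀ n χ, h n χ 0 = 0)
    (hface : ∀ (n : ℕ) (χ : ⦋n + 1⦌ ⟶ ⦋1⦌) (i : Fin (n + 2)) (y : Y _⦋n + 1⦌),
      (Z.δ i).hom (h (n + 1) χ y) = h n (SimplexCategory.δ i ≫ χ) ((Y.δ i).hom y))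
    {n : ℕ} {z : Y _⦋n⦌} (hz : z ∈ cycles Y n)
    (hP : ∀ (χ : ⦋n + 1⦌ ⟶ ⦋1⦌) (j : Fin (n + 1)), h (n + 1) χ ((Y.σ j).hom z) ∈ P (n + 1)) :
    BdIn Z (fun m => P m) n (h n (constMap ⦋n⦌ 1) z - h n (constMap ⦋n⦌ 0) z) := by
  have hc : ∀ χ, h n χ z ∈ cycles Z n := by
    intro χ
    cases n with
    | zero => trivial
    | succ n =>
      rw [mem_cycles_succ] at hz ⊢
      intro i
      rw [hface, hz, h0]
  suffices H : ∀ t : ℕ, t ≤ n + 1 →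
      BdIn Z (fun m => P m) n (h n (cut ⦋n⦌ 0) z - h n (cut ⦋n⦌ t) z) by
    have := H (n + 1) le_rfl
    rwa [cut_zero, cut_len] at this
  intro t
  induction t with
  | zero =>
    intro _
    rw [sub_self]
    exact bdIn_zero
  | succ t ih =>
    intro ht
    rw [← sub_add_sub_cancel _ (h n (cut ⦋n⦌ t) z)]
    refine bdIn_add (ih (by omega)) ?_
    refine bdIn_sub_of_two_faces hδ hσ t ht
      (hP (cut ⦋n + 1⦌ (t + 1)) ⟨t, ht⟩) (hc _) (hc _) ?_ ?_ ?_
    · rw [hface, face_degen_castSucc, δ_castSucc_cut ⟨t, ht⟩]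
    · rw [hface, face_degen_succ, δ_succ_cut ⟨t, ht⟩]
    · intro i hi hi'
      rw [hface, face_degen_of_mem hz hi hi', h0]

section piGroups

variable {Y : SMod.{u} S} {Z : SMod.{u} T} {ρ : S →+* T} {g : ∀ n : ℕ, Y _⦋n⦌ →ₛₗ[ρ] Z _⦋n⦌}
  (hg : ∀ (n : ℕ) (i : Fin (n + 2)) (y : Y _⦋n + 1⦌),
      (Z.δ i).hom (g (n + 1) y) = g n ((Y.δ i).hom y)) (n : ℕ)

theorem subsingleton_piGroup_iff : Subsingleton (PiGroup Y n) ↔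
    ∀ z ∈ cycles Y n, z ∈ boundaries Y n := by
  refine ⟨fun h z hz => PiGroup.mk_eq_zero.1 (h.elim (PiGroup.mk ⟨z, hz⟩) 0), fun h => ⟨?_⟩⟩
  suffices H : ∀ x : PiGroup Y n, x = 0 from fun x y => (H x).trans (H y).symm
  intro x
  obtain ⟨z, rfl⟩ := Submodule.Quotient.mk_surjective _ x
  exact PiGroup.mk_eq_zero.2 (h z z.2)

theorem mapSemi_injective_iff : Function.Injective (PiGroup.mapSemi g hg n) ↔
    ∀ y ∈ cycles Y n, g n y ∈ boundaries Z n → y ∈ boundaries Y n := by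
  rw [injective_iff_map_eq_zero]
  constructor
  · intro h y hy hb
    exact PiGroup.mk_eq_zero.1 (h (PiGroup.mk ⟨y, hy⟩) (PiGroup.mk_eq_zero.2 hb))
  · intro h x hx
    obtain ⟨z, rfl⟩ := Submodule.Quotient.mk_surjective _ x
    exact PiGroup.mk_eq_zero.2 (h z z.2 (PiGroup.mk_eq_zero.1 hx))

theorem mapSemi_surjective_iff : Function.Surjective (PiGroup.mapSemi g hg n) ↔
    ∀ z ∈ cycles Z n, ∃ y ∈ cycles Y n, z - g n y ∈ boundaries Z n := by
  constructor
  · intro h z hz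
    obtain ⟨x, hx⟩ := h (PiGroup.mk ⟨z, hz⟩)
    obtain ⟨y, rfl⟩ := Submodule.Quotient.mk_surjective _ x
    exact ⟨y, y.2, PiGroup.mk_eq_mk.1 hx.symm⟩
  · intro h x
    obtain ⟨z, rfl⟩ := Submodule.Quotient.mk_surjective _ x
    obtain ⟨y, hy, hb⟩ := h z z.2
    exact ⟨PiGroup.mk ⟨y, hy⟩, (PiGroup.mk_eq_mk.2 hb).symm⟩

end piGroups

theorem PiGroup.map_id (Y : SMod.{u} S) (n : ℕ) (x : PiGroup Y n) : PiGroup.map (𝟙 Y) n x = x := by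
  obtain ⟨z, rfl⟩ := Submodule.Quotient.mk_surjective _ x
  rfl

theorem PiGroup.map_comp {Y Z W : SMod.{u} S} (f : Y ⟶ Z) (g : Z ⟶ W) (n : ℕ) (x : PiGroup Y n) :
    PiGroup.map (f ≫ g) n x = PiGroup.map g n (PiGroup.map f n x) := by
  obtain ⟨z, rfl⟩ := Submodule.Quotient.mk_surjective _ x
  rfl

end simplicialModules

/-- A simplicial homotopy `X × Δ[1] → Y` from `f` to `g`: maps `Xₙ → Yₙ` indexed by the
`n`-simplices of `Δ[1]`, natural in `n`. -/
structure SimplicialHomotopy {C : Type*} [Category C] {X Y : SimplicialObject C} (f g : X ⟶ Y) where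
  app : ∀ (n : SimplexCategory), (n ⟶ ⦋1⦌) → (X.obj (op n) ⟶ Y.obj (op n))
  naturality : ∀ {m n : SimplexCategory} (θ : m ⟶ n) (χ : n ⟶ ⦋1⦌),
    X.map θ.op ≫ app m (θ ≫ χ) = app n χ ≫ Y.map θ.op
  app_zero : ∀ n, app n (constMap n 0) = f.app (op n)
  app_one : ∀ n, app n (constMap n 1) = g.app (op n)

namespace SimplicialHomotopy

/-- The image of a simplicial homotopy under a functor applied degreewise. -/
def whisker {C D : Type*} [Category C] [Category D] {X Y : SimplicialObject C} {f g : X ⟶ Y}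
    (H : SimplicialHomotopy f g) (F : C ⥤ D) :
    SimplicialHomotopy (((SimplicialObject.whiskering C D).obj F).map f)
      (((SimplicialObject.whiskering C D).obj F).map g) where
  app n χ := F.map (H.app n χ)
  naturality θ χ := by
    change F.map _ ≫ F.map _ = F.map _ ≫ F.map _
    rw [← F.map_comp, ← F.map_comp, H.naturality]
  app_zero n := congrArg F.map (H.app_zero n)
  app_one n := congrArg F.map (H.app_one n)

theorem map_eq {S : Type v} [Ring S] {Y Z : SMod.{u} S} {f g : Y ⟶ Z} (H : SimplicialHomotopy f g)
    (n : ℕ) (x : PiGroup Y n) : PiGroup.map f n x = PiGroup.map g n x := by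
  obtain ⟨z, rfl⟩ := Submodule.Quotient.mk_surjective _ x
  refine Eq.symm (PiGroup.mk_eq_mk.2 ?_)
  have := bdIn_of_homotopy (Y := Y) (Z := Z) (P := fun _ => ⊤) (fun _ _ _ _ => trivial)
    (fun _ _ _ _ => trivial) (fun n χ => (H.app ⦋n⦌ χ).hom) (fun _ _ => map_zero _)
    (fun n χ i y => (LinearMap.congr_fun (congrArg ModuleCat.Hom.hom
      (H.naturality (SimplexCategory.δ i) χ)) y).symm) z.2 (fun _ _ => trivial)
  rw [H.app_zero, H.app_one] at this
  exact BdIn.mem_boundaries this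

end SimplicialHomotopy

/-! ### Products of restricted Lie algebras -/

section products

variable {p : ℕ} {k : Type u} [Field k] {ι : Type} (N : ι → RLieCat p k)

instance piLieRing : LieRing (∀ i, N i) where
  bracket x y i := ⁅x i, y i⁆
  add_lie _ _ _ := funext fun _ => add_lie _ _ _
  lie_add _ _ _ := funext fun _ => lie_add _ _ _
  lie_self _ := funext fun _ => lie_self _
  leibniz_lie _ _ _ := funext fun _ => leibniz_lie _ _ _

instance piLieAlgebra : LieAlgebra k (∀ i, N i) where
  lie_smul _ _ _ := funext fun _ => lie_smul _ _ _

/-- The projection of a product of restricted Lie algebras to a factor. -/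
def piProj (i : ι) : (∀ i, N i) →ₗ⁅k⁆ N i :=
  { LinearMap.proj (R := k) (φ := fun i => (N i : Type u)) i with map_lie' := rfl }

instance piRestricted : RestrictedLieAlgebra p k (∀ i, N i) where
  pOp x i := pOp p k (x i)
  pOp_smul a x := funext fun _ => RestrictedLieAlgebra.pOp_smul _ _
  lie_pOp x y := funext fun i => (RestrictedLieAlgebra.lie_pOp (x i) (y i)).trans
    (map_lie_iterate (piProj N i) x y p).symm
  pOp_add x y := funext fun i => by
    refine (RestrictedLieAlgebra.pOp_add (x i) (y i)).trans
      (congrArg (pOp p k (x i) + pOp p k (y i) + ·) ?_)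
    refine Eq.trans ?_ (map_sum (piProj N i)
      (fun j : ℕ => ((j : k)⁻¹) • adCoeff x y (p - 1) (j - 1)) (Finset.Icc 1 (p - 1))).symm
    exact Finset.sum_congr rfl fun j _ => congrArg _ (map_adCoeff (piProj N i) x y _ _).symm

/-- The product of a family of restricted Lie algebras. -/
def piRLie : RLieCat p k where
  carrier := ∀ i, N i

end products

/-! ### Mapping path spaces -/

section mappingPath

variable {p : ℕ} {k : Type u} [Field k]

/-- The simplices of `Δ[n] × Δ[1]`. -/
abbrev PathIndex (n : SimplexCategory) : Type := Σ m : SimplexCategory, (m ⟶ n) × (m ⟶ ⦋1⦌)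

/-- The restriction of a simplex of `Δ[n] × Δ[1]` along a simplicial operator. -/
abbrev PathIndex.restrict {n : SimplexCategory} (s : PathIndex n) {m : SimplexCategory}
    (η : m ⟶ s.1) : PathIndex n := ⟨m, η ≫ s.2.1, η ≫ s.2.2⟩

/-- The image of a simplex under `Δ[m] × Δ[1] → Δ[n] × Δ[1]`. -/
abbrev PathIndex.push {m n : SimplexCategory} (θ : m ⟶ n) (s : PathIndex m) : PathIndex n :=
  ⟨s.1, s.2.1 ≫ θ, s.2.2⟩

theorem PathIndex.congr {X : SRLieCat p k} {n : SimplexCategory}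
    (γ : ∀ s : PathIndex n, X.obj (op s.1)) {m : SimplexCategory} {θ θ' : m ⟶ n} {χ χ' : m ⟶ ⦋1⦌}
    (h : θ = θ') (h' : χ = χ') : γ ⟨m, θ, χ⟩ = γ ⟨m, θ', χ'⟩ := by
  subst h h'
  rfl

variable {E X : SRLieCat p k} (φ : E ⟶ X)

/-- The `n`-simplices `(e, γ)` of the mapping path space `E ×_X X^{Δ[1]}`: an `n`-simplex `e` of `E`
and a map `γ : Δ[n] × Δ[1] → X` whose restriction to `Δ[n] × {0}` is `φ(e)`. -/
def mappingPathSub (n : SimplexCategoryᵒᵖ) :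
    RestrictedSubalgebra p k (E.obj n × ∀ s : PathIndex n.unop, X.obj (op s.1)) where
  carrier := {x | (∀ (s : PathIndex n.unop) {m : SimplexCategory} (η : m ⟶ s.1),
      RLieCat.lieHom (X.map η.op) (x.2 s) = x.2 (s.restrict η)) ∧
    x.2 ⟨n.unop, 𝟙 _, constMap _ 0⟩ = RLieCat.lieHom (φ.app n) x.1}
  add_mem' {x y} hx hy := ⟨fun s m η => by
      rw [Prod.snd_add, Pi.add_apply, map_add, hx.1, hy.1]; rfl, by
      rw [Prod.snd_add, Pi.add_apply, Prod.fst_add, map_add, hx.2, hy.2]⟩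
  zero_mem' := ⟨fun s m η => map_zero _, (map_zero _).symm⟩
  smul_mem' a x hx := ⟨fun s m η => by
      rw [Prod.smul_snd, Pi.smul_apply, map_smul, hx.1]; rfl, by
      rw [Prod.smul_snd, Pi.smul_apply, Prod.smul_fst, map_smul, hx.2]⟩
  lie_mem' {x y} hx hy := ⟨fun s m η => by
      change RLieCat.lieHom _ ⁅x.2 s, y.2 s⁆ = ⁅x.2 (s.restrict η), y.2 (s.restrict η)⁆
      rw [LieHom.map_lie, hx.1, hy.1], by
      change ⁅x.2 ⟨n.unop, 𝟙 _, constMap _ 0⟩, y.2 ⟨n.unop, 𝟙 _, constMap _ 0⟩⁆ =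
        RLieCat.lieHom _ ⁅x.1, y.1⁆
      rw [LieHom.map_lie, hx.2, hy.2]⟩
  pOp_mem x hx := ⟨fun s m η => by
      change RLieCat.lieHom _ (pOp p k (x.2 s)) = pOp p k (x.2 (s.restrict η))
      rw [RLieCat.lieHom_pOp, hx.1], by
      change pOp p k (x.2 ⟨n.unop, 𝟙 _, constMap _ 0⟩) = RLieCat.lieHom _ (pOp p k x.1)
      rw [RLieCat.lieHom_pOp, hx.2]⟩

theorem mappingPathSub_map {m n : SimplexCategoryᵒᵖ} (θ : m ⟶ n)
    {x : E.obj m × ∀ s : PathIndex m.unop, X.obj (op s.1)}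
    (hx : x ∈ (mappingPathSub φ m).toLieSubalgebra) :
    ((RLieCat.lieHom (E.map θ) x.1, fun s => x.2 (s.push θ.unop)) :
      E.obj n × ∀ s : PathIndex n.unop, X.obj (op s.1)) ∈
      (mappingPathSub φ n).toLieSubalgebra := by
  refine ⟨fun s m' η => ?_, ?_⟩
  · exact (hx.1 (s.push θ.unop) η).trans (PathIndex.congr x.2 (Category.assoc _ _ _).symm rfl)
  · change x.2 ⟨n.unop, 𝟙 _ ≫ θ.unop, constMap _ 0⟩ =
      RLieCat.lieHom (φ.app n) (RLieCat.lieHom (E.map θ) x.1)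
    have h1 := RLieCat.lieHom_congr (φ.naturality θ) x.1
    rw [RLieCat.lieHom_comp, RLieCat.lieHom_comp] at h1
    rw [h1, ← hx.2]
    exact (PathIndex.congr x.2 ((Category.id_comp θ.unop).trans
      (Category.comp_id θ.unop).symm) rfl).trans (hx.1 ⟨m.unop, 𝟙 _, constMap _ 0⟩ θ.unop).symm

/-- The mapping path space `E ×_X X^{Δ[1]}`. -/
def mappingPath : SRLieCat p k where
  obj n := { carrier := (mappingPathSub φ n).toLieSubalgebra }
  map {m n} θ :=
    { toFun := fun x => ⟨(RLieCat.lieHom (E.map θ) x.1.1, fun s => x.1.2 (s.push θ.unop)),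
        mappingPathSub_map φ θ x.2⟩
      map_add' := fun x y => Subtype.ext (Prod.ext (map_add _ _ _) rfl)
      map_smul' := fun a x => Subtype.ext (Prod.ext (map_smul _ _ _) rfl)
      map_lie' := Subtype.ext (Prod.ext (LieHom.map_lie _ _ _) rfl)
      map_pOp := fun x => Subtype.ext (Prod.ext (RLieCat.lieHom_pOp _ _) rfl) }
  map_id n := RLieCat.hom_ext fun x => Subtype.ext (Prod.ext
    (RLieCat.lieHom_congr (E.map_id n) x.1.1) (funext fun s =>
      PathIndex.congr x.1.2 (Category.comp_id s.2.1) rfl))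
  map_comp {l m n} θ η := RLieCat.hom_ext fun x => Subtype.ext (Prod.ext
    (RLieCat.lieHom_congr (E.map_comp θ η) x.1.1) (funext fun s =>
      PathIndex.congr x.1.2 (Category.assoc s.2.1 η.unop θ.unop).symm rfl))

namespace mappingPath

/-- The projection to `E`, a deformation retraction. -/
def fst : mappingPath φ ⟶ E where
  app n :=
    { toFun := fun x => x.1.1
      map_add' := fun _ _ => rfl
      map_smul' := fun _ _ => rfl
      map_lie' := rfl
      map_pOp := fun _ => rfl }
  naturality _ _ _ := rfl

/-- The value of a path at a simplex of `Δ[n] × Δ[1]` with first component the identity. -/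
def value (n : SimplexCategory) (χ : n ⟶ ⦋1⦌) : (mappingPath φ).obj (op n) ⟶ X.obj (op n) :=
  { toFun := fun x => x.1.2 ⟨n, 𝟙 _, χ⟩
    map_add' := fun _ _ => rfl
    map_smul' := fun _ _ => rfl
    map_lie' := rfl
    map_pOp := fun _ => rfl }

theorem map_value {m n : SimplexCategory} (θ : m ⟶ n) (χ : n ⟶ ⦋1⦌) :
    (mappingPath φ).map θ.op ≫ value φ m (θ ≫ χ) = value φ n χ ≫ X.map θ.op :=
  RLieCat.hom_ext fun x => by
    exact (PathIndex.congr x.1.2 ((Category.id_comp θ).trans (Category.comp_id θ).symm) rfl).trans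
      (x.2.1 ⟨n, 𝟙 _, χ⟩ θ).symm

/-- The end point of a path. -/
def endpoint : mappingPath φ ⟶ X where
  app n := value φ n.unop (constMap _ 1)
  naturality _ _ θ := map_value φ θ.unop (constMap _ 1)

/-- The tautological homotopy between the two ends of a path. -/
def homotopy : SimplicialHomotopy (fst φ ≫ φ) (endpoint φ) where
  app := value φ
  naturality := map_value φ
  app_zero n := RLieCat.hom_ext fun x => x.2.2
  app_one _ := rfl

/-- The constant paths. -/
def constPath : E ⟶ mappingPath φ where
  app n :=
    { toFun := fun e => ⟨(e, fun s => RLieCat.lieHom (X.map s.2.1.op) (RLieCat.lieHom (φ.app n) e)),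
        fun s m η => by
          dsimp only
          rw [← RLieCat.lieHom_comp, ← X.map_comp]
          rfl,
        RLieCat.lieHom_congr (X.map_id n) _⟩
      map_add' := fun x y => Subtype.ext (Prod.ext rfl (funext fun s => by
        dsimp only
        rw [map_add, map_add]; rfl))
      map_smul' := fun a x => Subtype.ext (Prod.ext rfl (funext fun s => by
        dsimp only
        rw [map_smul, map_smul]; rfl))
      map_lie' := fun {x y} => Subtype.ext (Prod.ext rfl (funext fun s => by
        dsimp only
        rw [LieHom.map_lie, LieHom.map_lie]; rfl))
      map_pOp := fun x => Subtype.ext (Prod.ext rfl (funext fun s => by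
        dsimp only
        rw [RLieCat.lieHom_pOp, RLieCat.lieHom_pOp]; rfl)) }
  naturality m n θ := RLieCat.hom_ext fun e => Subtype.ext (Prod.ext rfl (funext fun s => by
    change RLieCat.lieHom (X.map s.2.1.op) (RLieCat.lieHom (φ.app n) (RLieCat.lieHom (E.map θ) e)) =
      RLieCat.lieHom (X.map (s.2.1 ≫ θ.unop).op) (RLieCat.lieHom (φ.app m) e)
    rw [← RLieCat.lieHom_comp (E.map θ), φ.naturality, op_comp, X.map_comp]
    rfl))

theorem constPath_fst : constPath φ ≫ fst φ = 𝟙 E := rfl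

theorem constPath_endpoint : constPath φ ≫ endpoint φ = φ := by
  apply NatTrans.ext
  funext n
  exact RLieCat.hom_ext fun e => RLieCat.lieHom_congr (X.map_id n) _

/-- The pointwise minimum of two maps to `[1]`. -/
def minMap {m : SimplexCategory} (χ χ' : m ⟶ ⦋1⦌) : m ⟶ ⦋1⦌ :=
  SimplexCategory.Hom.mk (χ.toOrderHom ⊓ χ'.toOrderHom)

/-- The mapping path space contracts to the constant paths. -/
def contraction : SimplicialHomotopy (fst φ ≫ constPath φ) (𝟙 (mappingPath φ)) where
  app n χ :=
    { toFun := fun x => ⟨(x.1.1, fun s => x.1.2 ⟨s.1, s.2.1, minMap s.2.2 (s.2.1 ≫ χ)⟩),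
        fun s m η => (x.2.1 ⟨s.1, s.2.1, minMap s.2.2 (s.2.1 ≫ χ)⟩ η).trans rfl,
        Eq.trans (PathIndex.congr x.1.2 rfl (by
          ext r : 3
          exact inf_eq_left.2 (Fin.zero_le _))) x.2.2⟩
      map_add' := fun _ _ => rfl
      map_smul' := fun _ _ => rfl
      map_lie' := rfl
      map_pOp := fun _ => rfl }
  naturality θ χ := RLieCat.hom_ext fun x => Subtype.ext (Prod.ext rfl (funext fun s => by
    exact PathIndex.congr x.1.2 rfl (congrArg (minMap s.2.2) (Category.assoc s.2.1 θ χ).symm)))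
  app_zero n := RLieCat.hom_ext fun x => Subtype.ext (Prod.ext rfl (funext fun s => by
    change x.1.2 ⟨s.1, s.2.1, minMap s.2.2 (s.2.1 ≫ constMap n 0)⟩ =
      RLieCat.lieHom (X.map s.2.1.op) (RLieCat.lieHom (φ.app (op n)) x.1.1)
    rw [← x.2.2]
    refine Eq.trans (PathIndex.congr x.1.2 (θ' := s.2.1 ≫ 𝟙 n) (χ' := s.2.1 ≫ constMap n 0)
      (Category.comp_id s.2.1).symm ?_) (x.2.1 ⟨n, 𝟙 _, constMap n 0⟩ s.2.1).symm
    ext r : 3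
    exact inf_eq_right.2 (Fin.zero_le _)))
  app_one n := RLieCat.hom_ext fun x => Subtype.ext (Prod.ext rfl (funext fun s => by
    refine PathIndex.congr x.1.2 rfl ?_
    ext r : 3
    exact inf_eq_left.2 (Fin.le_last _)))

end mappingPath

end mappingPath

/-! ### The end point fibration and homotopy sections -/

section mappingPathFibration

variable {p : ℕ} {k : Type u} [Field k]

/-- The map of underlying simplicial vector spaces. -/
def oblvHom {X Y : SRLieCat p k} (f : X ⟶ Y) :
    SimplicialAddHom ((oblvFunctor p k).obj X) ((oblvFunctor p k).obj Y) :=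
  SimplicialAddHom.ofHom ((oblvFunctor p k).map f)

theorem homotopyMap_comp {X Y Z : SRLieCat p k} (f : X ⟶ Y) (g : Y ⟶ Z) (n : ℕ)
    (x : homotopyGroup X n) : homotopyMap (f ≫ g) n x = homotopyMap g n (homotopyMap f n x) := by
  rw [homotopyMap, Functor.map_comp, PiGroup.map_comp]

theorem homotopyMap_id (X : SRLieCat p k) (n : ℕ) (x : homotopyGroup X n) :
    homotopyMap (𝟙 X) n x = x := by
  rw [homotopyMap, CategoryTheory.Functor.map_id, PiGroup.map_id]

theorem SimplicialHomotopy.homotopyMap_eq {X Y : SRLieCat p k} {f g : X ⟶ Y}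
    (H : SimplicialHomotopy f g) (n : ℕ) : homotopyMap f n = homotopyMap g n :=
  LinearMap.ext fun x => (H.whisker (RLieCat.oblv p k)).map_eq n x

theorem IsWeakEquiv.comp {X Y Z : SRLieCat p k} {f : X ⟶ Y} {g : Y ⟶ Z} (hf : IsWeakEquiv f)
    (hg : IsWeakEquiv g) : IsWeakEquiv (f ≫ g) := fun n => by
  have := (hg n).comp (hf n)
  convert this using 1
  exact funext fun x => homotopyMap_comp f g n x

theorem IsWeakEquiv.of_comp_left {X Y Z : SRLieCat p k} {f : X ⟶ Y} {g : Y ⟶ Z}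
    (hf : IsWeakEquiv f) (hfg : IsWeakEquiv (f ≫ g)) : IsWeakEquiv g := fun n => by
  have h := hfg n
  rw [show ⇑(homotopyMap (f ≫ g) n) = homotopyMap g n ∘ homotopyMap f n from
    funext fun x => homotopyMap_comp f g n x] at h
  exact (Function.Bijective.of_comp_iff _ (hf n)).1 h

theorem IsWeakEquiv.of_comp_right {X Y Z : SRLieCat p k} {f : X ⟶ Y} {g : Y ⟶ Z}
    (hg : IsWeakEquiv g) (hfg : IsWeakEquiv (f ≫ g)) : IsWeakEquiv f := fun n => by
  have h := hfg n
  rw [show ⇑(homotopyMap (f ≫ g) n) = homotopyMap g n ∘ homotopyMap f n from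
    funext fun x => homotopyMap_comp f g n x] at h
  exact (Function.Bijective.of_comp_iff' (hg n) _).1 h

/-- The map `Δ[n] × Δ[1] → Δ[0] ⋆ Δ[n]` that collapses `Δ[n] × {0}` to the cone point. -/
def cone {n : SimplexCategory} (s : PathIndex n) : s.1 ⟶ shift.obj n :=
  SimplexCategory.Hom.mk
    { toFun := fun r => if s.2.2.toOrderHom r = (0 : Fin 2) then (0 : Fin (n.len + 2))
        else (s.2.1.toOrderHom r).succ
      monotone' := by
        intro r t h
        have h1 := s.2.1.toOrderHom.monotone h
        have h2 := s.2.2.toOrderHom.monotone h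
        dsimp only
        by_cases h3 : s.2.2.toOrderHom r = (0 : Fin 2)
        · exact (if_pos h3).trans_le (Fin.zero_le (n := n.len + 2) _)
        · have h4 : s.2.2.toOrderHom t ≠ (0 : Fin 2) := fun h4 =>
            h3 (Fin.le_zero_iff.1 (h4 ▸ h2))
          exact (if_neg h3).trans_le ((Fin.succ_le_succ_iff.2 h1).trans_eq (if_neg h4).symm) }

theorem cone_zero (n : SimplexCategory) : cone ⟨n, 𝟙 n, constMap n 0⟩ =
    SimplexCategory.const n ⦋0⦌ 0 ≫ shiftVertex n := rfl

namespace mappingPath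

variable {E X : SRLieCat p k} (φ : E ⟶ X)

/-- The path in `X` from the base point to `d₀ γ` determined by a simplex `γ` whose `0`-th vertex
is the base point. -/
def conePath {n : SimplexCategory} (γ : X.obj (op (shift.obj n)))
    (h : RLieCat.lieHom (X.map (shiftVertex n).op) γ = 0) : (mappingPath φ).obj (op n) :=
  ⟨(0, fun s => RLieCat.lieHom (X.map (cone s).op) γ), fun s m η => by
      dsimp only
      rw [← RLieCat.lieHom_comp, ← X.map_comp]
      rfl, by
      refine Eq.trans ?_ (map_zero _).symm
      dsimp only
      rw [cone_zero, op_comp, X.map_comp, RLieCat.lieHom_comp, h, map_zero]⟩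

theorem endpoint_conePath {n : ℕ} (γ : X _⦋n + 1⦌)
    (h : RLieCat.lieHom (X.map (shiftVertex ⦋n⦌).op) γ = 0) :
    RLieCat.lieHom ((endpoint φ).app (op ⦋n⦌)) (conePath φ (n := ⦋n⦌) γ h) =
      RLieCat.lieHom (X.δ 0) γ := rfl

theorem endpoint_constPath {n : SimplexCategoryᵒᵖ} (e : E.obj n) :
    RLieCat.lieHom ((endpoint φ).app n) (RLieCat.lieHom ((constPath φ).app n) e) =
      RLieCat.lieHom (φ.app n) e :=
  RLieCat.lieHom_congr (congrArg (fun f => NatTrans.app f n) (constPath_endpoint φ)) e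

variable [Fact p.Prime]

theorem isWeakEquiv_constPath : IsWeakEquiv (constPath φ) := fun n => by
  refine Function.bijective_iff_has_inverse.2 ⟨homotopyMap (fst φ) n, fun x => ?_, fun x => ?_⟩
  · rw [← homotopyMap_comp, constPath_fst, homotopyMap_id]
  · rw [← homotopyMap_comp, (contraction φ).homotopyMap_eq, homotopyMap_id]

/-- If every component of `X` is hit by `φ`, the end point map is degreewise surjective: a
normalized simplex `z` of positive dimension is the end point of the path determined by `s₀ z`. -/
theorem endpoint_surjective (hφ : Function.Surjective (homotopyMap φ 0)) (n : ℕ) :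
    Function.Surjective (RLieCat.lieHom ((endpoint φ).app (op ⦋n⦌))) := by
  intro x
  have := mem_of_normalized (Y := (oblvFunctor p k).obj X)
    (fun m => ((oblvHom (endpoint φ)).app m).range) ?_ ?_ n x
  · exact this
  · rintro m j _ ⟨y, rfl⟩
    exact ⟨_, ((oblvHom (endpoint φ)).degen m j y).symm⟩
  · intro m z hz
    cases m with
    | zero =>
      obtain ⟨e, he⟩ := hφ (piMk X 0 z trivial)
      obtain ⟨e, he', rfl⟩ := piMk_surj e
      rw [homotopyMap_piMk] at he
      obtain ⟨w, hw, hw0⟩ := piMk_eq.1 he.symm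
      refine ⟨conePath φ (n := ⦋0⦌) w (vertex_eq_zero w 0 (hw 0)) +
        RLieCat.lieHom ((constPath φ).app (op ⦋0⦌)) e, ?_⟩
      refine (map_add (RLieCat.lieHom ((endpoint φ).app (op ⦋0⦌))) _ _).trans ?_
      exact (congrArg₂ (· + ·) ((endpoint_conePath φ w _).trans hw0)
        (endpoint_constPath φ e)).trans (sub_add_cancel _ _)
    | succ m =>
      have h : RLieCat.lieHom (X.δ (Fin.succ 1)) (RLieCat.lieHom (X.σ 0) z) = 0 :=
        (face_degen (X := X) 0 z).trans ((congrArg _ (hz 0)).trans (map_zero _))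
      have hv := vertex_eq_zero (L := X) (n := m + 1) _ 1 h
      exact ⟨conePath φ (n := ⦋m + 1⦌) (RLieCat.lieHom (X.σ 0) z) hv,
        (endpoint_conePath φ _ hv).trans (face0_degen (X := X) z)⟩

theorem acyclicFibrations_endpoint (hφ : IsWeakEquiv φ) : acyclicFibrations p k (endpoint φ) :=
  ⟨(isWeakEquiv_constPath φ).of_comp_left (by rwa [constPath_endpoint]),
    endpoint_surjective φ (hφ 0).2⟩

end mappingPath

variable [Fact p.Prime]

/-- A weak equivalence `φ` under `A` with target cofibrant relative to `A` has a section up to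
homotopy relative to `A`: lift the identity of the target to the mapping path space of `φ`. -/
theorem exists_homotopy_section {A E X : SRLieCat p k} {a : A ⟶ E} {φ : E ⟶ X} {i : A ⟶ X}
    (e : a ≫ φ = i) (hi : cofibrations p k i) (hφ : IsWeakEquiv φ) :
    ∃ (ψ : X ⟶ E) (H : SimplicialHomotopy (ψ ≫ φ) (𝟙 X)), i ≫ ψ = a ∧
      ∀ n χ, i.app (op n) ≫ H.app n χ = i.app (op n) := by
  have sq : CommSq (a ≫ mappingPath.constPath φ) i (mappingPath.endpoint φ) (𝟙 X) :=
    ⟨by rw [Category.assoc, mappingPath.constPath_endpoint, e, Category.comp_id]⟩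
  have := (hi _ (mappingPath.acyclicFibrations_endpoint φ hφ)).sq_hasLift sq
  have h1 := sq.fac_left
  have h2 := sq.fac_right
  set g := sq.lift
  refine ⟨g ≫ mappingPath.fst φ,
    { app := fun n χ => g.app (op n) ≫ mappingPath.value φ n χ
      naturality := fun {m n} θ χ => by
        rw [← Category.assoc, g.naturality, Category.assoc, Category.assoc, mappingPath.map_value]
      app_zero := fun n => congrArg (g.app (op n) ≫ ·) ((mappingPath.homotopy φ).app_zero n)
      app_one := fun n => congrArg (fun f => NatTrans.app f (op n)) h2 }, ?_, ?_⟩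
  · rw [← Category.assoc, h1, Category.assoc, mappingPath.constPath_fst, Category.comp_id]
  · intro n χ
    refine RLieCat.hom_ext fun x => ?_
    change RLieCat.lieHom (mappingPath.value φ n χ) (RLieCat.lieHom ((i ≫ g).app (op n)) x) = _
    rw [h1, ← e]
    exact RLieCat.lieHom_congr (X.map_id (op n)) _

end mappingPathFibration

/-! ### Cofibrations are degreewise split -/

section split

variable {p : ℕ} {k : Type u} [Field k]

/-- The simplicial restricted Lie algebra `[m] ↦ M ^ Hom([n], [m])`, the right adjoint of the
evaluation in degree `n`. -/
def coind (n : SimplexCategory) (M : RLieCat p k) : SRLieCat p k where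
  obj m := piRLie fun _ : n ⟶ m.unop => M
  map θ :=
    { toFun := fun f α => f (α ≫ θ.unop)
      map_add' := fun _ _ => rfl
      map_smul' := fun _ _ => rfl
      map_lie' := rfl
      map_pOp := fun _ => rfl }
  map_id m := RLieCat.hom_ext fun f => funext fun α =>
    congrArg f (Category.comp_id α)
  map_comp θ η := RLieCat.hom_ext fun f => funext fun α =>
    congrArg f (Category.assoc α η.unop θ.unop).symm

/-- The map to the zero object. -/
def toZero (L : SRLieCat p k) : L ⟶ zeroSRLie p k where
  app _ := { toLieHom := 0, map_pOp := fun _ => rfl }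
  naturality _ _ _ := rfl

variable [Fact p.Prime]

theorem acyclicFibrations_toZero {L : SRLieCat p k}
    (h : ∀ (n : ℕ), ∀ z ∈ (cyclesLie L n).toLieSubalgebra, IsBoundary L n z) :
    acyclicFibrations p k (toZero L) := by
  refine ⟨fun n => ⟨?_, ?_⟩, fun n y => ⟨0, rfl⟩⟩
  · refine (injective_iff_map_eq_zero _).2 fun x _ => ?_
    obtain ⟨z, hz, rfl⟩ := piMk_surj x
    exact piMk_eq_zero.2 (h n z hz)
  · intro x
    obtain ⟨z, hz, rfl⟩ := piMk_surj x
    exact ⟨0, rfl⟩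

/-- `[m] ↦ M ^ Hom([n], [m])` is contractible: extending a function on `Hom([n], [m])` by zero from
the maps `[n] → [m + 1]` that avoid the vertex `0` is an extra degeneracy. -/
theorem coind_isBoundary (n : SimplexCategory) (M : RLieCat p k) (m : ℕ)
    (z : (coind n M) _⦋m⦌) (hz : z ∈ (cyclesLie (coind n M) m).toLieSubalgebra) :
    IsBoundary (coind n M) m z := by
  classical
  let z' : (n ⟶ ⦋m⦌) → M := z
  let w : (n ⟶ ⦋m + 1⦌) → M := fun α =>
    if h : ∃ β : n ⟶ ⦋m⦌, β ≫ SimplexCategory.δ 0 = α then z' h.choose else 0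
  have hw : ∀ β : n ⟶ ⦋m⦌, w (β ≫ SimplexCategory.δ 0) = z' β := fun β => by
    have h : ∃ β' : n ⟶ ⦋m⦌, β' ≫ SimplexCategory.δ 0 = β ≫ SimplexCategory.δ 0 := ⟨β, rfl⟩
    exact (dif_pos h).trans (congrArg z' ((cancel_mono _).1 h.choose_spec))
  refine ⟨w, fun i => funext fun (β : n ⟶ ⦋m⦌) => ?_, funext fun (β : n ⟶ ⦋m⦌) => hw β⟩
  change w (β ≫ SimplexCategory.δ i.succ) = 0
  by_cases h : ∀ r, β.toOrderHom r ≠ 0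
  · cases m with
    | zero => exact absurd (Fin.fin_one_eq_zero _) (h 0)
    | succ m =>
      obtain ⟨β, rfl⟩ := SimplexCategory.eq_comp_δ_of_not_surjective' β 0 h
      have e : SimplexCategory.δ (n := m) 0 ≫ SimplexCategory.δ i.succ =
          SimplexCategory.δ i ≫ SimplexCategory.δ 0 :=
        SimplexCategory.δ_comp_δ (Fin.zero_le i)
      rw [Category.assoc, e, ← Category.assoc, hw]
      exact congrFun (mem_cyclesLie_succ.1 hz i) β
  · push Not at h
    obtain ⟨r, hr⟩ := h
    refine dif_neg ?_
    rintro ⟨β', hβ'⟩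
    have h1 : (0 : Fin (m + 2)).succAbove (β'.toOrderHom r) =
        i.succ.succAbove (β.toOrderHom r) :=
      congrArg (fun f : n ⟶ ⦋m + 1⦌ => f.toOrderHom r) hβ'
    rw [hr] at h1
    exact Fin.succAbove_ne _ _ (h1.trans (Fin.succ_succAbove_zero i))

/-- A cofibration is a split monomorphism in each degree. -/
theorem exists_retraction {A Z : SRLieCat p k} {i : A ⟶ Z} (hi : cofibrations p k i)
    (n : SimplexCategory) : ∃ r : Z.obj (op n) ⟶ A.obj (op n), i.app (op n) ≫ r = 𝟙 _ := by
  let f : A ⟶ coind n (A.obj (op n)) :=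
    { app := fun m =>
        { toFun := fun a α => RLieCat.lieHom (A.map (Quiver.Hom.op α)) a
          map_add' := fun _ _ => funext fun _ => map_add _ _ _
          map_smul' := fun _ _ => funext fun _ => map_smul _ _ _
          map_lie' := funext fun _ => LieHom.map_lie _ _ _
          map_pOp := fun _ => funext fun _ => RLieCat.lieHom_pOp _ _ }
      naturality := fun _ _ θ => RLieCat.hom_ext fun a => funext fun α =>
        (RLieCat.lieHom_congr (A.map_comp θ (Quiver.Hom.op α)) a).symm }
  have sq : CommSq f i (toZero _) (toZero _) := ⟨rfl⟩
  have := (hi _ (acyclicFibrations_toZero (coind_isBoundary n (A.obj (op n))))).sq_hasLift sq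
  have h := sq.fac_left
  refine ⟨{ toFun := fun z => RLieCat.lieHom (sq.lift.app (op n)) z (𝟙 n)
            map_add' := fun x y => congrFun (map_add (RLieCat.lieHom (sq.lift.app (op n))) x y) _
            map_smul' := fun c x => congrFun (map_smul (RLieCat.lieHom (sq.lift.app (op n))) c x) _
            map_lie' := fun {x y} =>
              congrFun (LieHom.map_lie (RLieCat.lieHom (sq.lift.app (op n))) x y) _
            map_pOp := fun x => congrFun (RLieCat.lieHom_pOp (sq.lift.app (op n)) x) _ }, ?_⟩
  refine RLieCat.hom_ext fun a => ?_
  exact (congrFun (RLieCat.lieHom_congr (congrArg (fun f => NatTrans.app f (op n)) h) a)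
    (𝟙 n)).trans
    (RLieCat.lieHom_congr (A.map_id (op n)) a)

theorem cofibration_injective {A Z : SRLieCat p k} {i : A ⟶ Z} (hi : cofibrations p k i)
    (n : SimplexCategory) : Function.Injective (RLieCat.lieHom (i.app (op n))) := by
  obtain ⟨r, hr⟩ := exists_retraction hi n
  exact Function.LeftInverse.injective (g := RLieCat.lieHom r) fun x => RLieCat.lieHom_congr hr x

end split

/-! ### Factorizations -/

section lifting

variable {p : ℕ} {k : Type u} [Field k]

theorem oblvHom_isSurjective {X Y : SRLieCat p k} {f : X ⟶ Y}
    (hf : ∀ n : ℕ, Function.Surjective (RLieCat.lieHom (f.app (op ⦋n⦌)))) :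
    (oblvHom f).IsSurjective := hf

variable [Fact p.Prime]

theorem isWeakEquiv_of_kerAcyclic {X Y : SRLieCat p k} {f : X ⟶ Y}
    (hf : ∀ n : ℕ, Function.Surjective (RLieCat.lieHom (f.app (op ⦋n⦌))))
    (h : ∀ n, (oblvHom f).KerAcyclic n) : IsWeakEquiv f := fun n => by
  have hs := oblvHom_isSurjective hf
  constructor
  · exact (mapSemi_injective_iff _ n).2 fun y hy hb => (h n).mem_boundaries hs hy hb
  · refine (mapSemi_surjective_iff _ n).2 fun z hz => ?_
    suffices H : ∃ y ∈ cycles ((oblvFunctor p k).obj X) n, (oblvHom f).app n y = z by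
      obtain ⟨y, hy, rfl⟩ := H
      exact ⟨y, hy, by rw [show ∀ a b : ((oblvFunctor p k).obj Y) _⦋n⦌, a = b → a - b = 0 from
        fun a b => sub_eq_zero.2]; exacts [zero_mem _, rfl]⟩
    cases n with
    | zero =>
      obtain ⟨y, hy⟩ := hf 0 z
      exact ⟨y, trivial, hy⟩
    | succ n => exact (h n).exists_cycle hs hz

theorem kerAcyclic_of_acyclicFibrations {X Y : SRLieCat p k} {f : X ⟶ Y}
    (h : acyclicFibrations p k f) (n : ℕ) : (oblvHom f).KerAcyclic n :=
  SimplicialAddHom.kerAcyclic_of (oblvHom_isSurjective h.2)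
    ((mapSemi_injective_iff _ n).1 (h.1 n).1) ((mapSemi_surjective_iff _ (n + 1)).1 (h.1 (n + 1)).2)

end lifting

section factorization

variable {p : ℕ} {k : Type u} [Field k]

/-- The product of two simplicial restricted Lie algebras. -/
def prodSRLie (X Y : SRLieCat p k) : SRLieCat p k where
  obj n := { carrier := X.obj n × Y.obj n }
  map θ :=
    { toFun := fun x => (RLieCat.lieHom (X.map θ) x.1, RLieCat.lieHom (Y.map θ) x.2)
      map_add' := fun _ _ => Prod.ext (map_add _ _ _) (map_add _ _ _)
      map_smul' := fun _ _ => Prod.ext (map_smul _ _ _) (map_smul _ _ _)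
      map_lie' := Prod.ext (LieHom.map_lie _ _ _) (LieHom.map_lie _ _ _)
      map_pOp := fun _ => Prod.ext (RLieCat.lieHom_pOp _ _) (RLieCat.lieHom_pOp _ _) }
  map_id n := RLieCat.hom_ext fun x => Prod.ext (RLieCat.lieHom_congr (X.map_id n) x.1)
    (RLieCat.lieHom_congr (Y.map_id n) x.2)
  map_comp θ η := RLieCat.hom_ext fun x => Prod.ext (RLieCat.lieHom_congr (X.map_comp θ η) x.1)
    (RLieCat.lieHom_congr (Y.map_comp θ η) x.2)

/-- The second projection of a product. -/
def prodSnd (X Y : SRLieCat p k) : prodSRLie X Y ⟶ Y where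
  app _ :=
    { toFun := fun x => x.2
      map_add' := fun _ _ => rfl
      map_smul' := fun _ _ => rfl
      map_lie' := rfl
      map_pOp := fun _ => rfl }
  naturality _ _ _ := rfl

/-- Formal expressions in simplices of `A` and formal cells: a cell `cell z l` of dimension `n + 1`
for each expression `z` of dimension `n` and each `(n + 1)`-simplex `l` of `L`. -/
inductive CellTerm (A L : SRLieCat p k) : SimplexCategory → Type u where
  /-- A simplex of `A`. -/
  | of {n : SimplexCategory} (a : A.obj (op n)) : CellTerm A L n
  /-- The zero element. -/
  | zero {n : SimplexCategory} : CellTerm A L n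
  /-- A sum. -/
  | add {n : SimplexCategory} (s t : CellTerm A L n) : CellTerm A L n
  /-- A negative. -/
  | neg {n : SimplexCategory} (t : CellTerm A L n) : CellTerm A L n
  /-- A scalar multiple. -/
  | smul {n : SimplexCategory} (c : k) (t : CellTerm A L n) : CellTerm A L n
  /-- A bracket. -/
  | lie {n : SimplexCategory} (s t : CellTerm A L n) : CellTerm A L n
  /-- The result of the `p`-operation. -/
  | pow {n : SimplexCategory} (t : CellTerm A L n) : CellTerm A L n
  /-- The result of a simplicial operator. -/
  | map {m n : SimplexCategory} (θ : m ⟶ n) (t : CellTerm A L n) : CellTerm A L m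
  /-- A free vertex over a vertex of `L`. -/
  | vertex (l : L _⦋0⦌) : CellTerm A L ⦋0⦌
  /-- A formal cell with boundary `z` over `l`. -/
  | cell {n : ℕ} (z : CellTerm A L ⦋n⦌) (l : L _⦋n + 1⦌) : CellTerm A L ⦋n + 1⦌

namespace CellTerm

variable {A L : SRLieCat p k} {X Y : SRLieCat p k}

/-- The value of an expression in `X`, given a map `A → X` and values of the cells, which may depend
on the value of the expression that the cell is attached to. -/
def eval (α : A ⟶ X) (v : L _⦋0⦌ → X _⦋0⦌)
    (c : ∀ n : ℕ, CellTerm A L ⦋n⦌ → X _⦋n⦌ → L _⦋n + 1⦌ → X _⦋n + 1⦌) :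
    ∀ {n : SimplexCategory}, CellTerm A L n → X.obj (op n) := fun {n} t => match n, t with
  | _, of a => RLieCat.lieHom (α.app (op _)) a
  | _, zero => 0
  | _, add s t => eval α v c s + eval α v c t
  | _, neg t => -eval α v c t
  | _, smul a t => a • eval α v c t
  | _, lie s t => ⁅eval α v c s, eval α v c t⁆
  | _, pow t => pOp p k (eval α v c t)
  | _, map θ t => RLieCat.lieHom (X.map (Quiver.Hom.op θ)) (eval α v c t)
  | _, vertex l => v l
  | _, cell z l => c _ z (eval α v c z) l

variable [Fact p.Prime] (f : A ⟶ L)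

/-- The value of an expression in `L`, the value of `cell z l` being `l`. -/
def evalBase {n : SimplexCategory} (t : CellTerm A L n) : L.obj (op n) :=
  eval f id (fun _ _ _ l => l) t

/-- The condition on `l` for `cell z l` to be attached to `z`. -/
def Admissible {n : ℕ} (z : CellTerm A L ⦋n⦌) (l : L _⦋n + 1⦌) : Prop :=
  (∀ i : Fin (n + 1), RLieCat.lieHom (L.δ i.succ) l = 0) ∧
    RLieCat.lieHom (L.δ 0) l = evalBase f z

/-- A way to evaluate all expressions in `X`: a map `α` from `A`, values `v` of the vertices and
values `c` of the cells, such that `cell z l` has `0`-th face `z` and other faces `0`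
whenever the value of `z` is a cycle and `l` is admissible. -/
structure Model (X : SRLieCat p k) where
  α : A ⟶ X
  v : L _⦋0⦌ → X _⦋0⦌
  c : ∀ n : ℕ, CellTerm A L ⦋n⦌ → X _⦋n⦌ → L _⦋n + 1⦌ → X _⦋n + 1⦌
  face : ∀ (n : ℕ) (z : CellTerm A L ⦋n⦌) (l : L _⦋n + 1⦌),
    eval α v c z ∈ (cyclesLie X n).toLieSubalgebra → Admissible f z l →
      (∀ i : Fin (n + 1), RLieCat.lieHom (X.δ i.succ) (eval α v c (cell z l)) = 0) ∧
        RLieCat.lieHom (X.δ 0) (eval α v c (cell z l)) = eval α v c z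

/-- The values of expressions in a model. -/
abbrev Model.val {f : A ⟶ L} (M : Model f X) {n : SimplexCategory} (t : CellTerm A L n) :
    X.obj (op n) := eval M.α M.v M.c t

/-- Two expressions are equivalent if they have the same value in every model. The models range over
all simplicial restricted Lie algebras, so that the quotient is the universal model. -/
def setoid (n : SimplexCategory) : Setoid (CellTerm A L n) where
  r s t := ∀ (X : SRLieCat p k) (M : Model f X), M.val s = M.val t
  iseqv := ⟨fun _ _ _ => rfl, fun h X M => (h X M).symm, fun h h' X M => (h X M).trans (h' X M)⟩

end CellTerm

variable [Fact p.Prime] {A L : SRLieCat p k} {X : SRLieCat p k} (f : A ⟶ L)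

open CellTerm

/-- The `n`-simplices of the simplicial restricted Lie algebra obtained from `A` by attaching cells
freely. -/
def CellObj (n : SimplexCategory) : Type u := Quotient (CellTerm.setoid f n)

namespace CellObj

variable {f} {n : SimplexCategory}

/-- The class of an expression. -/
def mk (f : A ⟶ L) (t : CellTerm A L n) : CellObj f n := Quotient.mk (CellTerm.setoid f n) t

theorem mk_surjective (x : CellObj f n) : ∃ t, mk f t = x := Quotient.exists_rep x

/-- The value of a simplex in a model. -/
def val (M : Model f X) (x : CellObj f n) : X.obj (op n) :=
  Quotient.lift (s := CellTerm.setoid f n) (fun t => M.val t) (fun _ _ h => h X M) x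

theorem ext_val {x y : CellObj f n} (h : ∀ (X : SRLieCat p k) (M : Model f X), val M x = val M y) :
    x = y := by
  obtain ⟨s, rfl⟩ := mk_surjective x
  obtain ⟨t, rfl⟩ := mk_surjective y
  exact Quotient.sound h

instance : Zero (CellObj f n) := ⟨mk f zero⟩

instance : Add (CellObj f n) := ⟨Quotient.map₂ add fun _ _ h _ _ h' X M =>
  congrArg₂ (· + ·) (h X M) (h' X M)⟩

instance : Neg (CellObj f n) := ⟨Quotient.map neg fun _ _ h X M => congrArg (- ·) (h X M)⟩

instance : SMul k (CellObj f n) := ⟨fun a => Quotient.map (smul a) fun _ _ h X M =>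
  congrArg (a • ·) (h X M)⟩

instance : Bracket (CellObj f n) (CellObj f n) := ⟨Quotient.map₂ lie fun _ _ h _ _ h' X M =>
  congrArg₂ (⁅·, ·⁆) (h X M) (h' X M)⟩

/-- The `p`-operation. -/
def pow : CellObj f n → CellObj f n :=
  Quotient.map CellTerm.pow fun _ _ h X M => congrArg (pOp p k) (h X M)

/-- The action of a simplicial operator. -/
def map {m : SimplexCategory} (θ : m ⟶ n) : CellObj f n → CellObj f m :=
  Quotient.map (CellTerm.map θ) fun _ _ h X M => congrArg (RLieCat.lieHom (X.map θ.op)) (h X M)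

section

variable (M : Model f X)

theorem val_zero : val M (0 : CellObj f n) = 0 := rfl

theorem val_add (x y : CellObj f n) : val M (x + y) = val M x + val M y := by
  obtain ⟨s, rfl⟩ := mk_surjective x
  obtain ⟨t, rfl⟩ := mk_surjective y
  rfl

theorem val_neg (x : CellObj f n) : val M (-x) = -val M x := by
  obtain ⟨s, rfl⟩ := mk_surjective x
  rfl

theorem val_smul (a : k) (x : CellObj f n) : val M (a • x) = a • val M x := by
  obtain ⟨s, rfl⟩ := mk_surjective x
  rfl

theorem val_lie (x y : CellObj f n) : val M ⁅x, y⁆ = ⁅val M x, val M y⁆ := by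
  obtain ⟨s, rfl⟩ := mk_surjective x
  obtain ⟨t, rfl⟩ := mk_surjective y
  rfl

theorem val_pow (x : CellObj f n) : val M (pow x) = pOp p k (val M x) := by
  obtain ⟨s, rfl⟩ := mk_surjective x
  rfl

theorem val_map {m : SimplexCategory} (θ : m ⟶ n) (x : CellObj f n) :
    val M (map θ x) = RLieCat.lieHom (X.map θ.op) (val M x) := by
  obtain ⟨s, rfl⟩ := mk_surjective x
  rfl

end

instance : AddCommGroup (CellObj f n) where
  add_assoc x y z := ext_val fun X M => by simp only [val_add, add_assoc]
  zero_add x := ext_val fun X M => by simp only [val_add, val_zero, zero_add]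
  add_zero x := ext_val fun X M => by simp only [val_add, val_zero, add_zero]
  neg_add_cancel x := ext_val fun X M => by simp only [val_add, val_neg, val_zero, neg_add_cancel]
  add_comm x y := ext_val fun X M => by simp only [val_add, add_comm]
  nsmul := nsmulRec
  zsmul := zsmulRec

instance : Module k (CellObj f n) where
  one_smul x := ext_val fun X M => by simp only [val_smul, one_smul]
  mul_smul a b x := ext_val fun X M => by simp only [val_smul, mul_smul]
  smul_zero a := ext_val fun X M => by simp only [val_smul, val_zero, smul_zero]
  smul_add a x y := ext_val fun X M => by simp only [val_smul, val_add, smul_add]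
  add_smul a b x := ext_val fun X M => by simp only [val_smul, val_add, add_smul]
  zero_smul x := ext_val fun X M => by simp only [val_smul, val_zero, zero_smul]

instance : LieRing (CellObj f n) where
  add_lie x y z := ext_val fun X M => by simp only [val_add, val_lie, add_lie]
  lie_add x y z := ext_val fun X M => by simp only [val_add, val_lie, lie_add]
  lie_self x := ext_val fun X M => by simp only [val_lie, val_zero, lie_self]
  leibniz_lie x y z := ext_val fun X M => by
    simp only [val_lie, val_add]
    exact leibniz_lie _ _ _

instance : LieAlgebra k (CellObj f n) where
  lie_smul a x y := ext_val fun X M => by simp only [val_lie, val_smul, lie_smul]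

/-- The values in a model, as a homomorphism of Lie algebras. -/
def valLie (M : Model f X) : CellObj f n →ₗ⁅k⁆ X.obj (op n) where
  toFun := val M
  map_add' := val_add M
  map_smul' := val_smul M
  map_lie' := val_lie M _ _

instance : RestrictedLieAlgebra p k (CellObj f n) where
  pOp := pow
  pOp_smul a x := ext_val fun X M => by
    simp only [val_pow, val_smul]
    exact RestrictedLieAlgebra.pOp_smul _ _
  lie_pOp x y := ext_val fun X M => by
    rw [val_lie, val_pow, RestrictedLieAlgebra.lie_pOp]
    exact (map_lie_iterate (valLie M) x y p).symm
  pOp_add x y := ext_val fun X M => by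
    rw [val_pow, val_add, pOp, RestrictedLieAlgebra.pOp_add]
    change _ = valLie M _
    simp only [map_add, map_sum, map_smul, map_adCoeff]
    change _ = val M (pow x) + val M (pow y) + _
    rw [val_pow, val_pow]
    rfl

end CellObj

/-- The simplicial restricted Lie algebra obtained from `A` by attaching cells freely. -/
def cellSRLie : SRLieCat p k where
  obj n := { carrier := CellObj f n.unop }
  map θ :=
    { toFun := CellObj.map θ.unop
      map_add' := fun x y => CellObj.ext_val fun X M => by
        simp only [CellObj.val_map, CellObj.val_add, map_add]
      map_smul' := fun a x => CellObj.ext_val fun X M => by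
        simp only [CellObj.val_map, CellObj.val_smul, map_smul, RingHom.id_apply]
      map_lie' := fun {x y} => CellObj.ext_val fun X M => by
        simp only [CellObj.val_map, CellObj.val_lie, LieHom.map_lie]
      map_pOp := fun x => CellObj.ext_val fun X M => by
        change CellObj.val M (CellObj.map _ (CellObj.pow x)) = CellObj.val M (CellObj.pow _)
        rw [CellObj.val_map, CellObj.val_pow, CellObj.val_pow, RLieCat.lieHom_pOp]
        exact congrArg _ (CellObj.val_map M _ _).symm }
  map_id n := RLieCat.hom_ext fun x => CellObj.ext_val fun X M =>
    (CellObj.val_map M _ _).trans (RLieCat.lieHom_congr (X.map_id n) _)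
  map_comp θ η := RLieCat.hom_ext fun x => CellObj.ext_val fun X M =>
    ((CellObj.val_map M _ _).trans (RLieCat.lieHom_congr (X.map_comp θ η) _)).trans
      (((CellObj.val_map M _ _).trans (congrArg _ (CellObj.val_map M _ _))).symm)

variable {f}

/-- The map to a model. -/
def CellTerm.Model.desc (M : Model f X) : cellSRLie f ⟶ X where
  app n := { CellObj.valLie M with map_pOp := CellObj.val_pow M }
  naturality _ _ θ := RLieCat.hom_ext fun x => CellObj.val_map M θ.unop x

theorem cell_face {n : ℕ} {z : CellTerm A L ⦋n⦌} {l : L _⦋n + 1⦌}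
    (hz : (CellObj.mk f z : (cellSRLie f) _⦋n⦌) ∈ (cyclesLie (cellSRLie f) n).toLieSubalgebra)
    (hl : Admissible f z l) :
    (∀ i : Fin (n + 1), RLieCat.lieHom ((cellSRLie f).δ i.succ)
      (CellObj.mk f (cell z l) : (cellSRLie f) _⦋n + 1⦌) = 0) ∧
    RLieCat.lieHom ((cellSRLie f).δ 0) (CellObj.mk f (cell z l) : (cellSRLie f) _⦋n + 1⦌) =
      CellObj.mk f z := by
  have h := fun (X : SRLieCat p k) (M : Model f X) =>
    M.face n z l (map_mem_cyclesLie M.desc hz) hl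
  exact ⟨fun i => CellObj.ext_val fun X M => (h X M).1 i, CellObj.ext_val fun X M => (h X M).2⟩

variable (f)

/-- The inclusion of `A`. -/
def cellIncl : A ⟶ cellSRLie f where
  app n :=
    { toFun := fun a => CellObj.mk f (of a)
      map_add' := fun x y => CellObj.ext_val fun X M => map_add (RLieCat.lieHom (M.α.app n)) x y
      map_smul' := fun a x => CellObj.ext_val fun X M => map_smul (RLieCat.lieHom (M.α.app n)) a x
      map_lie' := fun {x y} => CellObj.ext_val fun X M =>
        LieHom.map_lie (RLieCat.lieHom (M.α.app n)) x y
      map_pOp := fun x => CellObj.ext_val fun X M => RLieCat.lieHom_pOp (M.α.app n) x }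
  naturality _ _ θ := RLieCat.hom_ext fun a => CellObj.ext_val fun X M =>
    RLieCat.lieHom_congr (M.α.naturality θ) a

/-- The model given by `L` itself, in which the value of `cell z l` is `l`. -/
def baseModel : Model f L where
  α := f
  v := id
  c _ _ _ l := l
  face _ _ _ _ h := h

theorem cellIncl_desc : cellIncl f ≫ (baseModel f).desc = f := by
  apply NatTrans.ext
  funext n
  exact RLieCat.hom_ext fun a => rfl

theorem acyclicFibrations_desc : acyclicFibrations p k (baseModel f).desc := by
  have hs : ∀ n : ℕ, Function.Surjective
      (RLieCat.lieHom ((baseModel f).desc.app (op ⦋n⦌))) := by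
    intro n l
    cases n with
    | zero => exact ⟨CellObj.mk f (vertex l), rfl⟩
    | succ n => exact ⟨CellObj.mk f (cell zero l), rfl⟩
  refine ⟨isWeakEquiv_of_kerAcyclic hs fun n x hx hxk => ?_, hs⟩
  obtain ⟨z, rfl⟩ := CellObj.mk_surjective (x : CellObj f ⦋n⦌)
  have hl : Admissible f z (0 : L _⦋n + 1⦌) :=
    ⟨fun i => map_zero _, (map_zero _).trans (Eq.symm hxk)⟩
  exact ⟨CellObj.mk f (cell z 0), rfl, (cell_face hx hl).1, (cell_face hx hl).2⟩

/-- The inclusion of `A` is a cofibration: a lift is defined by recursion on expressions, choosing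
the values of the cells. The values are taken in a product with `cellSRLie f`, so that the condition
on a cell has to be met only if the cell is attached to a cycle of `cellSRLie f`. -/
theorem cofibrations_cellIncl : cofibrations p k (cellIncl f) := by
  intro X Y q hq
  refine ⟨fun {u v} sq => ?_⟩
  let W := prodSRLie (cellSRLie f) X
  let α : A ⟶ W :=
    { app := fun n =>
        { toFun := fun a => (RLieCat.lieHom ((cellIncl f).app n) a, RLieCat.lieHom (u.app n) a)
          map_add' := fun _ _ => Prod.ext (map_add _ _ _) (map_add _ _ _)
          map_smul' := fun _ _ => Prod.ext (map_smul _ _ _) (map_smul _ _ _)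
          map_lie' := Prod.ext (LieHom.map_lie _ _ _) (LieHom.map_lie _ _ _)
          map_pOp := fun _ => Prod.ext (RLieCat.lieHom_pOp _ _) (RLieCat.lieHom_pOp _ _) }
      naturality := fun _ _ θ => RLieCat.hom_ext fun a => Prod.ext
        (RLieCat.lieHom_congr ((cellIncl f).naturality θ) a)
        (RLieCat.lieHom_congr (u.naturality θ) a) }
  let R (n : ℕ) (z : CellTerm A L ⦋n⦌) (w : W _⦋n⦌) (l : L _⦋n + 1⦌) (x : X _⦋n + 1⦌) : Prop :=
    RLieCat.lieHom (q.app (op ⦋n + 1⦌)) x =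
      RLieCat.lieHom (v.app (op ⦋n + 1⦌)) (CellObj.mk f (cell z l)) ∧
    (w ∈ (cyclesLie W n).toLieSubalgebra → Admissible f z l →
      (∀ i : Fin (n + 1), RLieCat.lieHom (X.δ i.succ) x = 0) ∧ RLieCat.lieHom (X.δ 0) x = w.2)
  let c (n : ℕ) (z : CellTerm A L ⦋n⦌) (w : W _⦋n⦌) (l : L _⦋n + 1⦌) : W _⦋n + 1⦌ :=
    (CellObj.mk f (cell z l), Classical.epsilon (R n z w l))
  let c0 (l : L _⦋0⦌) : W _⦋0⦌ := (CellObj.mk f (vertex l),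
    Function.surjInv (hq.2 0) (RLieCat.lieHom (v.app (op ⦋0⦌)) (CellObj.mk f (vertex l))))
  have h1 : ∀ {n : SimplexCategory} (t : CellTerm A L n),
      (eval α c0 c t).1 = (CellObj.mk f t : CellObj f n) := by
    intro n t
    induction t with
    | of a => rfl
    | zero => rfl
    | add s t hs ht => exact congrArg₂ (· + ·) hs ht
    | neg t ht => exact congrArg (- ·) ht
    | smul a t ht => exact congrArg (a • ·) ht
    | lie s t hs ht => exact congrArg₂ (⁅·, ·⁆) hs ht
    | pow t ht => exact congrArg CellObj.pow ht
    | map θ t ht => exact congrArg (CellObj.map θ) ht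
    | vertex l => rfl
    | cell z l hz => rfl
  have hex : ∀ (n : ℕ) (z : CellTerm A L ⦋n⦌) (l : L _⦋n + 1⦌),
      RLieCat.lieHom (q.app (op ⦋n⦌)) (eval α c0 c z).2 =
        RLieCat.lieHom (v.app (op ⦋n⦌)) (CellObj.mk f z) →
      R n z (eval α c0 c z) l (Classical.epsilon (R n z (eval α c0 c z) l)) := by
    intro n z l hz
    refine Classical.epsilon_spec (p := R n z (eval α c0 c z) l) ?_
    by_cases hp : eval α c0 c z ∈ (cyclesLie W n).toLieSubalgebra ∧ Admissible f z l
    · have hc2 : (eval α c0 c z).2 ∈ (cyclesLie X n).toLieSubalgebra :=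
        map_mem_cyclesLie (prodSnd (cellSRLie f) X) hp.1
      have hc1 : (CellObj.mk f z : (cellSRLie f) _⦋n⦌) ∈
          (cyclesLie (cellSRLie f) n).toLieSubalgebra := by
        have hp1 := hp.1
        cases n with
        | zero => trivial
        | succ n =>
          exact mem_cyclesLie_succ.2 fun i => (congrArg (RLieCat.lieHom (SimplicialObject.δ _ i))
            (h1 z).symm).trans (congrArg Prod.fst (mem_cyclesLie_succ.1 hp1 i))
      obtain ⟨hf1, hf2⟩ := cell_face hc1 hp.2
      obtain ⟨x, hx, hx0, hxe⟩ := (kerAcyclic_of_acyclicFibrations hq n).exists_lift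
        (oblvHom_isSurjective hq.2)
        (z := RLieCat.lieHom (v.app (op ⦋n + 1⦌)) (CellObj.mk f (cell z l)))
        (fun i => (map_face v i.succ _).trans ((congrArg _ (hf1 i)).trans (map_zero _))) hc2
        ((map_face v 0 _).trans ((congrArg _ hf2).trans hz.symm))
      exact ⟨x, hxe, fun _ _ => ⟨hx, hx0⟩⟩
    · obtain ⟨x, hx⟩ := hq.2 (n + 1)
        (RLieCat.lieHom (v.app (op ⦋n + 1⦌)) (CellObj.mk f (cell z l)))
      exact ⟨x, hx, fun h h' => absurd ⟨h, h'⟩ hp⟩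
  have h2 : ∀ {n : SimplexCategory} (t : CellTerm A L n),
      RLieCat.lieHom (q.app (op n)) (eval α c0 c t).2 =
        RLieCat.lieHom (v.app (op n)) (CellObj.mk f t) := by
    intro n t
    induction t with
    | of a => exact RLieCat.lieHom_congr (congrArg (fun g => NatTrans.app g _) sq.w) a
    | zero => exact (map_zero _).trans (map_zero (RLieCat.lieHom (v.app _))).symm
    | add s t hs ht =>
      exact (map_add _ _ _).trans ((congrArg₂ (· + ·) hs ht).trans
        (map_add (RLieCat.lieHom (v.app _)) _ _).symm)
    | neg t ht =>
      exact (map_neg _ _).trans ((congrArg (- ·) ht).trans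
        (map_neg (RLieCat.lieHom (v.app _)) _).symm)
    | smul a t ht =>
      exact (map_smul _ _ _).trans ((congrArg (a • ·) ht).trans
        (map_smul (RLieCat.lieHom (v.app _)) _ _).symm)
    | lie s t hs ht =>
      exact (LieHom.map_lie _ _ _).trans ((congrArg₂ (⁅·, ·⁆) hs ht).trans
        (LieHom.map_lie (RLieCat.lieHom (v.app _)) _ _).symm)
    | pow t ht =>
      exact (RLieCat.lieHom_pOp _ _).trans ((congrArg (pOp p k) ht).trans
        (RLieCat.lieHom_pOp (v.app _) _).symm)
    | map θ t ht =>
      exact (RLieCat.lieHom_congr (q.naturality (Quiver.Hom.op θ)) _).trans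
        ((congrArg (RLieCat.lieHom (Y.map (Quiver.Hom.op θ))) ht).trans
          (RLieCat.lieHom_congr (v.naturality (Quiver.Hom.op θ)) _).symm)
    | vertex l => exact Function.surjInv_eq (hq.2 0) _
    | cell z l hz => exact (hex _ z l hz).1
  let M : Model f W :=
    { α := α
      v := c0
      c := c
      face := fun n z l hz hl => by
        have hR := (hex n z l (h2 z)).2 hz hl
        have hc1 : (CellObj.mk f z : (cellSRLie f) _⦋n⦌) ∈
            (cyclesLie (cellSRLie f) n).toLieSubalgebra := by
          cases n with
          | zero => trivial
          | succ n =>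
            exact mem_cyclesLie_succ.2 fun i => (congrArg (RLieCat.lieHom (SimplicialObject.δ _ i))
              (h1 z).symm).trans (congrArg Prod.fst (mem_cyclesLie_succ.1 hz i))
        obtain ⟨hf1, hf2⟩ := cell_face hc1 hl
        exact ⟨fun i => Prod.ext (hf1 i) (hR.1 i), Prod.ext (hf2.trans (h1 z).symm) hR.2⟩ }
  refine ⟨⟨⟨M.desc ≫ prodSnd _ _, ?_, ?_⟩⟩⟩
  · apply NatTrans.ext
    funext n
    exact RLieCat.hom_ext fun a => rfl
  · apply NatTrans.ext
    funext n
    refine RLieCat.hom_ext fun x => ?_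
    obtain ⟨t, rfl⟩ := CellObj.mk_surjective (x : CellObj f n.unop)
    exact h2 t

theorem nonempty_cofibrantFactorization : Nonempty (CofibrantFactorization f) :=
  ⟨{ obj := cellSRLie f
     i := cellIncl f
     q := (baseModel f).desc
     fac := cellIncl_desc f
     cof := cofibrations_cellIncl f
     acyclic := acyclicFibrations_desc f }⟩

end factorization

/-! ### Quotients of simplicial vector spaces by the image of a map -/

section relQuot

variable {p : ℕ} {k : Type u} [Field k] [Fact p.Prime] {A E X : SRLieCat p k} (i : A ⟶ X)

/-- The image of a map of simplicial restricted Lie algebras, as a subspace. -/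
def imageSub (n : SimplexCategoryᵒᵖ) : Submodule k (X.obj n) :=
  LinearMap.range (RLieCat.lieHom (i.app n) : A.obj n →ₗ[k] X.obj n)

theorem app_mem_imageSub {n : SimplexCategoryᵒᵖ} (a : A.obj n) :
    RLieCat.lieHom (i.app n) a ∈ imageSub i n := ⟨a, rfl⟩

theorem map_mem_imageSub {m n : SimplexCategoryᵒᵖ} (θ : m ⟶ n) {x : X.obj m}
    (hx : x ∈ imageSub i m) : RLieCat.lieHom (X.map θ) x ∈ imageSub i n := by
  obtain ⟨a, rfl⟩ := hx
  exact ⟨RLieCat.lieHom (A.map θ) a, RLieCat.lieHom_congr (i.naturality θ) a⟩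

theorem lie_mem_imageSub {n : SimplexCategoryᵒᵖ} {x y : X.obj n} (hx : x ∈ imageSub i n)
    (hy : y ∈ imageSub i n) : ⁅x, y⁆ ∈ imageSub i n := by
  obtain ⟨a, rfl⟩ := hx
  obtain ⟨b, rfl⟩ := hy
  exact ⟨⁅a, b⁆, LieHom.map_lie (RLieCat.lieHom (i.app n)) a b⟩

theorem pOp_mem_imageSub {n : SimplexCategoryᵒᵖ} {x : X.obj n} (hx : x ∈ imageSub i n) :
    pOp p k x ∈ imageSub i n := by
  obtain ⟨a, rfl⟩ := hx
  exact ⟨pOp p k a, RLieCat.lieHom_pOp _ a⟩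

/-- The quotient of the simplicial vector space `X` by the image of `i`. -/
def relQuot : SMod.{u} k where
  obj n := ModuleCat.of k (X.obj n ⧸ imageSub i n)
  map {m n} θ := ModuleCat.ofHom (Submodule.mapQ (imageSub i m) (imageSub i n)
    (RLieCat.lieHom (X.map θ) : X.obj m →ₗ[k] X.obj n) fun _ hx => map_mem_imageSub i θ hx)
  map_id n := by
    ext x
    exact congrArg Submodule.Quotient.mk (RLieCat.lieHom_congr (X.map_id n) x)
  map_comp θ η := by
    ext x
    exact congrArg Submodule.Quotient.mk (RLieCat.lieHom_congr (X.map_comp θ η) x)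

/-- The class of a simplex of `X` modulo the image of `i`. -/
def relMk {n : SimplexCategoryᵒᵖ} (x : X.obj n) : (relQuot i).obj n :=
  Submodule.Quotient.mk (p := imageSub i n) x

theorem relMk_eq_zero {n : SimplexCategoryᵒᵖ} {x : X.obj n} :
    relMk i x = 0 ↔ x ∈ imageSub i n := Submodule.Quotient.mk_eq_zero (imageSub i n)

theorem relMk_eq {n : SimplexCategoryᵒᵖ} {x y : X.obj n} :
    relMk i x = relMk i y ↔ x - y ∈ imageSub i n := Submodule.Quotient.eq (imageSub i n)

theorem relMk_sub {n : SimplexCategoryᵒᵖ} (x y : X.obj n) :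
    relMk i (x - y) = relMk i x - relMk i y := rfl

/-- The projection to the quotient by the image. -/
def relProj : SimplicialAddHom ((oblvFunctor p k).obj X) (relQuot i) where
  app n := (imageSub i (op ⦋n⦌)).mkQ.toAddMonoidHom
  face _ _ _ := rfl
  degen _ _ _ := rfl

theorem relProj_isSurjective : (relProj i).IsSurjective := fun n =>
  (imageSub i (op ⦋n⦌)).mkQ_surjective

theorem mem_relProj_ker {n : ℕ} {x : X _⦋n⦌} :
    x ∈ (relProj i).ker n ↔ x ∈ imageSub i (op ⦋n⦌) := relMk_eq_zero i

/-- The image in `X / i(A)` of a family of subgroups of `X`. -/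
def relFamily (P : ∀ n : ℕ, AddSubgroup (X _⦋n⦌)) (n : ℕ) : AddSubgroup ((relQuot i) _⦋n⦌) :=
  (P n).map ((relProj i).app n)

/-- `z` is, modulo the image of `i`, the face of index `0` of a simplex of `P` whose other faces
lie in the image of `i`. -/
def RelBd (P : ∀ n : ℕ, AddSubgroup (X _⦋n⦌)) (n : ℕ) (z : X _⦋n⦌) : Prop :=
  BdIn (relQuot i) (fun m => relFamily i P m) n (relMk i z)

theorem relBd_iff {P : ∀ n : ℕ, AddSubgroup (X _⦋n⦌)} {n : ℕ} {z : X _⦋n⦌} :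
    RelBd i P n z ↔ ∃ w ∈ P (n + 1),
      (∀ j : Fin (n + 1), RLieCat.lieHom (X.δ j.succ) w ∈ imageSub i (op ⦋n⦌)) ∧
        RLieCat.lieHom (X.δ 0) w - z ∈ imageSub i (op ⦋n⦌) := by
  constructor
  · rintro ⟨_, ⟨w, hw, rfl⟩, hs, h0⟩
    exact ⟨w, hw, fun j => (relMk_eq_zero i).1 (hs j), (relMk_eq i).1 h0⟩
  · rintro ⟨w, hw, hs, h0⟩
    exact ⟨_, ⟨w, hw, rfl⟩, fun j => (relMk_eq_zero i).2 (hs j), (relMk_eq i).2 h0⟩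

variable {i}

theorem RelBd.of_mem {P : ∀ n : ℕ, AddSubgroup (X _⦋n⦌)} {n : ℕ} {z : X _⦋n⦌}
    (hz : z ∈ imageSub i (op ⦋n⦌)) : RelBd i P n z := by
  rw [RelBd, (relMk_eq_zero i).2 hz]
  exact bdIn_zero

theorem RelBd.add {P : ∀ n : ℕ, AddSubgroup (X _⦋n⦌)} {n : ℕ} {y z : X _⦋n⦌}
    (hy : RelBd i P n y) (hz : RelBd i P n z) : RelBd i P n (y + z) := bdIn_add hy hz

theorem RelBd.sub {P : ∀ n : ℕ, AddSubgroup (X _⦋n⦌)} {n : ℕ} {y z : X _⦋n⦌}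
    (hy : RelBd i P n y) (hz : RelBd i P n z) : RelBd i P n (y - z) := bdIn_sub hy hz

/-- A map under `A` takes boundaries modulo the image of `A` to such boundaries. -/
theorem RelBd.map {a : A ⟶ E} {φ : E ⟶ X} (e : a ≫ φ = i) {PE : ∀ n : ℕ, AddSubgroup (E _⦋n⦌)}
    {P : ∀ n : ℕ, AddSubgroup (X _⦋n⦌)}
    (h : ∀ (n : ℕ) (x : E _⦋n⦌), x ∈ PE n → RLieCat.lieHom (φ.app (op ⦋n⦌)) x ∈ P n) {n : ℕ}
    {z : E _⦋n⦌} (hz : RelBd a PE n z) : RelBd i P n (RLieCat.lieHom (φ.app (op ⦋n⦌)) z) := by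
  have him : ∀ (m : ℕ) (x : E _⦋m⦌), x ∈ imageSub a (op ⦋m⦌) →
      RLieCat.lieHom (φ.app (op ⦋m⦌)) x ∈ imageSub i (op ⦋m⦌) := by
    rintro m _ ⟨b, rfl⟩
    exact ⟨b, RLieCat.lieHom_congr (congrArg (fun f => NatTrans.app f _) e.symm) b⟩
  obtain ⟨w, hw, hs, h0⟩ := (relBd_iff a).1 hz
  refine (relBd_iff i).2 ⟨_, h _ w hw, fun j => ?_, ?_⟩
  · rw [map_face]
    exact him _ _ (hs j)
  · rw [map_face, ← map_sub]
    exact him _ _ h0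

variable (i) in
/-- The image of `P` in `X / i(A)` has no homotopy in degree `n`: every simplex of `P` that is a
cycle modulo the image of `i` is the boundary of a simplex of `P` modulo the image of `i`. -/
def RelAcyclic (P : ∀ n : ℕ, AddSubgroup (X _⦋n⦌)) (n : ℕ) : Prop :=
  ∀ z ∈ P n, relMk i z ∈ cycles (relQuot i) n → RelBd i P n z

/-- Acyclicity modulo `A` is invariant under weak equivalences `φ : E → X` under `A` if `X` is
cofibrant relative to `A`, for ideals that are respected by the relevant maps. -/
theorem RelAcyclic.of_isWeakEquiv {a : A ⟶ E} {φ : E ⟶ X} (e : a ≫ φ = i)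
    (hi : cofibrations p k i) (hφ : IsWeakEquiv φ) {PE : ∀ n : ℕ, AddSubgroup (E _⦋n⦌)}
    {P : ∀ n : ℕ, AddSubgroup (X _⦋n⦌)}
    (hδ : ∀ (n : ℕ) (j : Fin (n + 2)) (x : X _⦋n + 1⦌), x ∈ P (n + 1) →
      RLieCat.lieHom (X.δ j) x ∈ P n)
    (hσ : ∀ (n : ℕ) (j : Fin (n + 1)) (x : X _⦋n⦌), x ∈ P n →
      RLieCat.lieHom (X.σ j) x ∈ P (n + 1))
    (hPφ : ∀ (n : ℕ) (x : E _⦋n⦌), x ∈ PE n → RLieCat.lieHom (φ.app (op ⦋n⦌)) x ∈ P n)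
    (hPψ : ∀ ψ : X ⟶ E, i ≫ ψ = a → ∀ (n : ℕ) (x : X _⦋n⦌), x ∈ P n →
      RLieCat.lieHom (ψ.app (op ⦋n⦌)) x ∈ PE n)
    (hPH : ∀ (n : ℕ) (g : X.obj (op ⦋n⦌) ⟶ X.obj (op ⦋n⦌)), i.app (op ⦋n⦌) ≫ g = i.app (op ⦋n⦌) →
      ∀ x ∈ P n, RLieCat.lieHom g x ∈ P n) {n : ℕ} (h : RelAcyclic a PE n) :
    RelAcyclic i P n := by
  -- With `ψ` a section of `φ` up to the homotopy `H`, the difference `z - φ(ψ(z))` is a boundary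
  -- because of `H`, and `φ(ψ(z))` is one because `ψ(z)` is.
  obtain ⟨ψ, H, hψ, hH⟩ := exists_homotopy_section e hi hφ
  intro z hz hc
  have him : ∀ (m : ℕ) (x : X _⦋m⦌), x ∈ imageSub i (op ⦋m⦌) →
      RLieCat.lieHom (ψ.app (op ⦋m⦌)) x ∈ imageSub a (op ⦋m⦌) := by
    rintro m _ ⟨b, rfl⟩
    exact ⟨b, RLieCat.lieHom_congr (congrArg (fun f => NatTrans.app f _) hψ.symm) b⟩
  have hψc : relMk a (RLieCat.lieHom (ψ.app (op ⦋n⦌)) z) ∈ cycles (relQuot a) n := by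
    cases n with
    | zero => trivial
    | succ n =>
      refine mem_cycles_succ.2 fun j => (relMk_eq_zero a).2 ?_
      change RLieCat.lieHom (E.δ j) _ ∈ _
      rw [map_face]
      exact him _ _ ((relMk_eq_zero i).1 (mem_cycles_succ.1 hc j))
  have h1 := (h _ (hPψ ψ hψ n z hz) hψc).map e hPφ
  have hHim : ∀ (m : ℕ) (χ : ⦋m⦌ ⟶ ⦋1⦌), imageSub i (op ⦋m⦌) ≤
      (imageSub i (op ⦋m⦌)).comap (RLieCat.lieHom (H.app ⦋m⦌ χ) : _ →ₗ[k] _) := by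
    rintro m χ _ ⟨b, rfl⟩
    exact ⟨b, RLieCat.lieHom_congr (hH ⦋m⦌ χ).symm b⟩
  have h2 := bdIn_of_homotopy (Y := relQuot i) (Z := relQuot i) (P := relFamily i P)
    (by rintro m j _ ⟨x, hx, rfl⟩; exact ⟨_, hδ m j x hx, rfl⟩)
    (by rintro m j _ ⟨x, hx, rfl⟩; exact ⟨_, hσ m j x hx, rfl⟩)
    (fun m χ => Submodule.mapQ _ _ _ (hHim m χ)) (fun m χ => map_zero _)
    (fun m χ j y => by
      obtain ⟨y, rfl⟩ := Submodule.Quotient.mk_surjective _ y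
      exact congrArg (relMk i) (RLieCat.lieHom_congr (H.naturality (SimplexCategory.δ j) χ) y).symm)
    hc (fun χ j => ⟨_, hPH _ _ (hH _ χ) _ (hσ _ j z hz), rfl⟩)
  have e1 : ∀ (f : X ⟶ X) (ε : Fin 2) (hf : H.app ⦋n⦌ (constMap ⦋n⦌ ε) = f.app (op ⦋n⦌)),
      Submodule.mapQ _ _ _ (hHim n (constMap ⦋n⦌ ε)) (relMk i z) =
        relMk i (RLieCat.lieHom (f.app (op ⦋n⦌)) z) := fun f ε hf =>
    congrArg (relMk i) (RLieCat.lieHom_congr hf z)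
  rw [e1 _ 1 (H.app_one _), e1 _ 0 (H.app_zero _)] at h2
  have h3 := bdIn_add h2 h1
  rw [RLieCat.lieHom_congr (NatTrans.comp_app ψ φ _) z] at h3
  refine (congrArg (BdIn _ _ n) ?_).mp h3
  exact sub_add_cancel _ _

end relQuot

/-! ### Relative Eilenberg subobjects -/

section eilenberg

variable {p : ℕ} {k : Type u} [Field k] [Fact p.Prime] {A X : SRLieCat p k} (i : A ⟶ X) (n : ℕ)

/-- The simplices of `X` whose images under all simplicial operators to dimensions at most `n` lie
in the image of `i`. -/
def eilenbergSub (m : SimplexCategoryᵒᵖ) : RestrictedSubalgebra p k (X.obj m) where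
  carrier := {x | ∀ j ≤ n, ∀ θ : ⦋j⦌ ⟶ m.unop, RLieCat.lieHom (X.map θ.op) x ∈ imageSub i (op ⦋j⦌)}
  add_mem' {x y} hx hy j hj θ := by
    rw [map_add]
    exact add_mem (hx j hj θ) (hy j hj θ)
  zero_mem' j hj θ := by
    rw [map_zero]
    exact zero_mem _
  smul_mem' c x hx j hj θ := by
    rw [map_smul]
    exact Submodule.smul_mem _ c (hx j hj θ)
  lie_mem' {x y} hx hy j hj θ := by
    rw [LieHom.map_lie]
    exact lie_mem_imageSub i (hx j hj θ) (hy j hj θ)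
  pOp_mem x hx j hj θ := by
    rw [RLieCat.lieHom_pOp]
    exact pOp_mem_imageSub i (hx j hj θ)

/-- The relative Eilenberg subobject: the largest simplicial subobject of `X` that agrees with the
image of `i` in degrees at most `n`. -/
def eilenberg : SRLieCat p k where
  obj m := { carrier := (eilenbergSub i n m).toLieSubalgebra }
  map {l m} θ :=
    { toFun := fun x => ⟨RLieCat.lieHom (X.map θ) x.1, fun j hj η => by
        have h := x.2 j hj (η ≫ θ.unop)
        rw [op_comp, X.map_comp] at h
        exact h⟩
      map_add' := fun x y => Subtype.ext (map_add _ _ _)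
      map_smul' := fun c x => Subtype.ext (map_smul _ _ _)
      map_lie' := Subtype.ext (LieHom.map_lie _ _ _)
      map_pOp := fun x => Subtype.ext (RLieCat.lieHom_pOp _ _) }
  map_id m := RLieCat.hom_ext fun x => Subtype.ext (RLieCat.lieHom_congr (X.map_id m) x.1)
  map_comp θ η := RLieCat.hom_ext fun x =>
    Subtype.ext (RLieCat.lieHom_congr (X.map_comp θ η) x.1)

/-- The inclusion of the Eilenberg subobject. -/
def eilenbergIncl : eilenberg i n ⟶ X where
  app m :=
    { toFun := fun x => x.1
      map_add' := fun _ _ => rfl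
      map_smul' := fun _ _ => rfl
      map_lie' := rfl
      map_pOp := fun _ => rfl }
  naturality _ _ _ := rfl

theorem imageSub_le_eilenbergSub {m : SimplexCategoryᵒᵖ} {x : X.obj m} (hx : x ∈ imageSub i m) :
    x ∈ (eilenbergSub i n m).toLieSubalgebra := fun _ _ θ => map_mem_imageSub i θ.op hx

/-- The map from `A` to the Eilenberg subobject. -/
def toEilenberg : A ⟶ eilenberg i n where
  app m :=
    { toFun := fun a => ⟨RLieCat.lieHom (i.app m) a,
        imageSub_le_eilenbergSub i n (app_mem_imageSub i a)⟩
      map_add' := fun _ _ => Subtype.ext (map_add _ _ _)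
      map_smul' := fun _ _ => Subtype.ext (map_smul _ _ _)
      map_lie' := Subtype.ext (LieHom.map_lie _ _ _)
      map_pOp := fun _ => Subtype.ext (RLieCat.lieHom_pOp _ _) }
  naturality _ _ θ := RLieCat.hom_ext fun a =>
    Subtype.ext (RLieCat.lieHom_congr (i.naturality θ) a)

theorem toEilenberg_incl : toEilenberg i n ≫ eilenbergIncl i n = i := rfl

theorem toEilenberg_surjective {j : ℕ} (hj : j ≤ n) :
    Function.Surjective (RLieCat.lieHom ((toEilenberg i n).app (op ⦋j⦌))) := by
  rintro ⟨x, hx⟩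
  obtain ⟨a, ha⟩ := hx j hj (𝟙 _)
  exact ⟨a, Subtype.ext (ha.trans (RLieCat.lieHom_congr (X.map_id _) x))⟩

variable {i n} in
/-- A simplex of dimension greater than `n` lies in the Eilenberg subobject if its faces do. -/
theorem mem_eilenbergSub_of_faces {m : ℕ} (hm : n ≤ m) {x : X _⦋m + 1⦌}
    (h : ∀ j : Fin (m + 2), RLieCat.lieHom (X.δ j) x ∈
      (eilenbergSub i n (op ⦋m⦌)).toLieSubalgebra) :
    x ∈ (eilenbergSub i n (op ⦋m + 1⦌)).toLieSubalgebra := by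
  intro j hj θ
  have hθ : ¬ Function.Surjective θ.toOrderHom := fun hs => by
    have := Fintype.card_le_of_surjective _ hs
    simp at this
    omega
  obtain ⟨l, θ', rfl⟩ := SimplexCategory.eq_comp_δ_of_not_surjective θ hθ
  rw [op_comp, X.map_comp]
  exact h l j hj θ'

/-- If `X / i(A)` has no homotopy in degrees at most `n`, the inclusion of the Eilenberg subobject
is a weak equivalence. -/
theorem isWeakEquiv_eilenbergIncl
    (h : ∀ j ≤ n, ∀ z ∈ cycles (relQuot i) j, z ∈ boundaries (relQuot i) j) :
    IsWeakEquiv (eilenbergIncl i n) := by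
  intro m
  constructor
  · refine (mapSemi_injective_iff _ _).2 ?_
    intro y hy hb
    suffices H : ∃ w : X _⦋m + 1⦌, w ∈ (eilenbergSub i n (op ⦋m + 1⦌)).toLieSubalgebra ∧
        (∀ j : Fin (m + 1), RLieCat.lieHom (X.δ j.succ) w = 0) ∧
        RLieCat.lieHom (X.δ 0) w = (show (eilenberg i n) _⦋m⦌ from y).1 by
      obtain ⟨w, hwE, hw, hw0⟩ := H
      exact mem_boundaries.2 ⟨(⟨w, hwE⟩ : (eilenberg i n) _⦋m + 1⦌), fun j => Subtype.ext (hw j),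
        Subtype.ext hw0⟩
    rcases lt_or_ge m n with hmn | hmn
    · have hyk : (show (eilenberg i n) _⦋m⦌ from y).1 ∈ (relProj i).ker m := by
        obtain ⟨a, ha⟩ := toEilenberg_surjective i n hmn.le y
        exact (mem_relProj_ker i).2 ⟨a, congrArg Subtype.val ha⟩
      obtain ⟨w, hwk, hw, hw0⟩ := SimplicialAddHom.bdIn_ker_of_acyclic (relProj_isSurjective i)
        (h (m + 1) hmn) hyk hb
      exact ⟨w, imageSub_le_eilenbergSub i n ((mem_relProj_ker i).1 hwk), hw, hw0⟩
    · obtain ⟨w, hw, hw0⟩ := mem_boundaries.1 hb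
      refine ⟨w, mem_eilenbergSub_of_faces hmn (Fin.cases ?_ fun j => ?_), hw, hw0⟩
      · have : RLieCat.lieHom (X.δ 0) w = (show (eilenberg i n) _⦋m⦌ from y).1 := hw0
        rw [this]
        exact (show (eilenberg i n) _⦋m⦌ from y).2
      · have : RLieCat.lieHom (X.δ j.succ) w = 0 := hw j
        rw [this]
        exact zero_mem _
  · refine (mapSemi_surjective_iff _ _).2 ?_
    intro z hz
    suffices H : ∃ x : X _⦋m⦌, x ∈ (eilenbergSub i n (op ⦋m⦌)).toLieSubalgebra ∧
        x ∈ cycles ((oblvFunctor p k).obj X) m ∧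
        (show X _⦋m⦌ from z) - x ∈ boundaries ((oblvFunctor p k).obj X) m by
      obtain ⟨x, hxE, hx, hb⟩ := H
      refine ⟨(⟨x, hxE⟩ : (eilenberg i n) _⦋m⦌), ?_, hb⟩
      cases m with
      | zero => trivial
      | succ m => exact mem_cycles_succ.2 fun j => Subtype.ext (mem_cycles_succ.1 hx j)
    rcases le_or_gt m n with hmn | hmn
    · obtain ⟨x, hx, hxk, hb⟩ := SimplicialAddHom.exists_cycle_ker (relProj_isSurjective i)
        (h m hmn) hz
      exact ⟨x, imageSub_le_eilenbergSub i n ((mem_relProj_ker i).1 hxk), hx, hb⟩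
    · obtain ⟨m, rfl⟩ : ∃ m', m = m' + 1 := ⟨m - 1, by omega⟩
      refine ⟨z, mem_eilenbergSub_of_faces (by omega) fun j => ?_, hz, ?_⟩
      · have : RLieCat.lieHom (X.δ j) (show X _⦋m + 1⦌ from z) = 0 := mem_cycles_succ.1 hz j
        rw [this]
        exact zero_mem _
      · rw [sub_self]
        exact zero_mem _

end eilenberg

/-! ### Acyclicity modulo a subobject in the first nontrivial degree -/

section firstDegree

variable {p : ℕ} {k : Type u} [Field k] [Fact p.Prime] {A E : SRLieCat p k} (i : A ⟶ E) (n : ℕ)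

/-- The family of subgroups underlying a family of restricted ideals. -/
abbrev idealFamily (I : ∀ m : ℕ, RestrictedIdeal p k (E _⦋m⦌)) (m : ℕ) : AddSubgroup (E _⦋m⦌) :=
  (I m).toLieSubmodule.toSubmodule.toAddSubgroup

variable {i n}

section

variable (hA : ∀ j ≤ n, Function.Surjective (RLieCat.lieHom (i.app (op ⦋j⦌))))
include hA

theorem relMk_mem_cycles (x : E _⦋n + 1⦌) : relMk i x ∈ cycles (relQuot i) (n + 1) :=
  mem_cycles_succ.2 fun j => (relMk_eq_zero i).2 (hA n le_rfl (RLieCat.lieHom (E.δ j) x))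

theorem face_degen_mem_imageSub {j : Fin (n + 3)} {l : Fin (n + 2)} (h : j ≠ l.castSucc)
    (h' : j ≠ l.succ) (x : E _⦋n + 1⦌) :
    RLieCat.lieHom (E.δ j) (RLieCat.lieHom (E.σ l) x) ∈ imageSub i (op ⦋n + 1⦌) := by
  obtain ⟨j', l', e⟩ := exists_face_degen ((oblvFunctor p k).obj E) h h'
  have e' : RLieCat.lieHom (E.δ j) (RLieCat.lieHom (E.σ l) x) =
    RLieCat.lieHom (E.σ l') (RLieCat.lieHom (E.δ j') x) := e x
  rw [e']
  exact map_mem_imageSub i _ (hA n le_rfl _)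

variable {P : ∀ m : ℕ, AddSubgroup (E _⦋m⦌)}
  (hδ : ∀ (m : ℕ) (j : Fin (m + 2)) (x : E _⦋m + 1⦌), x ∈ P (m + 1) →
    RLieCat.lieHom (E.δ j) x ∈ P m)
  (hσ : ∀ (m : ℕ) (j : Fin (m + 1)) (x : E _⦋m⦌), x ∈ P m → RLieCat.lieHom (E.σ j) x ∈ P (m + 1))
include hδ hσ

/-- In the lowest degree in which `E` differs from `A`, the bracket `⁅x, q⁆` is modulo `A` the
boundary of `⁅s₀ x, s₀ q - s₁ q⁆`, up to brackets with simplices of `A`. -/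
theorem relBd_lie {x q : E _⦋n + 1⦌}
    (hP : ∀ l l' : Fin (n + 2), ⁅RLieCat.lieHom (E.σ l) x, RLieCat.lieHom (E.σ l') q⁆ ∈ P (n + 2))
    (h : ∀ a ∈ imageSub i (op ⦋n + 1⦌), RelBd i P (n + 1) ⁅a, x⁆ ∧ RelBd i P (n + 1) ⁅a, q⁆) :
    RelBd i P (n + 1) ⁅x, q⁆ := by
  set w : E _⦋n + 2⦌ := ⁅RLieCat.lieHom (E.σ 0) x,
    RLieCat.lieHom (E.σ 0) q - RLieCat.lieHom (E.σ 1) q⁆ with hw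
  have hwP : w ∈ P (n + 2) := by
    rw [hw, lie_sub]
    exact sub_mem (hP _ _) (hP _ _)
  -- The faces of `w` of index greater than `2` lie in `A`. Subtracting `s₁ (d₂ w)` makes the face
  -- of index `2` vanish, so that only the faces of index `0` and `1` remain modulo `A`.
  set v : E _⦋n + 1⦌ := RLieCat.lieHom (E.δ 2) w with hv
  set w' : E _⦋n + 2⦌ := w - RLieCat.lieHom (E.σ 1) v with hw'
  have hw'P : w' ∈ P (n + 2) := sub_mem hwP (hσ _ _ _ (hδ _ _ _ hwP))
  set a := RLieCat.lieHom (E.δ 2) (RLieCat.lieHom (E.σ 0) x)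
  set b := RLieCat.lieHom (E.δ 2) (RLieCat.lieHom (E.σ 0) q)
  set c := RLieCat.lieHom (E.δ 0) (RLieCat.lieHom (E.σ 1) q)
  set d := RLieCat.lieHom (E.δ 0) (RLieCat.lieHom (E.σ 1) v)
  have h2 : 2 % (n + 3) = 2 := Nat.mod_eq_of_lt (by omega)
  have n2 : (2 : Fin (n + 3)) ≠ (0 : Fin (n + 2)).castSucc := by simp [Fin.ext_iff, h2]
  have n2' : (2 : Fin (n + 3)) ≠ (0 : Fin (n + 2)).succ := by simp [Fin.ext_iff, h2]
  have n0 : (0 : Fin (n + 3)) ≠ (1 : Fin (n + 2)).castSucc := by simp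
  have n0' : (0 : Fin (n + 3)) ≠ (1 : Fin (n + 2)).succ := (Fin.succ_ne_zero _).symm
  have ha : a ∈ imageSub i _ := face_degen_mem_imageSub hA n2 n2' x
  have hb : b ∈ imageSub i _ := face_degen_mem_imageSub hA n2 n2' q
  have hc : c ∈ imageSub i _ := face_degen_mem_imageSub hA n0 n0' q
  have hd : d ∈ imageSub i _ := face_degen_mem_imageSub hA n0 n0' v
  have e00 : ∀ y : E _⦋n + 1⦌, RLieCat.lieHom (E.δ 0) (RLieCat.lieHom (E.σ 0) y) = y :=
    fun y => face0_degen y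
  have e10 : ∀ y : E _⦋n + 1⦌, RLieCat.lieHom (E.δ 1) (RLieCat.lieHom (E.σ 0) y) = y :=
    fun y => face1_degen y
  have e11 : ∀ y : E _⦋n + 1⦌, RLieCat.lieHom (E.δ 1) (RLieCat.lieHom (E.σ 1) y) = y :=
    fun y => face_degen_castSucc ((oblvFunctor p k).obj E) 1 y
  have e21 : ∀ y : E _⦋n + 1⦌, RLieCat.lieHom (E.δ 2) (RLieCat.lieHom (E.σ 1) y) = y :=
    fun y => face_degen_succ ((oblvFunctor p k).obj E) 1 y
  have f0 : RLieCat.lieHom (E.δ 0) w' = ⁅x, q - c⁆ - d := by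
    rw [hw', map_sub, hw, LieHom.map_lie, map_sub, e00, e00]
  have f1 : RLieCat.lieHom (E.δ 1) w' = -v := by
    rw [hw', map_sub, hw, LieHom.map_lie, map_sub, e10, e10, e11, sub_self, lie_zero, e11, zero_sub]
  have fv : v = ⁅a, b - q⁆ := by
    rw [hv, hw, LieHom.map_lie, map_sub, e21]
  -- The boundary `d₀ w' - d₁ w'` differs from `⁅x, q⁆` by simplices of `A` and by brackets of `x`
  -- and `q` with simplices of `A`.
  have key := bdIn_sub_of_two_faces (Y := relQuot i) (P := relFamily i P)
    (by rintro m j _ ⟨x, hx, rfl⟩; exact ⟨_, hδ m j x hx, rfl⟩)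
    (by rintro m j _ ⟨x, hx, rfl⟩; exact ⟨_, hσ m j x hx, rfl⟩)
    0 (Nat.succ_pos _) (w := relMk i w') ⟨w', hw'P, rfl⟩
    (relMk_mem_cycles hA (⁅x, q - c⁆ - d)) (relMk_mem_cycles hA (-v))
    (congrArg (relMk i) f0) (congrArg (relMk i) f1)
    (fun j hj hj' => by
      refine (relMk_eq_zero i).2 ?_
      change RLieCat.lieHom (E.δ j) w' ∈ _
      rcases eq_or_ne j 2 with rfl | hj2
      · rw [hw', map_sub, e21, ← hv, sub_self]
        exact zero_mem _
      · have h0 : j ≠ (0 : Fin (n + 2)).castSucc := hj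
        have h0' : j ≠ (0 : Fin (n + 2)).succ := hj'
        have h1 : j ≠ (1 : Fin (n + 2)).castSucc := hj'
        have h1' : j ≠ (1 : Fin (n + 2)).succ := hj2
        rw [hw', map_sub, hw, LieHom.map_lie, map_sub]
        exact sub_mem (lie_mem_imageSub i (face_degen_mem_imageSub hA h0 h0' x)
          (sub_mem (face_degen_mem_imageSub hA h0 h0' q) (face_degen_mem_imageSub hA h1 h1' q)))
          (face_degen_mem_imageSub hA h1 h1' v))
  have key' : RelBd i P (n + 1) (⁅x, q - c⁆ - d - -v) := key
  have e : ⁅x, q⁆ = (⁅x, q - c⁆ - d - -v) - ⁅c, x⁆ + (⁅a, q⁆ - (⁅a, b⁆ - d)) := by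
    rw [fv, lie_sub, lie_sub, ← lie_skew c x]
    abel
  rw [e]
  exact (key'.sub (h c hc).1).add ((h a ha).2.sub
    (RelBd.of_mem (sub_mem (lie_mem_imageSub i ha hb) hd)))

end

variable {I : ∀ m : ℕ, RestrictedIdeal p k (E _⦋m⦌)}

/-- The simplices of a simplicial restricted ideal that are boundaries modulo `A` form a restricted
ideal, provided that they include all brackets with simplices of the ideal: if `x = d₀ w + a` then
`ξ x` agrees with `d₀ (ξ w) + ξ a` up to brackets. -/
theorem exists_restrictedIdeal_relBd {m : ℕ}
    (hI : ∀ a ∈ imageSub i (op ⦋m⦌), a ∈ (I m).toLieSubmodule)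
    (hlie : ∀ x ∈ (I m).toLieSubmodule, ∀ q : E _⦋m⦌, RelBd i (idealFamily I) m ⁅x, q⁆) :
    ∃ J : RestrictedIdeal p k (E _⦋m⦌), ∀ x, x ∈ J.toLieSubmodule ↔
      x ∈ (I m).toLieSubmodule ∧ RelBd i (idealFamily I) m x := by
  have hsmul : ∀ (c : k) (x : E _⦋m⦌), RelBd i (idealFamily I) m x →
      RelBd i (idealFamily I) m (c • x) := by
    intro c x hx
    obtain ⟨w, hw, hs, h0⟩ := (relBd_iff i).1 hx
    refine (relBd_iff i).2 ⟨c • w, (I (m + 1)).toLieSubmodule.toSubmodule.smul_mem c hw,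
      fun j => ?_, ?_⟩
    · rw [map_smul]
      exact Submodule.smul_mem _ c (hs j)
    · rw [map_smul, ← smul_sub]
      exact Submodule.smul_mem _ c h0
  have had : ∀ x ∈ (I m).toLieSubmodule, ∀ y ∈ (I m).toLieSubmodule, ∀ l j : ℕ,
      adCoeff x y l j ∈ (I m).toLieSubmodule := by
    intro x hx y hy l
    induction l with
    | zero =>
      rintro (_ | j)
      · exact hx
      · exact zero_mem _
    | succ l ih =>
      rintro (_ | j)
      · exact lie_mem_left k _ (I m).toLieSubmodule _ _ (ih 0)
      · exact add_mem (lie_mem_left k _ (I m).toLieSubmodule _ _ (ih j))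
          (lie_mem_left k _ (I m).toLieSubmodule _ _ (ih (j + 1)))
  have had' : ∀ x ∈ (I m).toLieSubmodule, ∀ y ∈ (I m).toLieSubmodule, ∀ l j : ℕ,
      RelBd i (idealFamily I) m (adCoeff x y (l + 1) j) := by
    rintro x hx y hy l (_ | j)
    · exact hlie _ (had x hx y hy l 0) _
    · exact (hlie _ (had x hx y hy l j) _).add (hlie _ (had x hx y hy l (j + 1)) _)
  have hpOp : ∀ x, x ∈ (I m).toLieSubmodule → RelBd i (idealFamily I) m x →
      RelBd i (idealFamily I) m (pOp p k x) := by
    intro x hxI hx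
    obtain ⟨w, hw, hs, h0⟩ := (relBd_iff i).1 hx
    set v := RLieCat.lieHom (E.δ 0) w
    have hb : x - v ∈ imageSub i (op ⦋m⦌) := by
      rw [← neg_sub]
      exact neg_mem h0
    have hv : v ∈ (I m).toLieSubmodule := by
      have := sub_mem hxI (hI _ hb)
      rwa [sub_sub_cancel] at this
    have e : pOp p k x = _ := congrArg (pOp p k) (add_sub_cancel v x).symm
    rw [e, pOp, RestrictedLieAlgebra.pOp_add]
    refine (RelBd.add ?_ (RelBd.of_mem (pOp_mem_imageSub i hb))).add ?_
    · refine (relBd_iff i).2 ⟨pOp p k w, (I (m + 1)).pOp_mem w hw, fun j => ?_, ?_⟩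
      · rw [RLieCat.lieHom_pOp]
        exact pOp_mem_imageSub i (hs j)
      · rw [RLieCat.lieHom_pOp, sub_self]
        exact zero_mem _
    · refine Finset.sum_induction _ (RelBd i (idealFamily I) m) (fun _ _ => RelBd.add)
        (RelBd.of_mem (zero_mem _)) fun l _ => hsmul _ _ ?_
      -- As `p ≥ 2`, the coefficients `sᵢ` of the `p`-th power of a sum are sums of brackets.
      obtain ⟨l', hl'⟩ : ∃ l', p - 1 = l' + 1 :=
        ⟨p - 2, by have := (Fact.out : p.Prime).two_le; omega⟩
      rw [hl']
      exact had' v hv _ (hI _ hb) l' _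
  refine ⟨{ carrier := {x | x ∈ (I m).toLieSubmodule ∧ RelBd i (idealFamily I) m x}
            add_mem' := fun hx hy => ⟨add_mem hx.1 hy.1, hx.2.add hy.2⟩
            zero_mem' := ⟨zero_mem _, RelBd.of_mem (zero_mem _)⟩
            smul_mem' := fun c x hx =>
              ⟨(I m).toLieSubmodule.toSubmodule.smul_mem c hx.1, hsmul c x hx.2⟩
            lie_mem := fun {q x} hx => ⟨lie_mem_right k _ (I m).toLieSubmodule _ _ hx.1, by
              have := (RelBd.of_mem (i := i) (P := idealFamily I) (zero_mem _)).sub (hlie x hx.1 q)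
              rwa [zero_sub, lie_skew] at this⟩
            pOp_mem := fun x hx => ⟨(I m).pOp_mem x hx.1, hpOp x hx.1 hx.2⟩ }, fun x => Iff.rfl⟩

end firstDegree

/-! ### Acyclicity of the commutator ideal -/

section commutator

variable {p : ℕ} {k : Type u} [Field k] [Fact p.Prime] {X : SRLieCat p k}

/-- The simplicial ideal `[X, X]`. -/
abbrev commFamily (X : SRLieCat p k) : ∀ m : ℕ, AddSubgroup (X _⦋m⦌) :=
  idealFamily fun m => commIdeal p k (X _⦋m⦌)

theorem map_mem_commIdeal {M N : RLieCat p k} (f : M ⟶ N) {x : M}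
    (hx : x ∈ (commIdeal p k M).toLieSubmodule) :
    RLieCat.lieHom f x ∈ (commIdeal p k N).toLieSubmodule :=
  RestrictedIdeal.gen_le_comap f
    (by rintro _ ⟨x, y, rfl⟩; exact ⟨_, _, (LieHom.map_lie (RLieCat.lieHom f) x y).symm⟩) hx

theorem lie_mem_commIdeal {M : RLieCat p k} (x y : M) :
    ⁅x, y⁆ ∈ (commIdeal p k M).toLieSubmodule := RestrictedIdeal.subset_gen ⟨x, y, rfl⟩

theorem imageSub_fromZero {n : SimplexCategoryᵒᵖ} {x : X.obj n}
    (hx : x ∈ imageSub (fromZero X) n) : x = 0 := by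
  obtain ⟨a, rfl⟩ := hx
  rfl

theorem relQuot_fromZero_acyclic {n : ℕ} (h : Subsingleton (homotopyGroup X n)) :
    ∀ z ∈ cycles (relQuot (fromZero X)) n, z ∈ boundaries (relQuot (fromZero X)) n := by
  intro z hz
  obtain ⟨x, rfl⟩ := relProj_isSurjective (fromZero X) n z
  refine SimplicialAddHom.map_boundaries ((subsingleton_piGroup_iff _).1 h x ?_)
  cases n with
  | zero => trivial
  | succ n => exact mem_cycles_succ.2 fun j =>
      imageSub_fromZero ((relMk_eq_zero _).1 (mem_cycles_succ.1 hz j))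

/-- If `A` and `E` agree in degrees at most `n`, simplicial ideals containing `A` are acyclic modulo
`A` in these degrees. -/
theorem relAcyclic_of_surjective {A E : SRLieCat p k} {i : A ⟶ E} {n : ℕ}
    (h : Function.Surjective (RLieCat.lieHom (i.app (op ⦋n⦌))))
    (P : ∀ m : ℕ, AddSubgroup (E _⦋m⦌)) : RelAcyclic i P n := fun z _ _ => RelBd.of_mem (h z)

/-- The ideal `[E, E]` is acyclic in degrees at most `n + 1` if `E` vanishes in degrees at most
`n`. -/
theorem relAcyclic_commFamily_of_surjective {E : SRLieCat p k} {n : ℕ}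
    (hA : ∀ j ≤ n, Function.Surjective (RLieCat.lieHom ((fromZero E).app (op ⦋j⦌)))) :
    RelAcyclic (fromZero E) (commFamily E) (n + 1) := by
  have hlie : ∀ x q : E _⦋n + 1⦌, RelBd (fromZero E) (commFamily E) (n + 1) ⁅x, q⁆ := by
    intro x q
    refine relBd_lie hA (fun m j x hx => map_mem_commIdeal _ hx)
      (fun m j x hx => map_mem_commIdeal _ hx) (fun l l' => lie_mem_commIdeal _ _) fun a ha => ?_
    rw [imageSub_fromZero ha, zero_lie, zero_lie]
    exact ⟨RelBd.of_mem (zero_mem _), RelBd.of_mem (zero_mem _)⟩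
  obtain ⟨J, hJ⟩ := exists_restrictedIdeal_relBd (i := fromZero E)
    (I := fun m => commIdeal p k (E _⦋m⦌)) (m := n + 1)
    (fun a ha => by rw [imageSub_fromZero ha]; exact zero_mem _) (fun x _ q => hlie x q)
  intro z hz _
  refine ((hJ z).1 (RestrictedIdeal.mem_gen.1 hz J ?_)).2
  rintro _ ⟨x, q, rfl⟩
  exact (hJ _).2 ⟨lie_mem_commIdeal x q, hlie x q⟩

/-- The commutator ideal of an `n`-connected cofibrant object is acyclic in degrees at most
`n + 1`. -/
theorem relAcyclic_commFamily (hX : cofibrations p k (fromZero X)) {n : ℕ}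
    (h : ∀ j ≤ n, Subsingleton (homotopyGroup X j)) {m : ℕ} (hm : m ≤ n + 1) :
    RelAcyclic (fromZero X) (commFamily X) m := by
  have hw := isWeakEquiv_eilenbergIncl (fromZero X) n fun j hj => relQuot_fromZero_acyclic (h j hj)
  refine RelAcyclic.of_isWeakEquiv (PE := commFamily _) (toEilenberg_incl (fromZero X) n) hX hw
    (fun m j x hx => map_mem_commIdeal _ hx) (fun m j x hx => map_mem_commIdeal _ hx)
    (fun m x hx => map_mem_commIdeal _ hx) (fun ψ _ m x hx => map_mem_commIdeal _ hx)
    (fun m g _ x hx => map_mem_commIdeal _ hx) ?_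
  rcases hm.lt_or_eq with hm | rfl
  · exact relAcyclic_of_surjective (toEilenberg_surjective _ n (by omega)) _
  · exact relAcyclic_commFamily_of_surjective fun j hj => toEilenberg_surjective (fromZero X) n hj

end commutator

/-! ### Modules over the twisted polynomial ring -/

namespace TwistedPoly

variable {p : ℕ} {k : Type u} [Field k] [Fact p.Prime] [CharP k p]

/-- The twisted polynomial ring is generated by `k` and `ξ`. -/
theorem induction_on {motive : TwistedPoly p k → Prop} (r : TwistedPoly p k)
    (hC : ∀ a, motive (C p k a)) (hX : ∀ r, motive r → motive (r * X p k))
    (hadd : ∀ r s, motive r → motive s → motive (r + s)) : motive r := by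
  let _ := frobAction p k
  have key : ∀ (n : ℕ) (a : k),
      motive (SkewMonoidAlgebra.single (Multiplicative.ofAdd n) a : SkewPolynomial k) := by
    intro n a
    induction n with
    | zero => exact hC a
    | succ n ih =>
      have e : (SkewMonoidAlgebra.single (Multiplicative.ofAdd (n + 1)) a : SkewPolynomial k) =
          SkewMonoidAlgebra.single (Multiplicative.ofAdd n) a *
            SkewMonoidAlgebra.single (Multiplicative.ofAdd 1) 1 := by
        rw [SkewMonoidAlgebra.single_mul_single, smul_one, mul_one]
        rfl
      rw [e]
      exact hX _ ih
  have main : ∀ r : SkewPolynomial k, motive r := by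
    intro r
    induction r using SkewMonoidAlgebra.induction_on with
    | zero =>
      have h := hC 0
      rw [map_zero] at h
      exact h
    | single g a => exact key g.toAdd a
    | add x y hx hy => exact hadd x y hx hy
  exact main r

/-- An additive map that commutes with `k` and `ξ` is `k{ξ}`-linear. -/
theorem map_smul_of {M N : Type*} [AddCommGroup M] [AddCommGroup N] [Module (TwistedPoly p k) M]
    [Module (TwistedPoly p k) N] (f : M →+ N) (hC : ∀ a x, f (C p k a • x) = C p k a • f x)
    (hX : ∀ x, f (X p k • x) = X p k • f x) (r : TwistedPoly p k) (x : M) :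
    f (r • x) = r • f x := by
  induction r using induction_on generalizing x with
  | hC a => exact hC a x
  | hX r ih => rw [mul_smul, mul_smul, ih, hX]
  | hadd r s hr hs => rw [add_smul, add_smul, map_add, hr, hs]

end TwistedPoly

namespace BalancedTensor

variable (R : Type*) [Ring R] (N : Type*) [AddCommGroup N] [Module R N]

/-- The additive map `R ⊗ N → N`, `r ⊗ x ↦ r x`. -/
def actHom : R ⊗[ℤ] N →+ N :=
  TensorProduct.liftAddHom (smulAddHom R N) fun a r x => by
    simp [mul_smul, Int.cast_smul_eq_zsmul, smul_comm a r x]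

/-- The map `R ⊗_R N → N`, `r ⊗ x ↦ r x`. -/
def act : BalancedTensor R R R N →ₗ[R] N :=
  Submodule.liftQ _
    { toFun := actHom R N
      map_add' := map_add _
      map_smul' := fun r t => by
        induction t using TensorProduct.induction_on with
        | zero => rw [smul_zero, map_zero, smul_zero]
        | tmul m x => exact mul_smul r m x
        | add x y hx hy => rw [smul_add, map_add, hx, hy, map_add, smul_add] } (by
    rw [balancedRel, Submodule.span_le]
    rintro _ ⟨m, r, x, rfl⟩
    refine LinearMap.mem_ker.2 ?_
    rw [map_sub]
    exact sub_eq_zero.2 (mul_smul m r x))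

theorem act_tmul (r : R) (x : N) : act R N (tmul R r x) = r • x := rfl

theorem tmul_one_surjective (t : BalancedTensor R R R N) :
    ∃ x : N, tmul (R := R) R (1 : R) x = t := by
  refine induction (motive := fun t => ∃ x : N, tmul (R := R) R (1 : R) x = t) t ⟨0, ?_⟩
    (fun r x => ⟨r • x, ?_⟩) ?_
  · have := tmul_add R R R (N := N) 1 0 0
    rw [add_zero] at this
    exact left_eq_add.1 this
  · rw [tmul_smul]
    congr 1
    simp
  · rintro _ _ ⟨x, rfl⟩ ⟨y, rfl⟩
    exact ⟨x + y, tmul_add R R R 1 x y⟩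

theorem tmul_one_injective {x : N} (h : tmul (R := R) R (1 : R) x = 0) : x = 0 := by
  have := congrArg (act R N) h
  rwa [act_tmul, one_smul, map_zero] at this

end BalancedTensor

/-! ### The Hurewicz theorem -/

section homotopyXi

variable {p : ℕ} {k : Type u} [Field k] [Fact p.Prime]

theorem homotopyXi_piMk {X : SRLieCat p k} {n : ℕ} {z : X _⦋n⦌}
    (hz : z ∈ (cyclesLie X n).toLieSubalgebra) : homotopyXi X n (piMk X n z hz) =
      piMk X n (pOp p k z) ((cyclesLie X n).pOp_mem z hz) := homotopyXi_mk X n ⟨z, hz⟩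

theorem homotopyMap_homotopyXi {X Y : SRLieCat p k} (f : X ⟶ Y) (n : ℕ) (x : homotopyGroup X n) :
    homotopyMap f n (homotopyXi X n x) = homotopyXi Y n (homotopyMap f n x) := by
  obtain ⟨z, hz, rfl⟩ := piMk_surj x
  rw [homotopyXi_piMk, homotopyMap_piMk, homotopyMap_piMk, homotopyXi_piMk, piMk_eq]
  rw [RLieCat.lieHom_pOp, sub_self]
  exact ⟨0, fun _ => map_zero _, map_zero _⟩

end homotopyXi

section hurewicz

variable {p : ℕ} {k : Type u} [Field k] [Fact p.Prime] [CharP k p]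

theorem abUnit_surjective (M : RLieCat p k) : Function.Surjective (abUnit M) := by
  intro t
  obtain ⟨x, rfl⟩ := BalancedTensor.tmul_one_surjective _ _ t
  obtain ⟨x, rfl⟩ := Ab.mk_surjective p k M x
  exact ⟨x, rfl⟩

theorem Ab.mk_eq_zero {M : Type*} [LieRing M] [LieAlgebra k M] [RestrictedLieAlgebra p k M]
    {x : M} :
    Ab.mk p k M x = 0 ↔ x ∈ (commIdeal p k M).toLieSubmodule :=
  Submodule.Quotient.mk_eq_zero _

theorem abUnit_eq_zero {M : RLieCat p k} {x : M} :
    abUnit M x = 0 ↔ x ∈ (commIdeal p k M).toLieSubmodule := by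
  rw [← Ab.mk_eq_zero]
  refine ⟨fun h => BalancedTensor.tmul_one_injective _ _ h, fun h => ?_⟩
  change BalancedTensor.tmul _ 1 (Ab.mk p k M x) = 0
  rw [h, ← Ab.mk_eq_zero.2 (zero_mem (commIdeal p k M).toLieSubmodule)]
  exact map_zero (abUnit M)

theorem abUnit_pOp {M : RLieCat p k} (x : M) :
    abUnit M (pOp p k x) = TwistedPoly.X p k • abUnit M x := by
  change BalancedTensor.tmul _ 1 (Ab.mk p k M (pOp p k x)) =
    TwistedPoly.X p k • BalancedTensor.tmul _ 1 (Ab.mk p k M x)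
  rw [← Ab.frob_mk, ← Ab.X_smul, BalancedTensor.tmul_smul, BalancedTensor.smul_tmul]
  congr 1
  simp

/-- The simplicial `k{ξ}`-module `Ab(X)`, in the form `k{ξ} ⊗ Ab(X)` in which it enters the
homology with coefficients in `k{ξ}`. -/
abbrev abChains (X : SRLieCat p k) : SMod.{u} (TwistedPoly p k) :=
  (chainsFunctor (TwistedPoly p k) (TwistedPoly p k)).obj X

/-- The map of simplicial modules induced by a map of simplicial restricted Lie algebras. -/
abbrev abChainsMap {X Y : SRLieCat p k} (f : X ⟶ Y) : abChains X ⟶ abChains Y :=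
  (chainsFunctor (TwistedPoly p k) (TwistedPoly p k)).map f

/-- The quotient map `X → Ab(X)`, degreewise additive. -/
def abHom (X : SRLieCat p k) : SimplicialAddHom ((oblvFunctor p k).obj X) (abChains X) where
  app n := (abUnit (X _⦋n⦌)).toAddMonoidHom
  face _ _ _ := rfl
  degen _ _ _ := rfl

theorem abHom_isSurjective (X : SRLieCat p k) : (abHom X).IsSurjective := fun n =>
  abUnit_surjective (X _⦋n⦌)

theorem abHom_kerAcyclic {X : SRLieCat p k} {n : ℕ}
    (h : RelAcyclic (fromZero X) (commFamily X) n) : (abHom X).KerAcyclic n := by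
  intro x hx hxk
  have hc : relMk (fromZero X) x ∈ cycles (relQuot (fromZero X)) n :=
    (relProj (fromZero X)).map_cycles hx
  obtain ⟨w, hw, hs, h0⟩ := (relBd_iff _).1 (h x (abUnit_eq_zero.1 hxk) hc)
  exact ⟨w, abUnit_eq_zero.2 hw, fun j => imageSub_fromZero (hs j),
    sub_eq_zero.1 (imageSub_fromZero h0)⟩

theorem piAbUnit_injective {X : SRLieCat p k} {n : ℕ} (h : (abHom X).KerAcyclic n) :
    Function.Injective (piAbUnit X n) :=
  (mapSemi_injective_iff _ _).2 fun _ hy hb => h.mem_boundaries (abHom_isSurjective X) hy hb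

theorem piAbUnit_surjective {X : SRLieCat p k} {n : ℕ} (h : (abHom X).KerAcyclic n) :
    Function.Surjective (piAbUnit X (n + 1)) :=
  (mapSemi_surjective_iff _ _).2 fun z hz => by
    obtain ⟨y, hy, e⟩ := h.exists_cycle (abHom_isSurjective X) hz
    refine ⟨y, hy, ?_⟩
    have e' : z - (abHom X).app (n + 1) y = 0 := sub_eq_zero.2 e.symm
    exact (congrArg (· ∈ boundaries (abChains X) (n + 1)) e').mpr (zero_mem _)

theorem hurewicz_homotopyMap {L : SRLieCat p k} (Q : CofibrantReplacement L) (s : ℕ)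
    (x : homotopyGroup Q.obj s) : hurewicz Q s (homotopyMap Q.q s x) = piAbUnit Q.obj s x := by
  refine congrArg (piAbUnit Q.obj s) ?_
  exact (LinearEquiv.ofBijective (homotopyMap Q.q s) (Q.acyclic.1 s)).symm_apply_apply x

theorem hurewicz_injective_iff {L : SRLieCat p k} (Q : CofibrantReplacement L) (s : ℕ) :
    Function.Injective (hurewicz Q s) ↔ Function.Injective (piAbUnit Q.obj s) :=
  Function.Injective.of_comp_iff' (piAbUnit Q.obj s)
    (LinearEquiv.ofBijective (homotopyMap Q.q s) (Q.acyclic.1 s)).symm.bijective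

theorem hurewicz_surjective_iff {L : SRLieCat p k} (Q : CofibrantReplacement L) (s : ℕ) :
    Function.Surjective (hurewicz Q s) ↔ Function.Surjective (piAbUnit Q.obj s) :=
  Function.Surjective.of_comp_iff (piAbUnit Q.obj s)
    (LinearEquiv.ofBijective (homotopyMap Q.q s) (Q.acyclic.1 s)).symm.surjective

theorem subsingleton_of_isWeakEquiv {X Y : SRLieCat p k} {f : X ⟶ Y} (hf : IsWeakEquiv f) {n : ℕ}
    (h : Subsingleton (homotopyGroup Y n)) : Subsingleton (homotopyGroup X n) :=
  (hf n).1.subsingleton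

theorem piAbUnit_homotopyXi (X : SRLieCat p k) (n : ℕ) (x : homotopyGroup X n) :
    piAbUnit X n (homotopyXi X n x) = TwistedPoly.X p k • piAbUnit X n x := by
  obtain ⟨z, hz, rfl⟩ := piMk_surj x
  rw [homotopyXi_piMk]
  exact congrArg Submodule.Quotient.mk (Subtype.ext (abUnit_pOp (M := X _⦋n⦌) z))

theorem hurewicz_homotopyXi {L : SRLieCat p k} (Q : CofibrantReplacement L) (s : ℕ)
    (x : homotopyGroup L s) :
    hurewicz Q s (homotopyXi L s x) = TwistedPoly.X p k • hurewicz Q s x := by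
  obtain ⟨x, rfl⟩ := (Q.acyclic.1 s).2 x
  exact (congrArg (hurewicz Q s) (homotopyMap_homotopyXi Q.q s x).symm).trans
    ((hurewicz_homotopyMap Q s _).trans ((piAbUnit_homotopyXi Q.obj s x).trans
      (congrArg (TwistedPoly.X p k • ·) (hurewicz_homotopyMap Q s x).symm)))

theorem eq_fromZero {X : SRLieCat p k} (g : zeroSRLie p k ⟶ X) : g = fromZero X := by
  apply NatTrans.ext
  funext n
  exact RLieCat.hom_ext fun _ => map_zero (RLieCat.lieHom (g.app n))

theorem CofibrantReplacement.cofibrations_fromZero {L : SRLieCat p k}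
    (Q : CofibrantReplacement L) : cofibrations p k (fromZero Q.obj) :=
  eq_fromZero Q.i ▸ Q.cof

/-- The Hurewicz theorem. -/
theorem hurewicz_of_connected {L : SRLieCat p k} (Q : CofibrantReplacement L) {n : ℕ}
    (h : ∀ j ≤ n, Subsingleton (homotopyGroup L j)) :
    Function.Bijective (hurewicz Q (n + 1)) ∧ Function.Surjective (hurewicz Q (n + 2)) := by
  have hQ : ∀ m ≤ n + 1, (abHom Q.obj).KerAcyclic m := fun m hm =>
    abHom_kerAcyclic (relAcyclic_commFamily Q.cofibrations_fromZero
      (fun j hj => subsingleton_of_isWeakEquiv Q.acyclic.1 (h j hj)) hm)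
  exact ⟨⟨(hurewicz_injective_iff Q _).2 (piAbUnit_injective (hQ (n + 1) le_rfl)),
    (hurewicz_surjective_iff Q _).2 (piAbUnit_surjective (hQ n (Nat.le_succ n)))⟩,
    (hurewicz_surjective_iff Q _).2 (piAbUnit_surjective (hQ (n + 1) le_rfl))⟩

/-! ### The Hurewicz homomorphism in degree zero -/

/-- The class of a vertex. -/
def vertexClass (L : SRLieCat p k) : L _⦋0⦌ →ₗ⁅k⁆ homotopyLie L 0 :=
  (boundariesLie L 0).mkLie.comp
    { toFun := fun x => ⟨x, trivial⟩
      map_add' := fun _ _ => rfl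
      map_smul' := fun _ _ => rfl
      map_lie' := rfl }

theorem vertexClass_surjective (L : SRLieCat p k) : Function.Surjective (vertexClass L) := by
  intro x
  obtain ⟨⟨z, hz⟩, rfl⟩ := (boundariesLie L 0).mkLie_surjective x
  exact ⟨z, rfl⟩

theorem vertexClass_pOp (L : SRLieCat p k) (x : L _⦋0⦌) :
    vertexClass L (pOp p k x) = pOp p k (vertexClass L x) :=
  ((boundariesLie L 0).pOp_mkLie ⟨x, trivial⟩).symm

theorem hurewicz_vertexClass {L : SRLieCat p k} (Q : CofibrantReplacement L) (z : Q.obj _⦋0⦌) :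
    hurewicz Q 0 ((toHomotopyLie L 0).symm (vertexClass L (RLieCat.lieHom (Q.q.app (op ⦋0⦌)) z))) =
      PiGroup.mk (Y := abChains Q.obj) (n := 0) ⟨abUnit (Q.obj _⦋0⦌) z, trivial⟩ :=
  hurewicz_homotopyMap Q 0 (piMk Q.obj 0 z trivial)

theorem hurewicz_vertexClass_eq_zero_iff {L : SRLieCat p k} (Q : CofibrantReplacement L)
    (z : Q.obj _⦋0⦌) : hurewicz Q 0 ((toHomotopyLie L 0).symm
      (vertexClass L (RLieCat.lieHom (Q.q.app (op ⦋0⦌)) z))) = 0 ↔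
      (abHom Q.obj).app 0 z ∈ boundaries (abChains Q.obj) 0 := by
  rw [hurewicz_vertexClass]
  exact PiGroup.mk_eq_zero

/-- The kernel of the Hurewicz homomorphism in degree `0` is the commutator ideal. -/
theorem hurewicz_zero_eq_zero_iff {L : SRLieCat p k} (Q : CofibrantReplacement L)
    (x : homotopyLie L 0) : hurewicz Q 0 ((toHomotopyLie L 0).symm x) = 0 ↔
      x ∈ (commIdeal p k (homotopyLie L 0)).toLieSubmodule := by
  have hlift : ∀ x : homotopyLie L 0, ∃ z : Q.obj _⦋0⦌,
      vertexClass L (RLieCat.lieHom (Q.q.app (op ⦋0⦌)) z) = x := fun x => by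
    obtain ⟨l, rfl⟩ := vertexClass_surjective L x
    obtain ⟨z, rfl⟩ := Q.acyclic.2 0 l
    exact ⟨z, rfl⟩
  constructor
  · intro hx
    obtain ⟨z, rfl⟩ := hlift x
    rw [hurewicz_vertexClass_eq_zero_iff] at hx
    obtain ⟨y, hy, e⟩ := SimplicialAddHom.exists_boundary_lift (abHom_isSurjective Q.obj) hx
    let y' : Q.obj _⦋0⦌ := y
    have hz : z - y' ∈ (commIdeal p k (Q.obj _⦋0⦌)).toLieSubmodule := by
      rw [← abUnit_eq_zero, map_sub]
      exact sub_eq_zero.2 e.symm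
    let F : RestrictedLieHom p k (Q.obj _⦋0⦌) (homotopyLie L 0) :=
      { toLieHom := (vertexClass L).comp (RLieCat.lieHom (Q.q.app (op ⦋0⦌)))
        map_pOp := fun x => by
          change vertexClass L (RLieCat.lieHom (Q.q.app (op ⦋0⦌)) (pOp p k x)) =
            pOp p k (vertexClass L (RLieCat.lieHom (Q.q.app (op ⦋0⦌)) x))
          rw [RLieCat.lieHom_pOp, vertexClass_pOp] }
    have hF := RestrictedIdeal.gen_le_comap F (S' := {z | ∃ x y : homotopyLie L 0, ⁅x, y⁆ = z})
      (by rintro _ ⟨x, y, rfl⟩; exact ⟨_, _, (LieHom.map_lie F.toLieHom x y).symm⟩) hz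
    have hy0 : F.toLieHom y' = 0 :=
      (Submodule.Quotient.mk_eq_zero _).2 ((oblvHom Q.q).map_boundaries hy)
    rw [map_sub, hy0, sub_zero] at hF
    exact hF
  · intro hx
    let J : RestrictedIdeal p k (homotopyLie L 0) :=
      { carrier := {x | hurewicz Q 0 ((toHomotopyLie L 0).symm x) = 0}
        add_mem' := fun {x y} hx hy => by
          change hurewicz Q 0 _ = 0
          rw [map_add, map_add, show hurewicz Q 0 ((toHomotopyLie L 0).symm x) = 0 from hx,
            show hurewicz Q 0 ((toHomotopyLie L 0).symm y) = 0 from hy, add_zero]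
        zero_mem' := by
          change hurewicz Q 0 _ = 0
          rw [map_zero, map_zero]
        smul_mem' := fun c x hx => by
          change hurewicz Q 0 _ = 0
          rw [map_smul, LinearMap.map_smulₛₗ,
            show hurewicz Q 0 ((toHomotopyLie L 0).symm x) = 0 from hx, smul_zero]
        lie_mem := fun {x y} _ => by
          obtain ⟨x, rfl⟩ := hlift x
          obtain ⟨y, rfl⟩ := hlift y
          change hurewicz Q 0 ((toHomotopyLie L 0).symm ⁅_, _⁆) = 0
          rw [← LieHom.map_lie, ← LieHom.map_lie, hurewicz_vertexClass_eq_zero_iff,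
            show (abHom Q.obj).app 0 (⁅x, y⁆ : Q.obj _⦋0⦌) = 0 from
              abUnit_eq_zero.2 (lie_mem_commIdeal x y)]
          exact zero_mem _
        pOp_mem := fun x hx => by
          change hurewicz Q 0 (homotopyXi L 0 ((toHomotopyLie L 0).symm x)) = 0
          rw [hurewicz_homotopyXi, show hurewicz Q 0 ((toHomotopyLie L 0).symm x) = 0 from hx,
            smul_zero] }
    refine RestrictedIdeal.mem_gen.1 hx J ?_
    rintro _ ⟨x, y, rfl⟩
    obtain ⟨x, rfl⟩ := hlift x
    obtain ⟨y, rfl⟩ := hlift y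
    change hurewicz Q 0 ((toHomotopyLie L 0).symm ⁅_, _⁆) = 0
    rw [← LieHom.map_lie, ← LieHom.map_lie, hurewicz_vertexClass_eq_zero_iff,
      show (abHom Q.obj).app 0 (⁅x, y⁆ : Q.obj _⦋0⦌) = 0 from
        abUnit_eq_zero.2 (lie_mem_commIdeal x y)]
    exact zero_mem _

theorem hurewicz_zero_surjective {L : SRLieCat p k} (Q : CofibrantReplacement L) :
    Function.Surjective (hurewicz Q 0) := by
  intro t
  obtain ⟨⟨t, ht⟩, rfl⟩ := Submodule.Quotient.mk_surjective _ t
  obtain ⟨z, rfl⟩ := abUnit_surjective (Q.obj _⦋0⦌) t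
  exact ⟨_, hurewicz_vertexClass Q z⟩

/-- The Hurewicz homomorphism in degree `0` identifies the first homology group with the
abelianization of `π₀`. -/
theorem exists_equiv_hurewicz_zero {L : SRLieCat p k} (Q : CofibrantReplacement L) :
    ∃ e : Ab p k (homotopyLie L 0) ≃ₗ[TwistedPoly p k] xiHomology Q 1,
      ∀ x : homotopyGroup L 0,
        e (Ab.mk p k (homotopyLie L 0) (toHomotopyLie L 0 x)) = hurewicz Q 0 x := by
  let g : homotopyLie L 0 →+ xiHomology Q 1 :=
    (hurewicz Q 0).toAddMonoidHom.comp (toHomotopyLie L 0).symm.toLinearMap.toAddMonoidHom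
  let f : Ab p k (homotopyLie L 0) →+ xiHomology Q 1 :=
    QuotientAddGroup.lift
      (commIdeal p k (homotopyLie L 0)).toLieSubmodule.toSubmodule.toAddSubgroup g
      fun x hx => (hurewicz_zero_eq_zero_iff Q x).2 hx
  have hf : ∀ x, f (Ab.mk p k _ x) = hurewicz Q 0 ((toHomotopyLie L 0).symm x) := fun _ => rfl
  let F : Ab p k (homotopyLie L 0) →ₗ[TwistedPoly p k] xiHomology Q 1 :=
    { toFun := f
      map_add' := map_add f
      map_smul' := TwistedPoly.map_smul_of f
        (fun a x => by
          obtain ⟨x, rfl⟩ := Ab.mk_surjective p k _ x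
          rw [Ab.C_smul, ← map_smul, hf, hf, map_smul, LinearMap.map_smulₛₗ])
        (fun x => by
          obtain ⟨x, rfl⟩ := Ab.mk_surjective p k _ x
          rw [Ab.X_smul, Ab.frob_mk, hf, hf, ← hurewicz_homotopyXi]
          rfl) }
  refine ⟨LinearEquiv.ofBijective F ⟨(injective_iff_map_eq_zero F).2 fun x hx => ?_, fun t => ?_⟩,
    fun x => rfl⟩
  · obtain ⟨x, rfl⟩ := Ab.mk_surjective p k _ x
    exact Ab.mk_eq_zero.2 ((hurewicz_zero_eq_zero_iff Q x).1 hx)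
  · obtain ⟨x, rfl⟩ := hurewicz_zero_surjective Q t
    exact ⟨Ab.mk p k _ (toHomotopyLie L 0 x), rfl⟩

end hurewicz

/-! ### The ideal generated by a connected subobject -/

section imageIdeal

variable {p : ℕ} {k : Type u} [Field k] [Fact p.Prime] {A E X : SRLieCat p k}

/-- The simplicial ideal of `X` generated by the image of `i`. -/
abbrev imageFamily (i : A ⟶ X) : ∀ m : ℕ, AddSubgroup (X _⦋m⦌) :=
  idealFamily fun m => imageIdeal i (op ⦋m⦌)

theorem mem_imageIdeal_of_mem_imageSub {i : A ⟶ X} {n : SimplexCategoryᵒᵖ} {x : X.obj n}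
    (hx : x ∈ imageSub i n) : x ∈ (imageIdeal i n).toLieSubmodule := by
  obtain ⟨a, rfl⟩ := hx
  exact RestrictedIdeal.subset_gen ⟨a, rfl⟩

theorem map_mem_imageIdeal {a : A ⟶ E} {i : A ⟶ X} {n : SimplexCategoryᵒᵖ}
    {g : E.obj n ⟶ X.obj n} (hg : a.app n ≫ g = i.app n) {x : E.obj n}
    (hx : x ∈ (imageIdeal a n).toLieSubmodule) :
    RLieCat.lieHom g x ∈ (imageIdeal i n).toLieSubmodule :=
  RestrictedIdeal.gen_le_comap g
    (by rintro _ ⟨b, rfl⟩; exact ⟨b, RLieCat.lieHom_congr hg.symm b⟩) hx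

/-- If `A` is connected, the bracket of `a ∈ A` with any simplex `q` is a boundary modulo `A` in the
lowest degree in which `E` differs from `A`: a path `γ` in `A` from `0` to `a` gives a homotopy
`⁅γ, q⁆` from `0` to `⁅a, q⁆`. -/
theorem relBd_lie_app {i : A ⟶ E} {n : ℕ}
    (hA : ∀ j ≤ n, Function.Surjective (RLieCat.lieHom (i.app (op ⦋j⦌))))
    (h0 : Function.Surjective (homotopyMap (fromZero A) 0)) {P : ∀ m : ℕ, AddSubgroup (E _⦋m⦌)}
    (hδ : ∀ (m : ℕ) (j : Fin (m + 2)) (x : E _⦋m + 1⦌), x ∈ P (m + 1) →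
      RLieCat.lieHom (E.δ j) x ∈ P m)
    (hσ : ∀ (m : ℕ) (j : Fin (m + 1)) (x : E _⦋m⦌), x ∈ P m →
      RLieCat.lieHom (E.σ j) x ∈ P (m + 1))
    (hP : ∀ x ∈ imageSub i (op ⦋n + 2⦌), ∀ y : E _⦋n + 2⦌, ⁅x, y⁆ ∈ P (n + 2))
    (a : A _⦋n + 1⦌) (q : E _⦋n + 1⦌) :
    RelBd i P (n + 1) ⁅RLieCat.lieHom (i.app (op ⦋n + 1⦌)) a, q⁆ := by
  obtain ⟨x, hx⟩ := mappingPath.endpoint_surjective (fromZero A) h0 (n + 1) a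
  let γ : ∀ s : PathIndex ⦋n + 1⦌, A.obj (op s.1) := x.1.2
  have hγ : ∀ (s : PathIndex ⦋n + 1⦌) {m : SimplexCategory} (η : m ⟶ s.1),
      RLieCat.lieHom (A.map η.op) (γ s) = γ (s.restrict η) := x.2.1
  have hγ0 : γ ⟨⦋n + 1⦌, 𝟙 _, constMap _ 0⟩ = 0 := x.2.2
  have hγ1 : γ ⟨⦋n + 1⦌, 𝟙 _, constMap _ 1⟩ = a := hx
  let f : ℕ → E _⦋n + 1⦌ := fun t =>
    ⁅RLieCat.lieHom (i.app (op ⦋n + 1⦌)) (γ ⟨⦋n + 1⦌, 𝟙 _, cut ⦋n + 1⦌ t⟩), q⁆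
  have hf0 : f 0 = ⁅RLieCat.lieHom (i.app (op ⦋n + 1⦌)) a, q⁆ := by
    rw [← hγ1]
    rfl
  have hf1 : f (n + 2) = 0 := by
    change ⁅RLieCat.lieHom (i.app (op ⦋n + 1⦌)) (γ ⟨⦋n + 1⦌, 𝟙 _, cut ⦋n + 1⦌ (n + 2)⟩), q⁆ = 0
    rw [PathIndex.congr γ rfl (cut_len (n + 1)), hγ0, map_zero, zero_lie]
  suffices H : ∀ t ≤ n + 2, RelBd i P (n + 1) (f 0 - f t) by
    have := H (n + 2) le_rfl
    rwa [hf0, hf1, sub_zero] at this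
  intro t
  induction t with
  | zero =>
    intro _
    rw [sub_self]
    exact RelBd.of_mem (zero_mem _)
  | succ t ih =>
    intro ht
    rw [← sub_add_sub_cancel _ (f t)]
    refine (ih (by omega)).add ?_
    let j : Fin (n + 2) := ⟨t, ht⟩
    -- The `t`-th simplex of the prism `Δ[n + 1] × Δ[1]`: the faces of `w` of index `t` and `t + 1`
    -- are `f t` and `f (t + 1)`, the other ones lie in `A`.
    let s : PathIndex ⦋n + 1⦌ := ⟨⦋n + 2⦌, SimplexCategory.σ j, cut ⦋n + 2⦌ (t + 1)⟩
    let w : E _⦋n + 2⦌ := ⁅RLieCat.lieHom (i.app (op ⦋n + 2⦌)) (γ s), RLieCat.lieHom (E.σ j) q⁆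
    have hw : w ∈ P (n + 2) := hP _ (app_mem_imageSub i _) _
    have hface : ∀ l : Fin (n + 3), RLieCat.lieHom (E.δ l) w =
        ⁅RLieCat.lieHom (i.app (op ⦋n + 1⦌)) (γ (s.restrict (SimplexCategory.δ l))),
          RLieCat.lieHom (E.δ l) (RLieCat.lieHom (E.σ j) q)⁆ := by
      intro l
      refine (LieHom.map_lie _ _ _).trans ?_
      rw [map_face, ← hγ s (SimplexCategory.δ l)]
      rfl
    have e1 : RLieCat.lieHom (E.δ j.castSucc) w = f t := by
      rw [hface]
      exact congrArg₂ _ (congrArg _ (PathIndex.congr γ SimplexCategory.δ_comp_σ_self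
        (δ_castSucc_cut j))) (face_degen_castSucc ((oblvFunctor p k).obj E) j q)
    have e2 : RLieCat.lieHom (E.δ j.succ) w = f (t + 1) := by
      rw [hface]
      exact congrArg₂ _ (congrArg _ (PathIndex.congr γ SimplexCategory.δ_comp_σ_succ
        (δ_succ_cut j))) (face_degen_succ ((oblvFunctor p k).obj E) j q)
    exact bdIn_sub_of_two_faces (Y := relQuot i) (P := relFamily i P)
      (by rintro m j _ ⟨x, hx, rfl⟩; exact ⟨_, hδ m j x hx, rfl⟩)
      (by rintro m j _ ⟨x, hx, rfl⟩; exact ⟨_, hσ m j x hx, rfl⟩)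
      t ht (w := relMk i w) ⟨w, hw, rfl⟩ (relMk_mem_cycles hA (f t))
      (relMk_mem_cycles hA (f (t + 1))) (congrArg (relMk i) e1) (congrArg (relMk i) e2)
      fun l hl hl' => by
        refine (relMk_eq_zero i).2 ?_
        change RLieCat.lieHom (E.δ l) w ∈ _
        rw [hface]
        exact lie_mem_imageSub i (app_mem_imageSub i _) (face_degen_mem_imageSub hA hl hl' q)

/-- The ideal generated by a connected `A` is acyclic modulo `A` in the lowest degree in which `E`
differs from `A`. -/
theorem relAcyclic_imageFamily_of_surjective {i : A ⟶ E} {n : ℕ}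
    (hA : ∀ j ≤ n, Function.Surjective (RLieCat.lieHom (i.app (op ⦋j⦌))))
    (h0 : Function.Surjective (homotopyMap (fromZero A) 0)) :
    RelAcyclic i (imageFamily i) (n + 1) := by
  have hδ : ∀ (m : ℕ) (j : Fin (m + 2)) (x : E _⦋m + 1⦌), x ∈ imageFamily i (m + 1) →
      RLieCat.lieHom (E.δ j) x ∈ imageFamily i m := fun m j x hx => imageIdeal_map i _ x hx
  have hσ : ∀ (m : ℕ) (j : Fin (m + 1)) (x : E _⦋m⦌), x ∈ imageFamily i m →
      RLieCat.lieHom (E.σ j) x ∈ imageFamily i (m + 1) := fun m j x hx => imageIdeal_map i _ x hx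
  have hP : ∀ x ∈ imageFamily i (n + 2), ∀ y : E _⦋n + 2⦌, ⁅x, y⁆ ∈ imageFamily i (n + 2) :=
    fun x hx y => lie_mem_left k _ (imageIdeal i (op ⦋n + 2⦌)).toLieSubmodule _ _ hx
  have happ : ∀ a ∈ imageSub i (op ⦋n + 1⦌), ∀ q : E _⦋n + 1⦌,
      RelBd i (imageFamily i) (n + 1) ⁅a, q⁆ := by
    rintro _ ⟨a, rfl⟩ q
    exact relBd_lie_app hA h0 hδ hσ
      (fun x hx y => hP x (mem_imageIdeal_of_mem_imageSub hx) y) a q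
  obtain ⟨J, hJ⟩ := exists_restrictedIdeal_relBd (i := i) (I := fun m => imageIdeal i (op ⦋m⦌))
    (m := n + 1) (fun a ha => mem_imageIdeal_of_mem_imageSub ha)
    (fun x hx q => relBd_lie hA hδ hσ (fun l l' => hP _ (hσ _ l _ hx) _)
      fun a ha => ⟨happ a ha x, happ a ha q⟩)
  intro z hz _
  refine ((hJ z).1 (RestrictedIdeal.mem_gen.1 hz J ?_)).2
  rintro _ ⟨a, rfl⟩
  exact (hJ _).2 ⟨RestrictedIdeal.subset_gen ⟨a, rfl⟩, RelBd.of_mem (app_mem_imageSub i a)⟩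

/-- If `i : A → X` is a cofibration, `A` is connected and `X / i(A)` has no homotopy in degrees at
most `n`, the ideal generated by `A` is acyclic modulo `A` in degrees at most `n + 1`. -/
theorem relAcyclic_imageFamily {i : A ⟶ X} (hi : cofibrations p k i)
    (h0 : Subsingleton (homotopyGroup A 0)) {n : ℕ}
    (h : ∀ j ≤ n, ∀ z ∈ cycles (relQuot i) j, z ∈ boundaries (relQuot i) j) {m : ℕ}
    (hm : m ≤ n + 1) : RelAcyclic i (imageFamily i) m := by
  refine RelAcyclic.of_isWeakEquiv (PE := imageFamily (toEilenberg i n)) (toEilenberg_incl i n) hi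
    (isWeakEquiv_eilenbergIncl i n h)
    (fun m j x hx => imageIdeal_map i _ x hx) (fun m j x hx => imageIdeal_map i _ x hx)
    (fun m x hx =>
      map_mem_imageIdeal (congrArg (fun f => NatTrans.app f _) (toEilenberg_incl i n)) hx)
    (fun ψ hψ m x hx => map_mem_imageIdeal (congrArg (fun f => NatTrans.app f _) hψ) hx)
    (fun m g hg x hx => map_mem_imageIdeal hg hx) ?_
  rcases hm.lt_or_eq with hm | rfl
  · exact relAcyclic_of_surjective (toEilenberg_surjective _ n (by omega)) _
  · exact relAcyclic_imageFamily_of_surjective (fun j hj => toEilenberg_surjective i n hj)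
      fun x => ⟨0, h0.elim _ _⟩

end imageIdeal

/-! ### The quotient by the image and the cokernel -/

section cokernel

variable {p : ℕ} {k : Type u} [Field k] [Fact p.Prime] {A X : SRLieCat p k} (i : A ⟶ X)

/-- The map from the quotient of simplicial vector spaces `X / i(A)` to the cokernel in simplicial
restricted Lie algebras. -/
def relToCokernel : SimplicialAddHom (relQuot i) ((oblvFunctor p k).obj (cokernel i)) where
  app n := (Submodule.mapQ (imageSub i (op ⦋n⦌))
    (imageIdeal i (op ⦋n⦌)).toLieSubmodule.toSubmodule LinearMap.id
    fun _ hx => mem_imageIdeal_of_mem_imageSub hx).toAddMonoidHom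
  face n j y := by
    obtain ⟨y, rfl⟩ := relProj_isSurjective i _ y
    rfl
  degen n j y := by
    obtain ⟨y, rfl⟩ := relProj_isSurjective i _ y
    rfl

theorem relToCokernel_isSurjective : (relToCokernel i).IsSurjective := fun n z => by
  obtain ⟨x, rfl⟩ := (imageIdeal i (op ⦋n⦌)).mkLie_surjective z
  exact ⟨relMk i x, rfl⟩

variable {i}

theorem relToCokernel_kerAcyclic {n : ℕ} (h : RelAcyclic i (imageFamily i) n) :
    (relToCokernel i).KerAcyclic n := by
  intro x hx hxk
  obtain ⟨x, rfl⟩ := relProj_isSurjective i n x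
  obtain ⟨_, ⟨w, hw, rfl⟩, hs, h0⟩ := h x ((Submodule.Quotient.mk_eq_zero _).1 hxk) hx
  exact ⟨_, (Submodule.Quotient.mk_eq_zero _).2 hw, hs, h0⟩

/-- Where the kernel of `X / i(A) → coker(i)` is acyclic, the vanishing of the homotopy of `X /
i(A)` implies that of the cokernel. -/
theorem cokernel_subsingleton {n : ℕ} (h : ∀ m < n, (relToCokernel i).KerAcyclic m)
    (hV : ∀ z ∈ cycles (relQuot i) n, z ∈ boundaries (relQuot i) n) :
    Subsingleton (homotopyGroup (cokernel i) n) := by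
  refine (subsingleton_piGroup_iff n).2 fun z hz => ?_
  cases n with
  | zero =>
    obtain ⟨y, rfl⟩ := relToCokernel_isSurjective i 0 z
    exact (relToCokernel i).map_boundaries (hV y trivial)
  | succ n =>
    obtain ⟨y, hy, rfl⟩ := (h n (Nat.lt_succ_self n)).exists_cycle (relToCokernel_isSurjective i) hz
    exact (relToCokernel i).map_boundaries (hV y hy)

/-- A cycle of `X / i(A)` is represented by a simplex of the homotopy fiber. -/
theorem exists_fiber_cycle (hi : ∀ m : ℕ, Function.Injective (RLieCat.lieHom (i.app (op ⦋m⦌))))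
    {n : ℕ} {z : (relQuot i) _⦋n + 1⦌} (hz : z ∈ cycles (relQuot i) (n + 1)) :
    ∃ x : (fiber i) _⦋n⦌, x ∈ (cyclesLie (fiber i) n).toLieSubalgebra ∧
      relMk i (show X _⦋n + 1⦌ from x.1.2) = z := by
  rw [mem_cycles_succ] at hz
  obtain ⟨γ, hγ, rfl⟩ := SimplicialAddHom.exists_normalized_lift (relProj_isSurjective i)
    fun j => hz j.succ
  have hγ' : ∀ j : Fin (n + 1), RLieCat.lieHom (X.δ j.succ) (show X _⦋n + 1⦌ from γ) = 0 := hγ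
  obtain ⟨a, ha⟩ := (relMk_eq_zero i).1 (hz 0)
  have ha' : RLieCat.lieHom (X.δ 0) (show X _⦋n + 1⦌ from γ) =
    RLieCat.lieHom (i.app (op ⦋n⦌)) a := ha.symm
  refine ⟨fiberMk (f := i) a γ ha' 0 (hγ' 0), fiber_mem_cycles ?_ hγ', rfl⟩
  cases n with
  | zero => trivial
  | succ n =>
    refine mem_cyclesLie_succ.2 fun j => hi n ?_
    refine (map_face i j a).symm.trans ?_
    rw [← ha', face_face0, hγ' j, map_zero, map_zero]

theorem fiberToCokernel_piMk {n : ℕ} {x : (fiber i) _⦋n⦌}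
    (hx : x ∈ (cyclesLie (fiber i) n).toLieSubalgebra)
    (hc : cokernelMk i (op ⦋n + 1⦌) x.1.2 ∈ (cyclesLie (cokernel i) (n + 1)).toLieSubalgebra) :
    fiberToCokernel i n (piMk _ n x hx) = piMk (cokernel i) (n + 1) _ hc := rfl

theorem cokernelMk_mem_cycles {n : ℕ} {x : (fiber i) _⦋n⦌}
    (hx : x ∈ (cyclesLie (fiber i) n).toLieSubalgebra) :
    cokernelMk i (op ⦋n + 1⦌) x.1.2 ∈ (cyclesLie (cokernel i) (n + 1)).toLieSubalgebra := by
  refine mem_cyclesLie_succ.2 fun j => ?_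
  refine (cokernelMk_map i (SimplexCategory.δ j).op _).trans ?_
  induction j using Fin.cases with
  | zero => exact (congrArg _ (fiber_face0 x)).trans (cokernelMk_i i _ _)
  | succ j => exact (congrArg _ (fiber_cycle_face hx j)).trans (map_zero _)

/-- If the class of `γ` in `X / i(A)` is a boundary, the simplex `(a, γ)` of the homotopy fiber is a
boundary. -/
theorem fiber_isBoundary_of_relMk {n : ℕ}
    (hi : Function.Injective (RLieCat.lieHom (i.app (op ⦋n⦌))))
    {x : (fiber i) _⦋n⦌} (hx : x ∈ (cyclesLie (fiber i) n).toLieSubalgebra)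
    (h : relMk i (show X _⦋n + 1⦌ from x.1.2) ∈ boundaries (relQuot i) (n + 1)) :
    IsBoundary (fiber i) n x := by
  have hxf := fiber_cycle_face hx
  have hx0 := fiber_face0 x
  set γ : X _⦋n + 1⦌ := x.1.2
  obtain ⟨w, hw, hw0⟩ := mem_boundaries.1 h
  obtain ⟨w, hws, rfl⟩ := SimplicialAddHom.exists_normalized_lift (relProj_isSurjective i) hw
  let w' : X _⦋n + 2⦌ := w
  have hws' : ∀ j : Fin (n + 2), RLieCat.lieHom (X.δ j.succ) w' = 0 := hws
  obtain ⟨b, hb⟩ := (relMk_eq i).1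
    (show relMk i γ = relMk i (RLieCat.lieHom (X.δ 0) w') from hw0.symm)
  have hb' : RLieCat.lieHom (i.app (op ⦋n + 1⦌)) b = γ - RLieCat.lieHom (X.δ 0) w' := hb
  have hwd : ∀ j : Fin (n + 2), RLieCat.lieHom (X.δ j) (RLieCat.lieHom (X.δ 0) w') = 0 :=
    fun j => by rw [face_face0, hws', map_zero]
  -- As `γ = d₀ w' + i(b)`, the faces of `s₀ γ - w'` are `i(b)`, `γ` and zeros.
  refine fiber_isBoundary_iff.2 ⟨b, RLieCat.lieHom (X.σ 0) γ - w', fun j => hi ?_, hi ?_, ?_,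
    fun j => ?_, ?_⟩
  · rw [← map_face, hb', map_sub, hwd, hxf, sub_zero, map_zero]
  · rw [← map_face, hb', map_sub, hwd, sub_zero]
    exact hx0
  · rw [map_sub, face0_degen, hb']
  · rw [map_sub, face_degen, hxf, map_zero, hws', sub_zero]
  · have h1 : RLieCat.lieHom (X.δ 1) w' = 0 := hws' 0
    rw [map_sub, face1_degen, h1, sub_zero]

theorem fiberToCokernel_injective
    (hi : ∀ m : ℕ, Function.Injective (RLieCat.lieHom (i.app (op ⦋m⦌)))) {n : ℕ}
    (h : (relToCokernel i).KerAcyclic (n + 1)) : Function.Injective (fiberToCokernel i n) := by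
  refine (injective_iff_map_eq_zero _).2 fun x hx => ?_
  obtain ⟨x, hxc, rfl⟩ := piMk_surj x
  have hγc := cokernelMk_mem_cycles hxc
  rw [fiberToCokernel_piMk hxc hγc, piMk_eq_zero] at hx
  refine piMk_eq_zero.2 (fiber_isBoundary_of_relMk (hi n) hxc ?_)
  refine h.mem_boundaries (relToCokernel_isSurjective i) (mem_cycles_succ.2 fun j => ?_)
    (mem_boundaries.2 hx)
  refine (relMk_eq_zero i).2 ?_
  change RLieCat.lieHom (X.δ j) (show X _⦋n + 1⦌ from x.1.2) ∈ _
  induction j using Fin.cases with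
  | zero =>
    rw [fiber_face0]
    exact app_mem_imageSub i _
  | succ j =>
    rw [fiber_cycle_face hxc j]
    exact zero_mem _

theorem fiberToCokernel_surjective
    (hi : ∀ m : ℕ, Function.Injective (RLieCat.lieHom (i.app (op ⦋m⦌)))) {n : ℕ}
    (h : (relToCokernel i).KerAcyclic n) : Function.Surjective (fiberToCokernel i n) := by
  intro t
  obtain ⟨z, hz, rfl⟩ := piMk_surj t
  obtain ⟨y, hy, e⟩ := h.exists_cycle (relToCokernel_isSurjective i)
    (z := z) (show z ∈ cycles ((oblvFunctor p k).obj (cokernel i)) (n + 1) from hz)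
  obtain ⟨x, hx, rfl⟩ := exists_fiber_cycle hi hy
  refine ⟨piMk _ n x hx, ?_⟩
  rw [fiberToCokernel_piMk hx (cokernelMk_mem_cycles hx), piMk_eq,
    show cokernelMk i (op ⦋n + 1⦌) x.1.2 = z from e, sub_self]
  exact ⟨0, fun _ => map_zero _, map_zero _⟩

theorem fiberToCokernel_homotopyXi (n : ℕ) (x : homotopyGroup (fiber i) n) :
    fiberToCokernel i n (homotopyXi _ n x) =
      homotopyXi (cokernel i) (n + 1) (fiberToCokernel i n x) := by
  obtain ⟨x, hx, rfl⟩ := piMk_surj x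
  have hp := (cyclesLie (fiber i) n).pOp_mem x hx
  rw [homotopyXi_piMk, fiberToCokernel_piMk hp (cokernelMk_mem_cycles hp),
    fiberToCokernel_piMk hx (cokernelMk_mem_cycles hx), homotopyXi_piMk, piMk_eq]
  have e : pOp p k (cokernelMk i (op ⦋n + 1⦌) x.1.2) =
      cokernelMk i (op ⦋n + 1⦌) (pOp p k (show X _⦋n + 1⦌ from x.1.2)) :=
    (imageIdeal i (op ⦋n + 1⦌)).pOp_mkLie _
  rw [e]
  refine ⟨0, fun _ => map_zero _, (map_zero _).trans (sub_self _).symm⟩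

end cokernel

/-! ### The relative Hurewicz theorem -/

section relativeHurewicz

variable {p : ℕ} {k : Type u} [Field k] [Fact p.Prime] {A L : SRLieCat p k} {ι : A ⟶ L}

theorem CofibrantFactorization.injective (F : CofibrantFactorization ι) (m : ℕ) :
    Function.Injective (RLieCat.lieHom (F.i.app (op ⦋m⦌))) := cofibration_injective F.cof ⦋m⦌

/-- For an `n`-connected pair, the quotient of simplicial vector spaces that belongs to a cofibrant
factorization has no homotopy in degrees at most `n`, since its homotopy groups are the relative
ones. -/
theorem relQuot_acyclic_of_isConnectedPair (F : CofibrantFactorization ι) {n : ℕ}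
    (h : IsConnectedPair ι n) : ∀ j ≤ n, ∀ z ∈ cycles (relQuot F.i) j,
      z ∈ boundaries (relQuot F.i) j := by
  intro j hj z hz
  have hs := h j hj
  cases j with
  | zero =>
    obtain ⟨x, rfl⟩ := relProj_isSurjective F.i 0 z
    have htop : LinearMap.range (homotopyMap ι 0) = ⊤ := Submodule.Quotient.subsingleton_iff.1 hs
    obtain ⟨a, ha⟩ := LinearMap.range_eq_top.1 htop (homotopyMap F.q 0 (piMk F.obj 0 x trivial))
    obtain ⟨a, ha', rfl⟩ := piMk_surj a
    have ha : homotopyMap (F.i ≫ F.q) 0 (piMk A 0 a ha') =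
        homotopyMap F.q 0 (piMk F.obj 0 x trivial) := by
      rw [F.fac]
      exact ha
    rw [homotopyMap_comp] at ha
    obtain ⟨w, hw, hw0⟩ := piMk_eq.1 ((F.acyclic.1 0).1 ha)
    let x' : F.obj _⦋0⦌ := x
    have hb := (relProj F.i).map_boundaries (n := 0)
      (y := RLieCat.lieHom (F.i.app (op ⦋0⦌)) a - x') (mem_boundaries.2 ⟨w, hw, hw0⟩)
    have hx : relMk F.i x' = -relMk F.i (RLieCat.lieHom (F.i.app (op ⦋0⦌)) a - x') := by
      rw [relMk_sub, (relMk_eq_zero F.i).2 (app_mem_imageSub F.i a), zero_sub, neg_neg]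
    exact (congrArg (· ∈ boundaries (relQuot F.i) 0) hx).mpr (neg_mem hb)
  | succ j =>
    have hs' : Subsingleton (homotopyGroup (fiber ι) j) := hs
    have hsub : Subsingleton (homotopyGroup (fiber F.i) j) :=
      (fiberMap_bijective F.fac F.acyclic.1 j).1.subsingleton
    obtain ⟨x, hx, rfl⟩ := exists_fiber_cycle F.injective hz
    obtain ⟨b, w, hb, hb0, hw0, hw, hw1⟩ := fiber_isBoundary_iff.1
      (piMk_eq_zero.1 (hsub.elim (piMk _ j x hx) 0))
    rw [← hw1]
    exact d1_mem_boundaries (Y := relQuot F.i) (relMk F.i w)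
      ((relMk_eq_zero F.i).2 (by
        change RLieCat.lieHom (F.obj.δ 0) w ∈ _
        rw [hw0]
        exact app_mem_imageSub F.i b))
      (fun l => (relMk_eq_zero F.i).2 (by
        change RLieCat.lieHom (F.obj.δ l.succ.succ) w ∈ _
        rw [hw l]
        exact zero_mem _))

variable [CharP k p]

theorem relativeHurewicz_homotopyMap (F : CofibrantFactorization ι)
    (Q : CofibrantReplacement (cofiber F)) (m : ℕ) (x : homotopyGroup (fiber F.i) m) :
    relativeHurewicz F Q m (homotopyMap (fiberMap F.fac) m x) =
      hurewicz Q (m + 1) (fiberToCokernel F.i m x) := by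
  refine congrArg (fun y => hurewicz Q (m + 1) (fiberToCokernel F.i m y)) ?_
  exact (LinearEquiv.ofBijective (homotopyMap (fiberMap F.fac) m)
    (fiberMap_bijective F.fac F.acyclic.1 m)).symm_apply_apply x

theorem relativeHurewicz_relativeXi (F : CofibrantFactorization ι)
    (Q : CofibrantReplacement (cofiber F)) (m : ℕ) (x : relativeHomotopy ι (m + 1)) :
    relativeHurewicz F Q m (relativeXi ι m x) =
      TwistedPoly.X p k • relativeHurewicz F Q m x := by
  obtain ⟨x, rfl⟩ := (fiberMap_bijective F.fac F.acyclic.1 m).2 x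
  refine (congrArg (relativeHurewicz F Q m)
    (homotopyMap_homotopyXi (fiberMap F.fac) m x).symm).trans
    ((relativeHurewicz_homotopyMap F Q m _).trans ?_)
  rw [fiberToCokernel_homotopyXi]
  exact (hurewicz_homotopyXi Q (m + 1) _).trans
    (congrArg (TwistedPoly.X p k • ·) (relativeHurewicz_homotopyMap F Q m x).symm)

/-- The relative Hurewicz theorem. -/
theorem relativeHurewicz_of_connected (F : CofibrantFactorization ι)
    (Q : CofibrantReplacement (cofiber F)) {n : ℕ} (h : IsConnectedPair ι n)
    (h0 : Subsingleton (homotopyGroup A 0)) : Function.Bijective (relativeHurewicz F Q n) ∧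
      Function.Surjective (relativeHurewicz F Q (n + 1)) := by
  have hV := relQuot_acyclic_of_isConnectedPair F h
  have hk : ∀ m ≤ n + 1, (relToCokernel F.i).KerAcyclic m := fun m hm =>
    relToCokernel_kerAcyclic (relAcyclic_imageFamily F.cof h0 hV hm)
  obtain ⟨h1, h2⟩ := hurewicz_of_connected Q (n := n) fun j hj =>
    cokernel_subsingleton (i := F.i) (fun m hm => hk m (by omega)) (hV j hj)
  have hsymm : ∀ m, Function.Bijective (LinearEquiv.ofBijective (homotopyMap (fiberMap F.fac) m)
    (fiberMap_bijective F.fac F.acyclic.1 m)).symm := fun m => LinearEquiv.bijective _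
  exact ⟨h1.comp (Function.Bijective.comp (g := fiberToCokernel F.i n)
    ⟨fiberToCokernel_injective F.injective (hk (n + 1) le_rfl),
    fiberToCokernel_surjective F.injective (hk n (Nat.le_succ n))⟩ (hsymm n)),
    h2.comp ((fiberToCokernel_surjective F.injective (hk (n + 1) le_rfl)).comp
      (hsymm (n + 1)).surjective)⟩

end relativeHurewicz

/-! ### Homotopy invariance of homology -/

section invariance

variable {p : ℕ} {k : Type u} [Field k] [Fact p.Prime] [CharP k p]

/-- A weak equivalence between cofibrant objects induces isomorphisms on the homotopy groups of the
abelianizations: it has a homotopy section, which in turn has a homotopy section. -/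
theorem abChainsMap_bijective {X Y : SRLieCat p k} (hX : cofibrations p k (fromZero X))
    (hY : cofibrations p k (fromZero Y)) {φ : X ⟶ Y} (hφ : IsWeakEquiv φ) (n : ℕ) :
    Function.Bijective (PiGroup.map (abChainsMap φ) n) := by
  have key : ∀ {X Y : SRLieCat p k} (hY : cofibrations p k (fromZero Y)) {φ : X ⟶ Y}
      (hφ : IsWeakEquiv φ), ∃ ψ : Y ⟶ X, IsWeakEquiv ψ ∧
        ∀ x, PiGroup.map (abChainsMap φ) n (PiGroup.map (abChainsMap ψ) n x) = x := by
    intro X Y hY φ hφ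
    obtain ⟨ψ, H, -, -⟩ := exists_homotopy_section (fromZero_comp φ) hY hφ
    refine ⟨ψ, hφ.of_comp_right fun m => ?_, fun x => ?_⟩
    · rw [H.homotopyMap_eq m]
      exact Function.bijective_iff_has_inverse.2
        ⟨id, fun x => homotopyMap_id Y m x, fun x => homotopyMap_id Y m x⟩
    · have h := (H.whisker (abFunctor p k ⋙ tensorFunctor (TwistedPoly p k) (TwistedPoly p k)
        (TwistedPoly p k))).map_eq n x
      rw [← PiGroup.map_comp, ← Functor.map_comp]
      refine h.trans ?_
      rw [CategoryTheory.Functor.map_id, PiGroup.map_id]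
  obtain ⟨ψ, hψ, h1⟩ := key hY hφ
  obtain ⟨ψ', -, h2⟩ := key hX hψ
  refine ⟨fun x y hxy => ?_, fun y => ⟨_, h1 y⟩⟩
  rw [← h2 x, ← h2 y, h1, h1] at hxy
  rw [← h2 x, ← h2 y, hxy]

end invariance

/-! ### Cokernels of cofibrations -/

section cokernelCofibration

variable {p : ℕ} {k : Type u} [Field k] [Fact p.Prime] {A Z Y : SRLieCat p k} (i : A ⟶ Z)

/-- The quotient map. -/
def cokernelProj : Z ⟶ cokernel i where
  app n := { toLieHom := cokernelMk i n, map_pOp := fun x => ((imageIdeal i n).pOp_mkLie x).symm }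
  naturality _ _ _ := rfl

variable {i}

/-- The kernel of a homomorphism, as a restricted ideal. -/
def kerIdeal {M N : RLieCat p k} (f : M ⟶ N) : RestrictedIdeal p k M where
  carrier := {x | RLieCat.lieHom f x = 0}
  add_mem' {x y} hx hy := by
    change RLieCat.lieHom f (x + y) = 0
    rw [map_add, show RLieCat.lieHom f x = 0 from hx, show RLieCat.lieHom f y = 0 from hy, add_zero]
  zero_mem' := map_zero _
  smul_mem' c x hx := by
    change RLieCat.lieHom f (c • x) = 0
    rw [map_smul, show RLieCat.lieHom f x = 0 from hx, smul_zero]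
  lie_mem {x y} hy := by
    change RLieCat.lieHom f ⁅x, y⁆ = 0
    rw [LieHom.map_lie, show RLieCat.lieHom f y = 0 from hy, lie_zero]
  pOp_mem x hx := by
    change RLieCat.lieHom f (pOp p k x) = 0
    rw [RLieCat.lieHom_pOp, show RLieCat.lieHom f x = 0 from hx, pOp_zero]

/-- The universal property of the cokernel. -/
def cokernelDesc (l : Z ⟶ Y)
    (h : ∀ n (a : A.obj n), RLieCat.lieHom (l.app n) (RLieCat.lieHom (i.app n) a) = 0) :
    cokernel i ⟶ Y where
  app n :=
    { toLinearMap := Submodule.liftQ (imageIdeal i n).toLieSubmodule.toSubmodule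
        (RLieCat.lieHom (l.app n) : Z.obj n →ₗ[k] Y.obj n) fun x hx =>
          RestrictedIdeal.mem_gen.1 hx (kerIdeal (l.app n)) (by rintro _ ⟨a, rfl⟩; exact h n a)
      map_lie' := fun {x y} => by
        obtain ⟨x, rfl⟩ := (imageIdeal i n).mkLie_surjective x
        obtain ⟨y, rfl⟩ := (imageIdeal i n).mkLie_surjective y
        exact LieHom.map_lie (RLieCat.lieHom (l.app n)) x y
      map_pOp := fun x => by
        obtain ⟨x, rfl⟩ := (imageIdeal i n).mkLie_surjective x
        refine Eq.trans (congrArg _ ((imageIdeal i n).pOp_mkLie x)) ?_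
        exact RLieCat.lieHom_pOp (l.app n) x }
  naturality m n θ := RLieCat.hom_ext fun x => by
    obtain ⟨x, rfl⟩ := (imageIdeal i m).mkLie_surjective x
    exact RLieCat.lieHom_congr (l.naturality θ) x

/-- The cokernel of a cofibration is cofibrant. -/
theorem cofibrations_fromZero_cokernel (hi : cofibrations p k i) :
    cofibrations p k (fromZero (cokernel i)) := by
  intro Y W q hq
  refine ⟨fun {u v} sq => ?_⟩
  have sq' : CommSq (toZero A ≫ fromZero Y) i q (cokernelProj i ≫ v) := ⟨by
    apply NatTrans.ext
    funext n
    refine RLieCat.hom_ext fun a => ?_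
    refine (map_zero (RLieCat.lieHom (q.app n))).trans (Eq.symm ?_)
    exact (congrArg (RLieCat.lieHom (v.app n)) (cokernelMk_i i n a)).trans (map_zero _)⟩
  have := (hi q hq).sq_hasLift sq'
  have h1 := sq'.fac_left
  have h2 := sq'.fac_right
  refine ⟨⟨⟨cokernelDesc sq'.lift fun n a =>
    RLieCat.lieHom_congr (congrArg (fun f => NatTrans.app f n) h1) a, ?_, ?_⟩⟩⟩
  · apply NatTrans.ext
    funext n
    refine RLieCat.hom_ext fun x => ?_
    exact (map_zero (RLieCat.lieHom (NatTrans.app _ n))).trans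
      (map_zero (RLieCat.lieHom (u.app n))).symm
  · apply NatTrans.ext
    funext n
    refine RLieCat.hom_ext fun x => ?_
    obtain ⟨x, rfl⟩ := (imageIdeal i n).mkLie_surjective x
    exact RLieCat.lieHom_congr (congrArg (fun f => NatTrans.app f n) h2) x

/-- Modulo commutators, the kernel of `Z → coker(i)` is the image of `i`. -/
theorem exists_sub_mem_commIdeal {n : SimplexCategoryᵒᵖ} {x : Z.obj n}
    (hx : cokernelMk i n x ∈ (commIdeal p k ((cokernel i).obj n)).toLieSubmodule) :
    ∃ a, x - RLieCat.lieHom (i.app n) a ∈ (commIdeal p k (Z.obj n)).toLieSubmodule := by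
  -- `K` is the sum of the image of `i` and the commutator ideal; it contains the ideal generated by
  -- the image of `i`, and its image `J` in the cokernel contains all brackets.
  let K : RestrictedIdeal p k (Z.obj n) :=
    { carrier := {x | ∃ a, x - RLieCat.lieHom (i.app n) a ∈
        (commIdeal p k (Z.obj n)).toLieSubmodule}
      add_mem' := by
        rintro x y ⟨a, ha⟩ ⟨b, hb⟩
        refine ⟨a + b, ?_⟩
        rw [map_add, add_sub_add_comm]
        exact add_mem ha hb
      zero_mem' := ⟨0, by rw [map_zero, sub_zero]; exact zero_mem _⟩
      smul_mem' := by
        rintro c x ⟨a, ha⟩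
        refine ⟨c • a, ?_⟩
        rw [map_smul, ← smul_sub]
        exact (commIdeal p k (Z.obj n)).toLieSubmodule.toSubmodule.smul_mem c ha
      lie_mem := fun {x y} _ => ⟨0, by
        rw [map_zero, sub_zero]
        exact lie_mem_commIdeal x y⟩
      pOp_mem := by
        rintro x ⟨a, ha⟩
        refine ⟨pOp p k a, ?_⟩
        rw [RLieCat.lieHom_pOp, ← RestrictedIdeal.mkLie_eq_iff]
        exact RestrictedIdeal.mkLie_pOp_eq _ (((commIdeal p k (Z.obj n)).mkLie_eq_iff _ _).2 ha) }
  have hK : ∀ y ∈ (imageIdeal i n).toLieSubmodule, y ∈ K.toLieSubmodule := fun y hy =>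
    RestrictedIdeal.mem_gen.1 hy K (by
      rintro _ ⟨a, rfl⟩
      exact ⟨a, by rw [sub_self]; exact zero_mem _⟩)
  let J : RestrictedIdeal p k ((cokernel i).obj n) :=
    { carrier := {y | ∃ x ∈ K.toLieSubmodule, cokernelMk i n x = y}
      add_mem' := by
        rintro _ _ ⟨x, hx, rfl⟩ ⟨y, hy, rfl⟩
        exact ⟨x + y, add_mem hx hy, map_add _ _ _⟩
      zero_mem' := ⟨0, zero_mem _, map_zero _⟩
      smul_mem' := by
        rintro c _ ⟨x, hx, rfl⟩
        exact ⟨c • x, K.toLieSubmodule.toSubmodule.smul_mem c hx, map_smul _ _ _⟩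
      lie_mem := by
        rintro z _ ⟨x, hx, rfl⟩
        obtain ⟨z, rfl⟩ := (imageIdeal i n).mkLie_surjective z
        exact ⟨⁅z, x⁆, lie_mem_right k _ K.toLieSubmodule _ _ hx, LieHom.map_lie _ _ _⟩
      pOp_mem := by
        rintro _ ⟨x, hx, rfl⟩
        exact ⟨pOp p k x, K.pOp_mem x hx, ((imageIdeal i n).pOp_mkLie x).symm⟩ }
  obtain ⟨y, hy, e⟩ := RestrictedIdeal.mem_gen.1 hx J (by
    rintro _ ⟨x, y, rfl⟩
    obtain ⟨x, rfl⟩ := (imageIdeal i n).mkLie_surjective x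
    obtain ⟨y, rfl⟩ := (imageIdeal i n).mkLie_surjective y
    exact ⟨⁅x, y⁆, ⟨0, by rw [map_zero, sub_zero]; exact lie_mem_commIdeal x y⟩,
      LieHom.map_lie _ _ _⟩)
  have h := sub_mem hy (hK _ ((RestrictedIdeal.mkLie_eq_iff _ _ _).1 e))
  rw [sub_sub_cancel] at h
  exact h

end cokernelCofibration

/-! ### The Whitehead theorem -/

/-- In a short exact sequence of simplicial modules, if the first map induces isomorphisms on
homotopy groups, the third module has no homotopy. -/
theorem acyclic_of_exact {S : Type v} {S' : Type*} {S'' : Type*} [Ring S] [Ring S'] [Ring S'']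
    {Y' : SMod.{u} S'} {Y : SMod.{u} S} {Y'' : SMod.{u} S''} (i : SimplicialAddHom Y' Y)
    (s : SimplicialAddHom Y Y'') (hi : ∀ n, Function.Injective (i.app n)) (hs : s.IsSurjective)
    (hsi : ∀ n x, s.app n (i.app n x) = 0) (hex : ∀ n y, s.app n y = 0 → ∃ x, i.app n x = y)
    (hinj : ∀ n, ∀ x ∈ cycles Y' n, i.app n x ∈ boundaries Y n → x ∈ boundaries Y' n)
    (hsurj : ∀ n, ∀ y ∈ cycles Y n, ∃ x ∈ cycles Y' n, y - i.app n x ∈ boundaries Y n) (n : ℕ) :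
    ∀ z ∈ cycles Y'' n, z ∈ boundaries Y'' n := by
  have key : ∀ n, ∀ y ∈ cycles Y n, s.app n y ∈ boundaries Y'' n := by
    intro n y hy
    obtain ⟨x, -, hx⟩ := hsurj n y hy
    have := s.map_boundaries hx
    rwa [map_sub, hsi, sub_zero] at this
  intro z hz
  cases n with
  | zero =>
    obtain ⟨y, rfl⟩ := hs 0 z
    exact key 0 y trivial
  | succ n =>
    rw [mem_cycles_succ] at hz
    obtain ⟨y, hy, rfl⟩ := SimplicialAddHom.exists_normalized_lift hs fun j => hz j.succ
    obtain ⟨a, ha⟩ := hex n ((Y.δ 0).hom y) (by rw [← s.face]; exact hz 0)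
    have hac : a ∈ cycles Y' n := by
      cases n with
      | zero => trivial
      | succ n =>
        refine mem_cycles_succ.2 fun j => hi n ?_
        rw [← i.face, ha, map_zero]
        exact mem_cycles_succ.1 (face_mem_cycles_of_forall hy) j
    obtain ⟨b, hb, rfl⟩ := mem_boundaries.1 (hinj n a hac (mem_boundaries.2 ⟨y, hy, ha.symm⟩))
    have hc : y - i.app (n + 1) b ∈ cycles Y (n + 1) := by
      refine mem_cycles_succ.2 (Fin.cases ?_ fun j => ?_)
      · rw [map_sub, i.face, ha, sub_self]
      · rw [map_sub, i.face, hb, hy, map_zero, sub_zero]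
    have := key _ _ hc
    rwa [map_sub, hsi, sub_zero] at this

section whitehead

variable {p : ℕ} {k : Type u} [Field k] [Fact p.Prime] [CharP k p]

/-- The abelianization of the cokernel of a cofibration that is a homology isomorphism has no
homotopy. -/
theorem abChains_cokernel_acyclic {A Z : SRLieCat p k} {i : A ⟶ Z} (hi : cofibrations p k i)
    (h : ∀ n, Function.Bijective (PiGroup.map (abChainsMap i) n)) (n : ℕ) :
    ∀ z ∈ cycles (abChains (cokernel i)) n, z ∈ boundaries (abChains (cokernel i)) n := by
  refine acyclic_of_exact (SimplicialAddHom.ofHom (abChainsMap i))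
    (SimplicialAddHom.ofHom (abChainsMap (cokernelProj i))) (fun m => ?_) (fun m z => ?_)
    (fun m y => ?_) (fun m y hy => ?_) (fun m => (mapSemi_injective_iff _ _).1 (h m).1)
    (fun m => (mapSemi_surjective_iff _ _).1 (h m).2) n
  · refine (injective_iff_map_eq_zero _).2 fun y hy => ?_
    obtain ⟨a, rfl⟩ := abUnit_surjective (A _⦋m⦌) y
    obtain ⟨r, hr⟩ := exists_retraction hi ⦋m⦌
    have ha := map_mem_commIdeal r (abUnit_eq_zero.1 hy)
    refine abUnit_eq_zero.2 ?_
    have e : RLieCat.lieHom r (RLieCat.lieHom (i.app (op ⦋m⦌)) a) = a := RLieCat.lieHom_congr hr a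
    exact (congrArg (· ∈ (commIdeal p k (A _⦋m⦌)).toLieSubmodule) e).mp ha
  · obtain ⟨x, rfl⟩ := abUnit_surjective ((cokernel i) _⦋m⦌) z
    obtain ⟨x, rfl⟩ := (imageIdeal i (op ⦋m⦌)).mkLie_surjective x
    exact ⟨abUnit (Z _⦋m⦌) x, rfl⟩
  · obtain ⟨a, rfl⟩ := abUnit_surjective (A _⦋m⦌) y
    refine (congrArg (abUnit ((cokernel i) _⦋m⦌)) (cokernelMk_i i (op ⦋m⦌) a)).trans (map_zero _)
  · obtain ⟨x, rfl⟩ := abUnit_surjective (Z _⦋m⦌) y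
    obtain ⟨a, ha⟩ := exists_sub_mem_commIdeal (abUnit_eq_zero.1 hy)
    refine ⟨abUnit (A _⦋m⦌) a, ?_⟩
    have e := abUnit_eq_zero.2 ha
    rw [map_sub] at e
    exact (sub_eq_zero.1 e).symm

/-- For a cofibration `i : A → Z` of connected objects that is a homology isomorphism, `Z / i(A)`
has no homotopy: by induction, its first homotopy group is that of the cokernel of `i`, and
therefore, by the Hurewicz theorem, embeds in the homology of the cokernel. -/
theorem relQuot_acyclic_of_abChainsMap {A Z : SRLieCat p k} {i : A ⟶ Z} (hi : cofibrations p k i)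
    (hA : Subsingleton (homotopyGroup A 0)) (hZ : Subsingleton (homotopyGroup Z 0))
    (h : ∀ n, Function.Bijective (PiGroup.map (abChainsMap i) n)) (n : ℕ) :
    ∀ z ∈ cycles (relQuot i) n, z ∈ boundaries (relQuot i) n := by
  induction n using Nat.strong_induction_on with
  | _ n ih =>
    intro z hz
    cases n with
    | zero =>
      obtain ⟨x, rfl⟩ := relProj_isSurjective i 0 z
      exact (relProj i).map_boundaries ((subsingleton_piGroup_iff 0).1 hZ x trivial)
    | succ n =>
      have hk : ∀ m ≤ n + 1, (relToCokernel i).KerAcyclic m := fun m hm =>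
        relToCokernel_kerAcyclic (relAcyclic_imageFamily hi hA (fun j hj => ih j (by omega)) hm)
      have hC : ∀ j ≤ n, Subsingleton (homotopyGroup (cokernel i) j) := fun j hj =>
        cokernel_subsingleton (fun m hm => hk m (by omega)) (ih j (by omega))
      have hinj := piAbUnit_injective (abHom_kerAcyclic
        (relAcyclic_commFamily (cofibrations_fromZero_cokernel hi) hC le_rfl))
      have hs : Subsingleton (PiGroup (abChains (cokernel i)) (n + 1)) :=
        (subsingleton_piGroup_iff _).2 (abChains_cokernel_acyclic hi h (n + 1))
      exact (hk (n + 1) le_rfl).mem_boundaries (relToCokernel_isSurjective i) hz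
        ((subsingleton_piGroup_iff _).1 hinj.subsingleton _ ((relToCokernel i).map_cycles hz))

/-- An injective map `i` is a weak equivalence if the quotient by its image has no homotopy. -/
theorem isWeakEquiv_of_relQuot_acyclic {A Z : SRLieCat p k} {i : A ⟶ Z}
    (hi : ∀ m : ℕ, Function.Injective (RLieCat.lieHom (i.app (op ⦋m⦌))))
    (h : ∀ n, ∀ z ∈ cycles (relQuot i) n, z ∈ boundaries (relQuot i) n) : IsWeakEquiv i := by
  intro n
  constructor
  · refine (mapSemi_injective_iff _ _).2 fun y hy hb => ?_
    obtain ⟨w, hwk, hw, hw0⟩ := SimplicialAddHom.bdIn_ker_of_acyclic (relProj_isSurjective i)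
      (h (n + 1)) ((mem_relProj_ker i).2 (app_mem_imageSub i (n := op ⦋n⦌) y)) hb
    obtain ⟨b, rfl⟩ := (mem_relProj_ker i).1 hwk
    refine mem_boundaries.2 ⟨b, fun j => hi n ?_, hi n ?_⟩
    · exact (map_face i j.succ b).symm.trans ((hw j).trans (map_zero _).symm)
    · exact (map_face i 0 b).symm.trans hw0
  · refine (mapSemi_surjective_iff _ _).2 fun z hz => ?_
    obtain ⟨x, hx, hxk, hb⟩ := SimplicialAddHom.exists_cycle_ker (relProj_isSurjective i) (h n) hz
    obtain ⟨a, rfl⟩ := (mem_relProj_ker i).1 hxk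
    refine ⟨a, ?_, hb⟩
    cases n with
    | zero => trivial
    | succ n =>
      refine mem_cycles_succ.2 fun j => hi n ?_
      exact (map_face i j a).symm.trans ((mem_cycles_succ.1 hx j).trans (map_zero _).symm)

variable {L' L : SRLieCat p k} (f : L' ⟶ L) (Q' : CofibrantReplacement L')
  (Q : CofibrantReplacement L)

/-- Being a weak equivalence can be tested on cofibrant replacements. -/
theorem isWeakEquiv_lift_iff :
    IsWeakEquiv (CofibrantReplacement.lift Q' Q f) ↔ IsWeakEquiv f := by
  have e := CofibrantReplacement.lift_q Q' Q f
  constructor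
  · intro h
    have h' := h.comp Q.acyclic.1
    rw [e] at h'
    exact Q'.acyclic.1.of_comp_left h'
  · intro h
    have h' := Q'.acyclic.1.comp h
    rw [← e] at h'
    exact Q.acyclic.1.of_comp_right h'

/-- The homological Whitehead theorem. -/
theorem isWeakEquiv_iff_xiHomologyMap (h' : Subsingleton (homotopyGroup L' 0))
    (h : Subsingleton (homotopyGroup L 0)) :
    IsWeakEquiv f ↔ ∀ i : ℕ, 1 ≤ i → Function.Bijective (xiHomologyMap Q' Q f i) := by
  rw [← isWeakEquiv_lift_iff f Q' Q]
  set g := CofibrantReplacement.lift Q' Q f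
  have hQ' := Q'.cofibrations_fromZero
  have hQ := Q.cofibrations_fromZero
  constructor
  · intro hg i hi
    obtain ⟨i, rfl⟩ : ∃ j, i = j + 1 := ⟨i - 1, by omega⟩
    exact abChainsMap_bijective hQ' hQ hg i
  · intro H
    obtain ⟨G⟩ := nonempty_cofibrantFactorization g
    have hZ : cofibrations p k (fromZero G.obj) := by
      rw [← fromZero_comp G.i]
      exact MorphismProperty.comp_mem (acyclicFibrations p k).llp _ _ hQ' G.cof
    have hq := abChainsMap_bijective hZ hQ G.acyclic.1
    have hi : ∀ n, Function.Bijective (PiGroup.map (abChainsMap G.i) n) := by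
      intro n
      refine (Function.Bijective.of_comp_iff' (hq n) _).1 ?_
      have e : ⇑(PiGroup.map (abChainsMap G.q) n) ∘ ⇑(PiGroup.map (abChainsMap G.i) n) =
          PiGroup.map (abChainsMap g) n := by
        funext x
        refine (PiGroup.map_comp _ _ n x).symm.trans ?_
        rw [← Functor.map_comp, G.fac]
      rw [e]
      exact H (n + 1) (Nat.succ_pos n)
    have hA := subsingleton_of_isWeakEquiv Q'.acyclic.1 h'
    have hZ0 := subsingleton_of_isWeakEquiv G.acyclic.1 (subsingleton_of_isWeakEquiv Q.acyclic.1 h)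
    have hiw := isWeakEquiv_of_relQuot_acyclic G.injective
      (relQuot_acyclic_of_abChainsMap G.cof hA hZ0 hi)
    rw [← G.fac]
    exact hiw.comp G.acyclic.1

end whitehead

end SRLie

end

theorem mainTheorem8 {k : Type u} [Field k] [PerfectField k] (p : ℕ) [Fact p.Prime] [CharP k p] :
    -- cofibrant replacements and factorizations, hence homology and homotopy cofibers, exist
    (∀ {A L : SRLieCat p k} (f : A ⟶ L), Nonempty (CofibrantFactorization f)) ∧
    -- the Hurewicz theorem
    (∀ (L : SRLieCat p k) (Q : CofibrantReplacement L),
      (∀ (s : ℕ) (x : homotopyGroup L s),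
        hurewicz Q s (homotopyXi L s x) = TwistedPoly.X p k • hurewicz Q s x) ∧
      (∃ e : Ab p k (homotopyLie L 0) ≃ₗ[TwistedPoly p k] xiHomology Q 1,
        ∀ x : homotopyGroup L 0,
          e (Ab.mk p k (homotopyLie L 0) (toHomotopyLie L 0 x)) = hurewicz Q 0 x) ∧
      (∀ n : ℕ, (∀ i ≤ n, Subsingleton (homotopyGroup L i)) →
        Function.Bijective (hurewicz Q (n + 1)) ∧ Function.Surjective (hurewicz Q (n + 2)))) ∧
    -- the relative Hurewicz theorem
    (∀ {A L : SRLieCat p k} (ι : A ⟶ L),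
      (∀ m : ℕ, Function.Injective (RLieCat.lieHom (ι.app (op ⦋m⦌)))) →
      ∀ (F : CofibrantFactorization ι) (Q : CofibrantReplacement (cofiber F)),
        (∀ (m : ℕ) (x : relativeHomotopy ι (m + 1)),
          relativeHurewicz F Q m (relativeXi ι m x) =
            TwistedPoly.X p k • relativeHurewicz F Q m x) ∧
        (∀ n : ℕ, 1 ≤ n → IsConnectedPair ι n → Subsingleton (homotopyGroup A 0) →
          Function.Bijective (relativeHurewicz F Q n) ∧
          Function.Surjective (relativeHurewicz F Q (n + 1)))) ∧
    -- the homological Whitehead theorem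
    (∀ {L' L : SRLieCat p k} (f : L' ⟶ L) (Q' : CofibrantReplacement L')
      (Q : CofibrantReplacement L),
      Subsingleton (homotopyGroup L' 0) → Subsingleton (homotopyGroup L 0) →
        (IsWeakEquiv f ↔ ∀ i : ℕ, 1 ≤ i → Function.Bijective (xiHomologyMap Q' Q f i))) := by
  refine ⟨fun f => nonempty_cofibrantFactorization f,
    fun L Q => ⟨hurewicz_homotopyXi Q, exists_equiv_hurewicz_zero Q,
      fun n h => hurewicz_of_connected Q h⟩,
    fun ι _ F Q => ⟨relativeHurewicz_relativeXi F Q,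
      fun n _ h h0 => relativeHurewicz_of_connected F Q h h0⟩,
    fun f Q' Q h' h => isWeakEquiv_iff_xiHomologyMap f Q' Q h' h⟩
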